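/- Let $V,H$ be real Hilbert spaces forming a Gelfand triple $V\hookrightarrow H\cong H^*\hookrightarrow V^*$ with dense and compact embedding $V\hookrightarrow H$. Let $a\colon V\times V\to\mathbb R$ be a continuous bilinear form such that $a(v,v)+\omega_0\|v\|_H^2\ge\alpha_0\|v\|_V^2$ for all $v\in V$, with constants $\alpha_0>0$, $\omega_0\ge 0$, and let $A\colon V\to V^*$, $\langle Ay,v\rangle=a(y,v)$, with adjoint $A^*\colon V\to V^*$, $\langle A^*y,v\rangle=a(v,y)$. Let $\omega=\{1,\dots,N\}$ be equipped with the counting measure, so that $L^2(\omega)=\mathbb R^{N}$ (purely time-dependent controls), let $B\colon L^2(\omega)\to V^*$ be linear and continuous, let $u_a,u_b\in L^\infty(\omega)$ with $u_a<u_b$, and let $y_0,y_d\in H$ and $\delta_0>0$. For $T>0$ let $W(0,T)=H^1((0,T);V^*)\cap L^2((0,T);V)$ (whose elements have a representative in $C([0,T];H)$) and $$U_{ad}(0,T)=\{u\in L^2((0,T);L^2(\omega)) : u_a\le u(t)\le u_b \text{ on } \omega \text{ for a.e. } t\in(0,T)\}.$$ For $u\in U_{ad}(0,T)$ let $y[u]\in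 W(0,T)$ solve $\partial_t y+Ay=Bu$, $y(0)=y_0$, and define the minimal distance value function $$\delta(T)=\inf_{u\in U_{ad}(0,T)}\|y[u](T)-y_d\|_H-\delta_0,\qquad T>0.$$ For $\nu>0$ and $u\in U_{ad}(0,1)$ let $S(\nu,u)=y\in W(0,1)$ solve $\partial_t y+\nu Ay=\nu Bu$ on $(0,1)$, $y(0)=y_0$, and let $\bar u(\nu)$ be the set of minimizers of $u\mapsto\|S(\nu,u)(1)-y_d\|_H$ over $U_{ad}(0,1)$. Let $\nu>0$ be such that $\delta(\nu)>-\delta_0$. Then $\bar u(\nu)\neq\emptyset$, and there is a number $d\in\mathbb R$ such that for every $u\in\bar u(\nu)$, even if the minimizer is not unique, $$\int_0^1\langle Bu(t)-Ay(t),p(t)\rangle_{V^*,V}\,dt=d,$$ where $y=S(\nu,u)$ and $p\in W(0,1)$ is the solution of $-\partial_t p+\nu A^*p=0$ on $(0,1)$, $p(1)=(y(1)-y_d)/\|y(1)-y_d\|_H$ (the state and the adjoint state exist and are unique). Moreover, $\delta(\cdot)$ is continuously differentiable in a neighbourhood of $\nu$, and $\delta'(\nu)=d$. -/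

import Mathlib

open MeasureTheory Set

namespace ParabolicControl

/-- The data of a linear parabolic control system with bilateral control constraints:
a Gelfand triple `V ↪ H ≅ H* ↪ V*` with compact dense embedding `ι : V → H`, a continuous
bilinear form `a` on `V` satisfying Gårding's inequality, a bounded control operator
`B : L²(ω, ρ) → V*`, bounds `ua < ub` in `L^∞(ω, ρ)`, an initial state `y0`, a desired state `yd`
and a radius `δ0 > 0`.  The operator `A : V → V*`, `⟨A y, v⟩ = a(y, v)`, is `a` itself,
and its adjoint `A* : V → V*` is `a.flip`. -/
structure ControlSystem (V H ω : Type*)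
    [NormedAddCommGroup V] [InnerProductSpace ℝ V] [CompleteSpace V]
    [NormedAddCommGroup H] [InnerProductSpace ℝ H] [CompleteSpace H]
    [MeasurableSpace ω] (ρ : Measure ω) where
  /-- the embedding of `V` into `H` -/
  ι : V →L[ℝ] H
  ι_injective : Function.Injective ι
  ι_compact : IsCompactOperator ι
  ι_dense : DenseRange ι
  /-- the bilinear form, i.e. the operator `A : V → V*` -/
  a : V →L[ℝ] StrongDual ℝ V
  garding : ∃ α₀ ω₀ : ℝ, 0 < α₀ ∧ 0 ≤ ω₀ ∧
    ∀ v : V, α₀ * ‖v‖ ^ 2 ≤ a v v + ω₀ * ‖ι v‖ ^ 2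
  /-- the control operator -/
  B : Lp ℝ 2 ρ →L[ℝ] StrongDual ℝ V
  /-- the lower control bound -/
  ua : ω → ℝ
  /-- the upper control bound -/
  ub : ω → ℝ
  ua_memLp : MemLp ua ⊤ ρ
  ub_memLp : MemLp ub ⊤ ρ
  ua_lt_ub : ∀ᵐ x ∂ρ, ua x < ub x
  /-- the initial state -/
  y0 : H
  /-- the desired state -/
  yd : H
  /-- the radius of the target ball -/
  δ0 : ℝ
  δ0_pos : 0 < δ0

/-- Lebesgue measure on the time interval `(0, T)`. -/
noncomputable def timeMeasure (T : ℝ) : Measure ℝ := volume.restrict (Ioo 0 T)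

namespace ControlSystem

variable {V H ω : Type*}
  [NormedAddCommGroup V] [InnerProductSpace ℝ V] [CompleteSpace V]
  [NormedAddCommGroup H] [InnerProductSpace ℝ H] [CompleteSpace H]
  [MeasurableSpace ω] {ρ : Measure ω}

/-- The embedding `H ≅ H* ↪ V*` of the Gelfand triple, `h ↦ (v ↦ (h, ι v)_H)`. -/
noncomputable def toDual (S : ControlSystem V H ω ρ) (h : H) : StrongDual ℝ V :=
  (innerSL ℝ h).comp S.ι

/-- `g : (0, T) → V*` is the weak (distributional) time derivative of `y : (0, T) → V`. -/
def HasWeakDeriv (S : ControlSystem V H ω ρ) (T : ℝ) (y : ℝ → V) (g : ℝ → StrongDual ℝ V) :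
    Prop :=
  ∀ φ : ℝ → ℝ, ContDiff ℝ (⊤ : ℕ∞) φ → HasCompactSupport φ → tsupport φ ⊆ Ioo 0 T →
    ∫ t, deriv φ t • S.toDual (S.ι (y t)) ∂(timeMeasure T) = - ∫ t, φ t • g t ∂(timeMeasure T)

/-- `y ∈ W(0, T) = H¹((0, T); V*) ∩ L²((0, T); V)` with time derivative `g`.
Functions stand for their classes modulo equality almost everywhere on `(0, T)`. -/
structure MemW (S : ControlSystem V H ω ρ) (T : ℝ) (y : ℝ → V) (g : ℝ → StrongDual ℝ V) :
    Prop where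
  memLp : MemLp y 2 (timeMeasure T)
  memLp_deriv : MemLp g 2 (timeMeasure T)
  weakDeriv : S.HasWeakDeriv T y g

/-- `h ∈ H` is the value at time `t ∈ [0, T]` of (the representative in `C([0, T]; H)` of) `y`. -/
def HasTrace (S : ControlSystem V H ω ρ) (T : ℝ) (y : ℝ → V) (t : ℝ) (h : H) : Prop :=
  ∃ Y : ℝ → H, ContinuousOn Y (Icc 0 T) ∧ (∀ᵐ s ∂(timeMeasure T), Y s = S.ι (y s)) ∧ Y t = h

/-- The admissible control values `{u ∈ L²(ω) : ua ≤ u ≤ ub a.e.}`. -/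
def Uad (S : ControlSystem V H ω ρ) : Set (Lp ℝ 2 ρ) :=
  {u | ∀ᵐ x ∂ρ, S.ua x ≤ u x ∧ u x ≤ S.ub x}

/-- The admissible controls on `(0, T)`:
`u ∈ L²((0, T); L²(ω))` with `u(t)` an admissible value for almost every `t ∈ (0, T)`. -/
def UadTime (S : ControlSystem V H ω ρ) (T : ℝ) : Set (ℝ → Lp ℝ 2 ρ) :=
  {u | MemLp u 2 (timeMeasure T) ∧ ∀ᵐ t ∂(timeMeasure T), u t ∈ S.Uad}

/-- `y ∈ W(0, T)` solves `∂ₜ y + ν A y = ν B u` in `V*` on `(0, T)`, `y(0) = y0`. For `ν = 1` this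
is the state equation on `(0, T)`, for `T = 1` the one transformed to the reference interval. -/
def IsState (S : ControlSystem V H ω ρ) (T ν : ℝ) (u : ℝ → Lp ℝ 2 ρ) (y : ℝ → V) : Prop :=
  (∃ g : ℝ → StrongDual ℝ V, S.MemW T y g ∧
    ∀ᵐ t ∂(timeMeasure T), g t + ν • S.a (y t) = ν • S.B (u t)) ∧
  S.HasTrace T y 0 S.y0

/-- The state with control `u` on `(0, T)` (and speed `ν`) has the value `h` at the final time. -/
def Reaches (S : ControlSystem V H ω ρ) (T ν : ℝ) (u : ℝ → Lp ℝ 2 ρ) (h : H) : Prop :=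
  ∃ y : ℝ → V, S.IsState T ν u y ∧ S.HasTrace T y T h

/-- The minimal distance value function
`δ(T) = inf {‖y[u](T) - yd‖ - δ0 : u admissible on (0, T)}`. -/
noncomputable def minDist (S : ControlSystem V H ω ρ) (T : ℝ) : ℝ :=
  sInf {r : ℝ | ∃ u ∈ S.UadTime T, ∃ h : H, S.Reaches T 1 u h ∧ r = ‖h - S.yd‖ - S.δ0}

/-- The set `ū(ν)` of minimizers of `‖y(1) - yd‖` among the admissible controls on `(0, 1)`,
`y` being the state transformed to the reference interval. -/
def argminSet (S : ControlSystem V H ω ρ) (ν : ℝ) : Set (ℝ → Lp ℝ 2 ρ) :=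
  {u | u ∈ S.UadTime 1 ∧ ∃ h : H, S.Reaches 1 ν u h ∧
    ∀ u' ∈ S.UadTime 1, ∀ h' : H, S.Reaches 1 ν u' h' → ‖h - S.yd‖ ≤ ‖h' - S.yd‖}

/-- `p ∈ W(0, 1)` solves the adjoint equation `-∂ₜ p + ν A* p = 0` on `(0, 1)`, `p(1) = p1`. -/
def IsAdjointState (S : ControlSystem V H ω ρ) (ν : ℝ) (p1 : H) (p : ℝ → V) : Prop :=
  (∃ g : ℝ → StrongDual ℝ V, S.MemW 1 p g ∧
    ∀ᵐ t ∂(timeMeasure 1), -g t + ν • S.a.flip (p t) = 0) ∧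
  S.HasTrace 1 p 1 p1

/-- `d` is a value of the derivative expression `∫₀¹ ⟨B u - A y, p⟩ dt` at `(ν, u)`, where `y` is the
transformed state of `u` and `p` the adjoint state with `p(1) = (y(1) - yd) / ‖y(1) - yd‖`. -/
def IsDerivExpr (S : ControlSystem V H ω ρ) (ν : ℝ) (u : ℝ → Lp ℝ 2 ρ) (d : ℝ) : Prop :=
  ∃ (y p : ℝ → V) (h : H), S.IsState 1 ν u y ∧ S.HasTrace 1 y 1 h ∧
    S.IsAdjointState ν (‖h - S.yd‖⁻¹ • (h - S.yd)) p ∧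
    d = ∫ t, (S.B (u t) - S.a (y t)) (p t) ∂(timeMeasure 1)

end ControlSystem

end ParabolicControl

open Filter Topology

set_option linter.unusedSectionVars false

namespace ParabolicControl

section Generation

variable {H : Type*} [NormedAddCommGroup H] [InnerProductSpace ℝ H]

/-- `R` is a bounded operator that behaves like the inverse of a sectorial operator: it is
accretive, satisfies a sector condition with constant `M`, and has dense range. -/
structure IsSectorialInverse (R : H →L[ℝ] H) (M : ℝ) : Prop where
  one_le : 1 ≤ M
  nonneg : ∀ g, 0 ≤ inner ℝ g (R g)
  sector : ∀ g h, inner ℝ g (R h) ^ 2 ≤ M ^ 2 * (inner ℝ g (R g) * inner ℝ h (R h))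
  dense : DenseRange R

/-- The operator semigroup `exp(-tA)` generated by a bounded operator. -/
noncomputable def expFlow (A : H →L[ℝ] H) (t : ℝ) : H →L[ℝ] H := NormedSpace.exp (t • (-A))

lemma expFlow_zero (A : H →L[ℝ] H) : expFlow A 0 = 1 := by
  simp [expFlow, NormedSpace.exp_zero]

lemma commute_expFlow {A C : H →L[ℝ] H} (h : Commute C A) (t : ℝ) : Commute C (expFlow A t) := by
  exact (h.neg_right.smul_right t).exp_right

variable [CompleteSpace H]

lemma hasDerivAt_expFlow (A : H →L[ℝ] H) (h : H) (t : ℝ) :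
    HasDerivAt (fun s => expFlow A s h) (-(A (expFlow A t h))) t := by
  have := (hasDerivAt_exp_smul_const' (𝕂 := ℝ) (-A) t).clm_apply (hasDerivAt_const t h)
  simpa [expFlow] using this

lemma expFlow_add (A : H →L[ℝ] H) (s t : ℝ) : expFlow A (s + t) = expFlow A s * expFlow A t := by
  let : NormedAlgebra ℚ (H →L[ℝ] H) := NormedAlgebra.restrictScalars ℚ ℝ _
  rw [expFlow, add_smul, NormedSpace.exp_add_of_commute]
  · rfl
  · exact (Commute.refl (-A)).smul_left _ |>.smul_right _

lemma norm_expFlow_le {A : H →L[ℝ] H} (hA : ∀ w, 0 ≤ inner ℝ w (A w)) (h : H) {t : ℝ}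
    (ht : 0 ≤ t) : ‖expFlow A t h‖ ≤ ‖h‖ := by
  have hd : ∀ s, HasDerivAt (fun s => ‖expFlow A s h‖ ^ 2)
      (2 * inner ℝ (expFlow A s h) (-(A (expFlow A s h)))) s :=
    fun s => (hasDerivAt_expFlow A h s).norm_sq
  have hanti : Antitone (fun s => ‖expFlow A s h‖ ^ 2) := by
    apply antitone_of_deriv_nonpos (fun s => (hd s).differentiableAt)
    intro s
    rw [(hd s).deriv, inner_neg_right]
    linarith [hA (expFlow A s h)]
  have := hanti ht
  simp only [expFlow_zero, one_apply_eq_self] at this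
  exact le_of_abs_le (abs_le_of_sq_le_sq this (norm_nonneg _))

/-- The smoothing estimate: for a sectorial `A`, `‖A exp(-tA)‖ ≤ M / (2t)` with `M` depending on the
sector only. The proof is a Lyapunov function. -/
lemma norm_generator_expFlow_le {A R : H →L[ℝ] H} {M : ℝ} (hM : 0 ≤ M)
    (hRA : ∀ h, R (A h) = h) (hR : ∀ g, 0 ≤ inner ℝ g (R g))
    (hsec : ∀ g h, inner ℝ g (R h) ^ 2 ≤ M ^ 2 * (inner ℝ g (R g) * inner ℝ h (R h)))
    (h : H) {t : ℝ} (ht : 0 ≤ t) : t * ‖A (expFlow A t h)‖ ≤ M / 2 * ‖h‖ := by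
  set y := fun s => expFlow A s h with hy
  have hd0 : ∀ s, HasDerivAt y (-(A (y s))) s := hasDerivAt_expFlow A h
  have hd1 : ∀ s, HasDerivAt (fun s => A (y s)) (A (-(A (y s)))) s :=
    fun s => A.hasFDerivAt.comp_hasDerivAt s (hd0 s)
  set Φ := fun s => s ^ 2 * ‖A (y s)‖ ^ 2 + M ^ 2 / 4 * ‖y s‖ ^ 2 with hΦ
  have hd : ∀ s, HasDerivAt Φ ((2 * s) * ‖A (y s)‖ ^ 2 +
      s ^ 2 * (2 * inner ℝ (A (y s)) (A (-(A (y s))))) +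
      M ^ 2 / 4 * (2 * inner ℝ (y s) (-(A (y s))))) s := by
    intro s
    have h2 : HasDerivAt (fun s : ℝ => s ^ 2) (2 * s) s := by simpa using hasDerivAt_pow 2 s
    exact (h2.mul (hd1 s).norm_sq).add ((hd0 s).norm_sq.const_mul _)
  have hanti : AntitoneOn Φ (Ici 0) := by
    apply antitoneOn_of_deriv_nonpos (convex_Ici 0)
      (fun s _ => (hd s).continuousAt.continuousWithinAt)
      (fun s _ => (hd s).differentiableAt.differentiableWithinAt)
    intro s hs
    rw [interior_Ici, mem_Ioi] at hs
    rw [(hd s).deriv]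
    set w := A (y s) with hw
    have hyw : y s = R w := (hRA _).symm
    have hww : w = R (A w) := (hRA _).symm
    have h1 : inner ℝ (y s) (-w) = -inner ℝ w (R w) := by
      rw [inner_neg_right, hyw, real_inner_comm]
    have h2 : inner ℝ w (A (-w)) = -inner ℝ (A w) (R (A w)) := by
      rw [map_neg, inner_neg_right, real_inner_comm, ← hww]
    have h3 : ‖w‖ ^ 2 = inner ℝ w (R (A w)) := by rw [← hww, real_inner_self_eq_norm_sq]
    have h4 := hsec w (A w)
    rw [h1, h2, h3]
    set p := inner ℝ w (R (A w))
    have ha := hR w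
    have hb := hR (A w)
    set a := inner ℝ w (R w)
    set b := inner ℝ (A w) (R (A w))
    have h5 : s * p ≤ s ^ 2 * b + M ^ 2 / 4 * a := by
      refine le_of_abs_le (abs_le_of_sq_le_sq ?_ (by positivity))
      calc (s * p) ^ 2 = s ^ 2 * p ^ 2 := by ring
        _ ≤ s ^ 2 * (M ^ 2 * (a * b)) := by gcongr
        _ ≤ _ := by nlinarith [sq_nonneg (s ^ 2 * b - M ^ 2 / 4 * a)]
    linarith
  have := hanti self_mem_Ici ht ht
  have h0 : y 0 = h := by simp [hy, expFlow_zero]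
  simp only [hΦ, h0] at this
  refine le_of_abs_le (abs_le_of_sq_le_sq ?_ (by positivity))
  have : 0 ≤ M ^ 2 / 4 * ‖y t‖ ^ 2 := by positivity
  nlinarith

lemma IsSectorialInverse.sector_add {R : H →L[ℝ] H} {M : ℝ} (hR : IsSectorialInverse R M)
    {l : ℝ} (hl : 0 ≤ l) (g h : H) :
    inner ℝ g ((R + l • (1 : H →L[ℝ] H)) h) ^ 2 ≤ M ^ 2 *
      (inner ℝ g ((R + l • (1 : H →L[ℝ] H)) g) * inner ℝ h ((R + l • (1 : H →L[ℝ] H)) h)) := by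
  simp only [add_apply, smul_apply, one_apply_eq_self,
    inner_add_right, inner_smul_right, real_inner_self_eq_norm_sq]
  have hM := hR.one_le
  have hx := hR.sector g h
  have ha := hR.nonneg g
  have hb := hR.nonneg h
  have hy : inner ℝ g h ^ 2 ≤ M ^ 2 * (‖g‖ ^ 2 * ‖h‖ ^ 2) := by
    have h1 := abs_real_inner_le_norm g h
    have h2 : inner ℝ g h ^ 2 ≤ ‖g‖ ^ 2 * ‖h‖ ^ 2 := by
      rw [← sq_abs, ← mul_pow]; gcongr
    have h3 : 1 ≤ M ^ 2 := by nlinarith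
    nlinarith [mul_nonneg (sq_nonneg ‖g‖) (sq_nonneg ‖h‖)]
  have hc := sq_nonneg ‖g‖
  have hd := sq_nonneg ‖h‖
  set x := inner ℝ g (R h)
  set y := inner ℝ g h
  set a := inner ℝ g (R g)
  set b := inner ℝ h (R h)
  set c := ‖g‖ ^ 2
  set d := ‖h‖ ^ 2
  have hxy : x * y ≤ M ^ 2 * (a * d + b * c) / 2 := by
    refine le_of_abs_le (abs_le_of_sq_le_sq ?_ (by positivity))
    calc (x * y) ^ 2 = x ^ 2 * y ^ 2 := by ring
      _ ≤ (M ^ 2 * (a * b)) * (M ^ 2 * (c * d)) := by gcongr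
      _ ≤ _ := by nlinarith [mul_nonneg (sq_nonneg (M ^ 2)) (sq_nonneg (a * d - b * c))]
  nlinarith [mul_le_mul_of_nonneg_left hxy hl, mul_le_mul_of_nonneg_left hy (sq_nonneg l)]

lemma IsSectorialInverse.nonneg_add {R : H →L[ℝ] H} {M : ℝ} (hR : IsSectorialInverse R M)
    (l : ℝ) (g : H) : l * ‖g‖ ^ 2 ≤ inner ℝ g ((R + l • (1 : H →L[ℝ] H)) g) := by
  simp only [add_apply, smul_apply, one_apply_eq_self,
    inner_add_right, inner_smul_right, real_inner_self_eq_norm_sq]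
  linarith [hR.nonneg g]

lemma IsSectorialInverse.isUnit_add {R : H →L[ℝ] H} {M : ℝ} (hR : IsSectorialInverse R M)
    {l : ℝ} (hl : 0 < l) : IsUnit (R + l • (1 : H →L[ℝ] H)) := by
  have hco : IsCoercive ((innerSL ℝ).comp (R + l • (1 : H →L[ℝ] H))) := by
    refine ⟨l, hl, fun u => ?_⟩
    have := hR.nonneg_add l u
    rw [real_inner_comm] at this
    rw [mul_assoc, ← sq]
    exact this
  have heq : (hco.continuousLinearEquivOfBilin : H →L[ℝ] H) = R + l • (1 : H →L[ℝ] H) := by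
    ext v
    refine ext_inner_right ℝ fun w => ?_
    exact hco.continuousLinearEquivOfBilin_apply v w
  rw [← heq]
  exact (ContinuousLinearEquiv.toUnit hco.continuousLinearEquivOfBilin).isUnit

/-- The Yosida approximation `(R + l)⁻¹` of `R⁻¹`. -/
noncomputable def yosida (R : H →L[ℝ] H) (l : ℝ) : H →L[ℝ] H := Ring.inverse (R + l • 1)

namespace IsSectorialInverse

variable {R : H →L[ℝ] H} {M : ℝ} (hR : IsSectorialInverse R M)

include hR

lemma add_yosida {l : ℝ} (hl : 0 < l) (h : H) :
    (R + l • (1 : H →L[ℝ] H)) (yosida R l h) = h := by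
  have := Ring.mul_inverse_cancel _ (hR.isUnit_add hl)
  exact DFunLike.congr_fun this h

lemma yosida_add {l : ℝ} (hl : 0 < l) (h : H) :
    yosida R l ((R + l • (1 : H →L[ℝ] H)) h) = h := by
  have := Ring.inverse_mul_cancel _ (hR.isUnit_add hl)
  exact DFunLike.congr_fun this h

lemma apply_yosida {l : ℝ} (hl : 0 < l) (h : H) : R (yosida R l h) = h - l • yosida R l h := by
  have := hR.add_yosida hl h
  simp only [add_apply, smul_apply,
    one_apply_eq_self] at this
  exact eq_sub_of_add_eq this

lemma yosida_apply {l : ℝ} (hl : 0 < l) (h : H) : yosida R l (R h) = h - l • yosida R l h := by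
  have := hR.yosida_add hl h
  simp only [add_apply, smul_apply,
    one_apply_eq_self, map_add, map_smul] at this
  exact eq_sub_of_add_eq this

lemma le_inner_yosida {l : ℝ} (hl : 0 < l) (h : H) :
    l * ‖yosida R l h‖ ^ 2 ≤ inner ℝ h (yosida R l h) := by
  have := hR.nonneg_add l (yosida R l h)
  rwa [hR.add_yosida hl, real_inner_comm] at this

lemma norm_yosida_le {l : ℝ} (hl : 0 < l) (h : H) : ‖l • yosida R l h‖ ≤ ‖h‖ := by
  have h1 := hR.le_inner_yosida hl h
  have h2 := real_inner_le_norm h (yosida R l h)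
  rw [norm_smul, Real.norm_of_nonneg hl.le]
  by_contra! h3
  have h4 : 0 < ‖yosida R l h‖ := by
    by_contra! h4
    have : ‖yosida R l h‖ = 0 := le_antisymm h4 (norm_nonneg _)
    rw [this] at h3
    linarith [norm_nonneg h]
  nlinarith

lemma norm_yosida_apply_le {l : ℝ} (hl : 0 < l) (h : H) : ‖yosida R l (R h)‖ ≤ 2 * ‖h‖ := by
  rw [hR.yosida_apply hl]
  linarith [norm_sub_le h (l • yosida R l h), hR.norm_yosida_le hl h]

omit hR in
lemma commute_yosida (R : H →L[ℝ] H) (l m : ℝ) : Commute (yosida R l) (yosida R m) := by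
  apply Commute.ringInverse_ringInverse
  apply Commute.add_left
  · exact (Commute.refl R).add_right ((Commute.one_right R).smul_right m)
  · exact (Commute.one_left _).smul_left l

lemma norm_expFlow_yosida_le {l : ℝ} (hl : 0 < l) (h : H) {t : ℝ} (ht : 0 ≤ t) :
    ‖expFlow (yosida R l) t h‖ ≤ ‖h‖ :=
  norm_expFlow_le (fun w => le_trans (by positivity) (hR.le_inner_yosida hl w)) h ht

lemma norm_yosida_expFlow_le {l : ℝ} (hl : 0 < l) (h : H) {t : ℝ} (ht : 0 ≤ t) :
    t * ‖yosida R l (expFlow (yosida R l) t h)‖ ≤ M / 2 * ‖h‖ :=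
  norm_generator_expFlow_le (R := R + l • 1) (by linarith [hR.one_le]) (hR.add_yosida hl)
    (fun g => le_trans (by positivity) (hR.nonneg_add l g)) (hR.sector_add hl.le) h ht

lemma norm_expFlow_sub_le {l m : ℝ} (hl : 0 < l) (hm : 0 < m) (h : H) {t : ℝ} (ht : 0 ≤ t) :
    ‖expFlow (yosida R l) t h - expFlow (yosida R m) t h‖ ≤
      t * ‖yosida R m h - yosida R l h‖ := by
  set A := yosida R l
  set C := yosida R m
  have hcomm : Commute A C := commute_yosida R l m
  have hd : ∀ s, HasDerivAt (fun s => expFlow A s (expFlow C (t - s) h))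
      (expFlow A s (expFlow C (t - s) (C h - A h))) s := by
    intro s
    have h1 : HasDerivAt (fun s => expFlow C (t - s) h) (C (expFlow C (t - s) h)) s := by
      have := (hasDerivAt_expFlow C h (t - s)).scomp s ((hasDerivAt_id s).const_sub t)
      simpa [Function.comp_def] using this
    have h2 : HasDerivAt (fun s => expFlow A s) (expFlow A s * (-A)) s :=
      hasDerivAt_exp_smul_const (𝕂 := ℝ) (-A) s
    have h3 := h2.clm_apply h1
    convert h3 using 1
    have e1 : C (expFlow C (t - s) h) = expFlow C (t - s) (C h) :=
      DFunLike.congr_fun (commute_expFlow (Commute.refl C) (t - s)).eq h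
    have e2 : A (expFlow C (t - s) h) = expFlow C (t - s) (A h) :=
      DFunLike.congr_fun (commute_expFlow hcomm (t - s)).eq h
    have e3 : (expFlow A s * -A) (expFlow C (t - s) h) = -expFlow A s (expFlow C (t - s) (A h)) := by
      rw [← e2]
      exact map_neg (expFlow A s) _
    rw [e1, e3, map_sub, map_sub]
    abel
  have := norm_image_sub_le_of_norm_deriv_le_segment' (f := fun s => expFlow A s
      (expFlow C (t - s) h)) (C := ‖C h - A h‖) (a := 0) (b := t)
    (fun s _ => (hd s).hasDerivWithinAt) (fun s hs => by
      exact (hR.norm_expFlow_yosida_le hl _ hs.1).trans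
        (hR.norm_expFlow_yosida_le hm _ (by linarith [hs.2]))) t ⟨ht, le_rfl⟩
  simpa [expFlow_zero, mul_comm] using this

lemma norm_yosida_sub_le {l m : ℝ} (hl : 0 < l) (hm : 0 < m) (k : H) :
    ‖yosida R m (R (R k)) - yosida R l (R (R k))‖ ≤ 2 * (l + m) * ‖k‖ := by
  rw [hR.yosida_apply hl, hR.yosida_apply hm, sub_sub_sub_cancel_left]
  calc ‖l • yosida R l (R k) - m • yosida R m (R k)‖
      ≤ ‖l • yosida R l (R k)‖ + ‖m • yosida R m (R k)‖ := norm_sub_le _ _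
    _ ≤ l * (2 * ‖k‖) + m * (2 * ‖k‖) := by
        rw [norm_smul, norm_smul, Real.norm_of_nonneg hl.le, Real.norm_of_nonneg hm.le]
        gcongr
        · exact hR.norm_yosida_apply_le hl k
        · exact hR.norm_yosida_apply_le hm k
    _ = _ := by ring

end IsSectorialInverse

/-- Equibounded families of operators that converge uniformly on a dense set do so everywhere. -/
lemma uniformCauchySeqOn_of_dense {T : ℕ → ℝ → H →L[ℝ] H} {s : Set ℝ} {C : ℝ} (hC : 0 ≤ C)
    (hT : ∀ n, ∀ t ∈ s, ∀ h, ‖T n t h‖ ≤ C * ‖h‖) {j : H → H} (hj : DenseRange j)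
    (hc : ∀ k, UniformCauchySeqOn (fun n t => T n t (j k)) atTop s) (h : H) :
    UniformCauchySeqOn (fun n t => T n t h) atTop s := by
  rw [Metric.uniformCauchySeqOn_iff]
  intro ε hε
  obtain ⟨k, hk⟩ := hj.exists_dist_lt h (ε := ε / (3 * (C + 1))) (by positivity)
  obtain ⟨N, hN⟩ := Metric.uniformCauchySeqOn_iff.1 (hc k) (ε / 3) (by positivity)
  refine ⟨N, fun m hm n hn t ht => ?_⟩
  have h1 : ∀ n, dist (T n t h) (T n t (j k)) < ε / 3 := by
    intro n
    rw [dist_eq_norm, ← map_sub]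
    refine (hT n t ht _).trans_lt ?_
    rw [← dist_eq_norm]
    calc C * dist h (j k) ≤ (C + 1) * dist h (j k) := by gcongr; linarith
      _ < (C + 1) * (ε / (3 * (C + 1))) := by gcongr
      _ = ε / 3 := by field_simp
  have h2 := hN m hm n hn t ht
  have h3 := h1 n
  rw [dist_comm] at h3
  calc dist (T m t h) (T n t h) ≤ dist (T m t h) (T m t (j k)) + dist (T m t (j k)) (T n t (j k)) +
      dist (T n t (j k)) (T n t h) := dist_triangle4 _ _ _ _
    _ < ε := by linarith [h1 m]

/-- A uniformly small correction of a uniform Cauchy sequence. -/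
lemma _root_.UniformCauchySeqOn.of_sub_tendsto {α : Type*} {f g : ℕ → α → H} {s : Set α} {b : ℕ → ℝ}
    (hf : UniformCauchySeqOn f atTop s) (hb : Tendsto b atTop (𝓝 0))
    (hfg : ∀ n, ∀ t ∈ s, ‖g n t - f n t‖ ≤ b n) : UniformCauchySeqOn g atTop s := by
  rw [Metric.uniformCauchySeqOn_iff] at hf ⊢
  intro ε hε
  obtain ⟨N, hN⟩ := hf (ε / 3) (by positivity)
  obtain ⟨N', hN'⟩ := eventually_atTop.1 (hb.eventually_lt_const (show 0 < ε / 3 by positivity))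
  refine ⟨max N N', fun m hm n hn t ht => ?_⟩
  have h1 := hN m (le_of_max_le_left hm) n (le_of_max_le_left hn) t ht
  have h2 := (hfg m t ht).trans_lt (hN' m (le_of_max_le_right hm))
  have h3 := (hfg n t ht).trans_lt (hN' n (le_of_max_le_right hn))
  rw [← dist_eq_norm] at h2 h3
  rw [dist_comm] at h3
  calc dist (g m t) (g n t) ≤ dist (g m t) (f m t) + dist (f m t) (f n t) +
      dist (f n t) (g n t) := dist_triangle4 _ _ _ _
    _ < ε := by linarith

/-- Pointwise limits of Cauchy sequences of operator functions are operator functions. -/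
lemma exists_tendsto_of_uniformCauchySeqOn {T : ℕ → ℝ → H →L[ℝ] H} {s : Set ℝ}
    (hT : ∀ h, ∀ t ∈ s, CauchySeq fun n => T n t h) :
    ∃ E : ℝ → H →L[ℝ] H, ∀ t ∈ s, ∀ h, Tendsto (fun n => T n t h) atTop (𝓝 (E t h)) := by
  have hT' : ∀ t : s, ∀ h, ∃ x, Tendsto (fun n => T n t h) atTop (𝓝 x) :=
    fun t h => cauchySeq_tendsto_of_complete (hT h t t.2)
  choose f hf using hT'
  classical
  refine ⟨fun t => if ht : t ∈ s then continuousLinearMapOfTendsto (fun n => T n t)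
    (tendsto_pi_nhds.2 (hf ⟨t, ht⟩)) else 0, fun t ht h => ?_⟩
  simp only [ht, dif_pos]
  exact hf ⟨t, ht⟩ h

namespace IsSectorialInverse

variable {R : H →L[ℝ] H} {M : ℝ} (hR : IsSectorialInverse R M)

include hR

lemma uniformCauchySeqOn_expFlow {l : ℕ → ℝ} (hl : ∀ n, 0 < l n) (hl0 : Tendsto l atTop (𝓝 0))
    (b : ℝ) (h : H) :
    UniformCauchySeqOn (fun n t => expFlow (yosida R (l n)) t h) atTop (Icc 0 b) := by
  refine uniformCauchySeqOn_of_dense (C := 1) zero_le_one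
    (fun n t ht h => by simpa using hR.norm_expFlow_yosida_le (hl n) h ht.1)
    (hR.dense.comp hR.dense R.continuous) (fun k => ?_) h
  rw [Metric.uniformCauchySeqOn_iff]
  intro ε hε
  have h1 : Tendsto (fun n => 4 * b * ‖k‖ * l n) atTop (𝓝 0) := by
    simpa using hl0.const_mul (4 * b * ‖k‖)
  obtain ⟨N, hN⟩ := eventually_atTop.1 (h1.eventually_lt_const hε)
  refine ⟨N, fun m hm n hn t ht => ?_⟩
  rw [dist_eq_norm]
  refine (hR.norm_expFlow_sub_le (hl m) (hl n) _ ht.1).trans_lt ?_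
  have h2 := hR.norm_yosida_sub_le (hl m) (hl n) k
  have h3 : t * ‖yosida R (l n) (R (R k)) - yosida R (l m) (R (R k))‖ ≤
      b * (2 * (l m + l n) * ‖k‖) :=
    mul_le_mul ht.2 h2 (norm_nonneg _) (ht.1.trans ht.2)
  refine h3.trans_lt ?_
  linarith [hN m hm, hN n hn]

lemma uniformCauchySeqOn_yosida_expFlow {l : ℕ → ℝ} (hl : ∀ n, 0 < l n)
    (hl0 : Tendsto l atTop (𝓝 0)) {a : ℝ} (ha : 0 < a) (b : ℝ) (h : H) :
    UniformCauchySeqOn (fun n t => (yosida R (l n) * expFlow (yosida R (l n)) t) h) atTop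
      (Icc a b) := by
  refine uniformCauchySeqOn_of_dense (C := M / 2 / a) (by have := hR.one_le; positivity)
    (fun n t ht h => ?_) (hR.dense.comp hR.dense R.continuous) (fun k => ?_) h
  · have h1 := hR.norm_yosida_expFlow_le (hl n) h (ha.le.trans ht.1)
    have h2 : a * ‖yosida R (l n) (expFlow (yosida R (l n)) t h)‖ ≤ M / 2 * ‖h‖ :=
      (mul_le_mul_of_nonneg_right ht.1 (norm_nonneg _)).trans h1
    rw [div_mul_eq_mul_div, le_div_iff₀ ha, mul_comm]
    exact h2
  · refine ((hR.uniformCauchySeqOn_expFlow hl hl0 b (R k)).mono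
      (Icc_subset_Icc_left ha.le)).of_sub_tendsto (b := fun n => l n * (2 * ‖k‖)) ?_ ?_
    · simpa using hl0.mul_const (2 * ‖k‖)
    · intro n t ht
      have h1 : (yosida R (l n) * expFlow (yosida R (l n)) t) (R (R k)) =
          expFlow (yosida R (l n)) t (yosida R (l n) (R (R k))) :=
        DFunLike.congr_fun (commute_expFlow (Commute.refl _) t).eq _
      simp only [Function.comp_apply]
      rw [h1, ← map_sub, hR.yosida_apply (hl n) (R k), sub_sub_cancel_left, map_neg, norm_neg]
      refine (hR.norm_expFlow_yosida_le (hl n) _ (ha.le.trans ht.1)).trans ?_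
      rw [norm_smul, Real.norm_of_nonneg (hl n).le]
      exact mul_le_mul_of_nonneg_left (hR.norm_yosida_apply_le (hl n) k) (hl n).le

/-- Generation of a differentiable contraction semigroup `E` with derivative `D` by `-R⁻¹`. -/
theorem exists_semigroup : ∃ E D : ℝ → H →L[ℝ] H, E 0 = 1 ∧
    (∀ t, 0 ≤ t → ∀ h, ‖E t h‖ ≤ ‖h‖) ∧ (∀ h, ContinuousOn (fun t => E t h) (Ici 0)) ∧
    (∀ s t, 0 ≤ s → 0 ≤ t → E (s + t) = E s * E t) ∧
    (∀ t, 0 < t → ∀ h, HasDerivAt (fun t => E t h) (D t h) t) ∧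
    ∀ t, 0 < t → ∀ h, R (D t h) = -E t h := by
  set l : ℕ → ℝ := fun n => 1 / ((n : ℝ) + 1) with hldef
  have hl : ∀ n, 0 < l n := fun n => by positivity
  have hl0 : Tendsto l atTop (𝓝 0) := tendsto_one_div_add_atTop_nhds_zero_nat
  obtain ⟨E, hE⟩ := exists_tendsto_of_uniformCauchySeqOn
    (T := fun n t => expFlow (yosida R (l n)) t) (s := Ici 0)
    (fun h t ht => (hR.uniformCauchySeqOn_expFlow hl hl0 t h).cauchySeq ⟨ht, le_rfl⟩)
  obtain ⟨G, hG⟩ := exists_tendsto_of_uniformCauchySeqOn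
    (T := fun n t => yosida R (l n) * expFlow (yosida R (l n)) t) (s := Ioi 0)
    (fun h t ht => (hR.uniformCauchySeqOn_yosida_expFlow hl hl0 ht t h).cauchySeq
      ⟨le_rfl, le_rfl⟩)
  have hEu : ∀ b h, TendstoUniformlyOn (fun n t => expFlow (yosida R (l n)) t h)
      (fun t => E t h) atTop (Icc 0 b) := fun b h =>
    (hR.uniformCauchySeqOn_expFlow hl hl0 b h).tendstoUniformlyOn_of_tendsto
      fun t ht => hE t ht.1 h
  have hGu : ∀ a, 0 < a → ∀ b h, TendstoUniformlyOn
      (fun n t => (yosida R (l n) * expFlow (yosida R (l n)) t) h)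
      (fun t => G t h) atTop (Icc a b) := fun a ha b h =>
    (hR.uniformCauchySeqOn_yosida_expFlow hl hl0 ha b h).tendstoUniformlyOn_of_tendsto
      fun t ht => hG t (ha.trans_le ht.1) h
  refine ⟨E, fun t => -G t, ?_, ?_, ?_, ?_, ?_, ?_⟩
  · ext h
    refine tendsto_nhds_unique (hE 0 self_mem_Ici h) ?_
    simp [expFlow_zero]
  · intro t ht h
    exact le_of_tendsto (hE t ht h).norm
      (Eventually.of_forall fun n => hR.norm_expFlow_yosida_le (hl n) h ht)
  · intro h t ht
    have h1 : ContinuousOn (fun t => E t h) (Icc 0 (t + 1)) :=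
      (hEu (t + 1) h).continuousOn (Frequently.of_forall fun n =>
        fun s _ => (hasDerivAt_expFlow _ h s).continuousAt.continuousWithinAt)
    refine (h1 t ⟨ht, by linarith⟩).mono_of_mem_nhdsWithin ?_
    rw [← Ici_inter_Iic]
    exact inter_mem_nhdsWithin _ (Iic_mem_nhds (by linarith))
  · intro s t hs ht
    ext h
    refine tendsto_nhds_unique (hE (s + t) (add_nonneg hs ht) h) ?_
    have h1 : Tendsto (fun n => expFlow (yosida R (l n)) s (expFlow (yosida R (l n)) t h - E t h))
        atTop (𝓝 0) := by
      refine squeeze_zero_norm (a := fun n => ‖expFlow (yosida R (l n)) t h - E t h‖)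
        (fun n => hR.norm_expFlow_yosida_le (hl n) _ hs) ?_
      rw [← tendsto_iff_norm_sub_tendsto_zero]
      exact hE t ht h
    have h2 := h1.add (hE s hs (E t h))
    rw [zero_add] at h2
    refine h2.congr fun n => ?_
    rw [map_sub, sub_add_cancel, expFlow_add]
    rfl
  · intro t ht h
    have h1 : t ∈ Ioo (t / 2) (t + 1) := by constructor <;> linarith
    exact hasDerivAt_of_tendstoUniformlyOn (l := atTop) (s := Ioo (t / 2) (t + 1))
      (f := fun n t => expFlow (yosida R (l n)) t h) (g := fun t => E t h)
      (f' := fun n t => -((yosida R (l n) * expFlow (yosida R (l n)) t) h))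
      (g' := fun t => -(G t h)) isOpen_Ioo
      ((hGu (t / 2) (by positivity) (t + 1) h).mono Ioo_subset_Icc_self).neg
      (Eventually.of_forall fun n s _ => hasDerivAt_expFlow _ h s)
      (fun s hs => hE s (by have := hs.1; simp only [mem_Ici]; linarith) h) h1
  · intro t ht h
    have h1 := (R.continuous.tendsto _).comp (hG t ht h)
    have h2 : Tendsto (fun n => l n • yosida R (l n) (expFlow (yosida R (l n)) t h)) atTop
        (𝓝 0) := by
      have := hl0.smul (hG t ht h)
      rwa [zero_smul] at this
    have h3 := (hE t ht.le h).sub h2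
    rw [sub_zero] at h3
    have h4 : R (G t h) = E t h := by
      refine tendsto_nhds_unique h1 (h3.congr fun n => ?_)
      exact (hR.apply_yosida (hl n) _).symm
    rw [neg_apply, map_neg, h4]

end IsSectorialInverse

end Generation

namespace ControlSystem

variable {V H ω : Type*}
  [NormedAddCommGroup V] [InnerProductSpace ℝ V] [CompleteSpace V]
  [NormedAddCommGroup H] [InnerProductSpace ℝ H] [CompleteSpace H]
  [MeasurableSpace ω] {ρ : Measure ω}

@[simp]
lemma toDual_apply (S : ControlSystem V H ω ρ) (h : H) (v : V) :
    S.toDual h v = inner ℝ h (S.ι v) := rfl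

/-- The embedding `H → V*` as a continuous linear map. -/
noncomputable def toDualL (S : ControlSystem V H ω ρ) : H →L[ℝ] StrongDual ℝ V :=
  LinearMap.mkContinuous
    { toFun := S.toDual
      map_add' := fun x y => by ext v; simp [inner_add_left]
      map_smul' := fun c x => by ext v; simp [inner_smul_left] } ‖S.ι‖ fun h => by
    refine ContinuousLinearMap.opNorm_le_bound _ (by positivity) fun v => ?_
    calc ‖inner ℝ h (S.ι v)‖ ≤ ‖h‖ * ‖S.ι v‖ := norm_inner_le_norm _ _
      _ ≤ ‖h‖ * (‖S.ι‖ * ‖v‖) := by gcongr; exact S.ι.le_opNorm v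
      _ = _ := by ring

@[simp]
lemma toDualL_apply (S : ControlSystem V H ω ρ) (h : H) : S.toDualL h = S.toDual h := rfl

/-- The control system with the adjoint bilinear form. -/
noncomputable def dual (S : ControlSystem V H ω ρ) : ControlSystem V H ω ρ :=
  { S with
    a := S.a.flip
    garding := S.garding }

/-- The resolvent equation `A v + κ v = b` is solvable for large `κ`. -/
lemma exists_resolvent (S : ControlSystem V H ω ρ) {α₀ ω₀ κ : ℝ} (hα : 0 < α₀) (hκ : ω₀ ≤ κ)
    (hG : ∀ v : V, α₀ * ‖v‖ ^ 2 ≤ S.a v v + ω₀ * ‖S.ι v‖ ^ 2) :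
    ∃ L : StrongDual ℝ V →L[ℝ] V, ∀ b, S.a (L b) + κ • S.toDual (S.ι (L b)) = b := by
  have hco : IsCoercive (S.a + κ • (S.toDualL.comp S.ι)) := by
    refine ⟨α₀, hα, fun u => ?_⟩
    have h1 := hG u
    have h2 : ω₀ * ‖S.ι u‖ ^ 2 ≤ κ * ‖S.ι u‖ ^ 2 := by gcongr
    simp only [add_apply, smul_apply, ContinuousLinearMap.comp_apply, toDualL_apply,
      toDual_apply, real_inner_self_eq_norm_sq, smul_eq_mul]
    linarith [sq ‖u‖]
  let J : StrongDual ℝ V →L[ℝ] V :=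
    { toFun := fun b => (InnerProductSpace.toDual ℝ V).symm b
      map_add' := map_add _
      map_smul' := fun c b => by simp
      cont := (InnerProductSpace.toDual ℝ V).symm.continuous }
  refine ⟨(hco.continuousLinearEquivOfBilin.symm : V →L[ℝ] V).comp J, fun b => ?_⟩
  ext w
  set v := hco.continuousLinearEquivOfBilin.symm ((InnerProductSpace.toDual ℝ V).symm b)
  have h1 := hco.continuousLinearEquivOfBilin_apply v w
  rw [ContinuousLinearEquiv.apply_symm_apply, InnerProductSpace.toDual_symm_apply] at h1
  exact h1.symm

/-- The analytic semigroup `E(t) = exp(-tA)` on `H` of a control system, with its `V`-valued version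
`F` and the derivative `F'` of the latter. -/
structure Flow (S : ControlSystem V H ω ρ) where
  /-- the semigroup on `H` -/
  E : ℝ → H →L[ℝ] H
  /-- the semigroup as a map into `V`, for positive times -/
  F : ℝ → H →L[ℝ] V
  /-- the time derivative of `F` -/
  F' : ℝ → H →L[ℝ] V
  /-- the exponential growth bound -/
  rate : ℝ
  rate_nonneg : 0 ≤ rate
  E_zero : E 0 = 1
  norm_E_le : ∀ t, 0 ≤ t → ∀ h, ‖E t h‖ ≤ Real.exp (rate * t) * ‖h‖
  continuousOn_E : ∀ h, ContinuousOn (fun t => E t h) (Ici 0)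
  E_add : ∀ s t, 0 ≤ s → 0 ≤ t → ∀ h, E (s + t) h = E s (E t h)
  ι_F : ∀ t, 0 < t → ∀ h, S.ι (F t h) = E t h
  hasDerivAt_F : ∀ t, 0 < t → ∀ h, HasDerivAt (fun t => F t h) (F' t h) t
  F_add : ∀ t s, 0 < t → 0 ≤ s → ∀ h, F (t + s) h = F t (E s h)
  F'_add : ∀ t s, 0 < t → 0 ≤ s → ∀ h, F' (t + s) h = F' t (E s h)
  equation : ∀ t, 0 < t → ∀ h, S.toDual (S.ι (F' t h)) = -S.a (F t h)

theorem exists_flow (S : ControlSystem V H ω ρ) : Nonempty S.Flow := by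
  obtain ⟨α₀, ω₀, hα, hω, hG⟩ := S.garding
  obtain ⟨L, hL⟩ := S.exists_resolvent hα le_rfl hG
  set P : H →L[ℝ] V := L.comp S.toDualL with hP
  set aω : V →L[ℝ] StrongDual ℝ V := S.a + ω₀ • (S.toDualL.comp S.ι) with haω
  have haP : ∀ h w, aω (P h) w = inner ℝ h (S.ι w) := fun h w =>
    DFunLike.congr_fun (hL (S.toDualL h)) w
  have hcoer : ∀ v, α₀ * ‖v‖ ^ 2 ≤ aω v v := fun v => by
    have := hG v
    simpa [haω] using this
  set R : H →L[ℝ] H := S.ι.comp P with hRdef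
  have hRa : ∀ g h, inner ℝ g (R h) = aω (P g) (P h) := fun g h => (haP g (P h)).symm
  have hR : IsSectorialInverse R (max 1 (‖aω‖ / α₀)) := by
    refine ⟨le_max_left _ _, fun g => ?_, fun g h => ?_, ?_⟩
    · rw [hRa]
      exact le_trans (by positivity) (hcoer _)
    · rw [hRa, hRa, hRa]
      have h1 : ‖aω (P g) (P h)‖ ≤ ‖aω‖ * ‖P g‖ * ‖P h‖ := aω.le_opNorm₂ _ _
      have h2 := hcoer (P g)
      have h3 := hcoer (P h)
      calc aω (P g) (P h) ^ 2 = ‖aω (P g) (P h)‖ ^ 2 := by rw [Real.norm_eq_abs, sq_abs]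
        _ ≤ (‖aω‖ * ‖P g‖ * ‖P h‖) ^ 2 := by gcongr
        _ = (‖aω‖ / α₀) ^ 2 * ((α₀ * ‖P g‖ ^ 2) * (α₀ * ‖P h‖ ^ 2)) := by
            field_simp
        _ ≤ _ := by
            have h4 : 0 ≤ aω (P g) (P g) := le_trans (by positivity) h2
            gcongr
            exact le_max_right _ _
    · have h1 : (LinearMap.range R.toLinearMap)ᗮ = ⊥ := by
        rw [Submodule.eq_bot_iff]
        intro k hk
        have h2 : inner ℝ k (R k) = 0 := by
          rw [real_inner_comm]
          exact hk (R k) ⟨k, rfl⟩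
        rw [hRa] at h2
        have h3 := hcoer (P k)
        rw [h2] at h3
        have h4 : P k = 0 := by
          rw [← norm_eq_zero, ← sq_eq_zero_iff]
          exact le_antisymm (by by_contra! h; nlinarith) (sq_nonneg _)
        refine S.ι_dense.eq_zero_of_inner_left (𝕜 := ℝ) fun v => ?_
        have := haP k v
        rw [h4] at this
        simpa using this.symm
      have h2 := Submodule.topologicalClosure_eq_top_iff.2 h1
      intro x
      have : x ∈ (LinearMap.range R.toLinearMap).topologicalClosure := by rw [h2]; trivial
      exact this
  obtain ⟨E, D, hE0, hE1, hEc, hEadd, hED, hRD⟩ := hR.exists_semigroup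
  have hDadd : ∀ t s, 0 < t → 0 ≤ s → ∀ h, D (t + s) h = D t (E s h) := by
    intro t s ht hs h
    have h1 : HasDerivAt (fun r => E (r + s) h) (D (t + s) h) t :=
      (hED (t + s) (by positivity) h).comp_add_const t s
    refine h1.unique ((hED t ht (E s h)).congr_of_eventuallyEq ?_)
    filter_upwards [lt_mem_nhds ht] with r hr
    rw [hEadd r s hr.le hs]; rfl
  have hDD : ∀ t, 0 < t → ∀ h, HasDerivAt (fun t => D t h) (D (t / 2) (D (t / 2) h)) t := by
    intro t ht h
    have h0 : HasDerivAt (fun r => E (r - t / 2) h) (D (t / 2) h) t := by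
      have := hED (t - t / 2) (by linarith) h
      have := this.comp_sub_const t (t / 2)
      rwa [sub_half] at this
    have h1 := (D (t / 2)).hasFDerivAt.comp_hasDerivAt t h0
    refine h1.congr_of_eventuallyEq ?_
    filter_upwards [lt_mem_nhds (half_lt_self ht)] with r hr
    have := hDadd (t / 2) (r - t / 2) (by positivity) (by linarith) h
    rw [add_sub_cancel] at this
    rw [this]; rfl
  set e : ℝ → ℝ := fun t => Real.exp (ω₀ * t) with he
  have hed : ∀ t, HasDerivAt e (ω₀ * e t) t := fun t => by
    have := ((hasDerivAt_id t).const_mul ω₀).exp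
    simpa [he, mul_comm] using this
  have headd : ∀ s t, e (s + t) = e s * e t := fun s t => by
    simp only [he, mul_add, Real.exp_add]
  set F : ℝ → H →L[ℝ] V := fun t => -(e t • P.comp (D t)) with hF
  set F' : ℝ → H →L[ℝ] V := fun t =>
    -(e t • P.comp ((D (t / 2)).comp (D (t / 2))) + (ω₀ * e t) • P.comp (D t)) with hF'
  have hιF : ∀ t, 0 < t → ∀ h, S.ι (F t h) = (e t • E t) h := fun t ht h => by
    have := hRD t ht h
    simp only [hF, neg_apply, smul_apply, ContinuousLinearMap.comp_apply, map_neg, map_smul]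
    rw [show S.ι (P (D t h)) = -E t h from this]
    simp
  have hFd : ∀ t, 0 < t → ∀ h, HasDerivAt (fun t => F t h) (F' t h) t := fun t ht h => by
    exact ((hed t).smul (P.hasFDerivAt.comp_hasDerivAt t (hDD t ht h))).neg
  have hFadd : ∀ t s, 0 < t → 0 ≤ s → ∀ h, F (t + s) h = F t ((e s • E s) h) := by
    intro t s ht hs h
    simp only [hF, neg_apply, smul_apply, ContinuousLinearMap.comp_apply, map_smul,
      hDadd t s ht hs, headd, smul_neg, smul_smul, mul_comm]
  refine ⟨⟨fun t => e t • E t, F, F', ω₀, hω, ?_, ?_, ?_, ?_, hιF, hFd, hFadd, ?_, ?_⟩⟩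
  · simp [he, hE0]
  · intro t ht h
    rw [smul_apply, norm_smul, Real.norm_of_nonneg (Real.exp_pos _).le]
    exact mul_le_mul_of_nonneg_left (hE1 t ht h) (Real.exp_pos _).le
  · intro h
    exact (Continuous.continuousOn (by fun_prop)).smul (hEc h)
  · intro s t hs ht h
    simp only [smul_apply, map_smul, hEadd s t hs ht, headd, smul_smul]
    rw [mul_comm]
    rfl
  · intro t s ht hs h
    have h1 : HasDerivAt (fun r => F (r + s) h) (F' (t + s) h) t :=
      (hFd (t + s) (by positivity) h).comp_add_const t s
    refine h1.unique ((hFd t ht ((e s • E s) h)).congr_of_eventuallyEq ?_)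
    filter_upwards [lt_mem_nhds ht] with r hr
    exact hFadd r s hr hs h
  · intro t ht h
    have h1 : S.ι (F' t h) = e t • D t h + (ω₀ * e t) • E t h := by
      have h2 := S.ι.hasFDerivAt.comp_hasDerivAt t (hFd t ht h)
      refine h2.unique (((hed t).smul (hED t ht h)).congr_of_eventuallyEq ?_)
      filter_upwards [lt_mem_nhds ht] with r hr
      exact hιF r hr h
    have h2 : F t h = P (-(e t • D t h)) := by simp [hF]
    have h3 := hL (S.toDualL (-(e t • D t h)))
    have h4 : S.a (F t h) + ω₀ • S.toDual (S.ι (F t h)) = S.toDualL (-(e t • D t h)) := by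
      rw [h2]; exact h3
    rw [hιF t ht, ← toDualL_apply] at h4
    rw [h1, eq_sub_of_add_eq h4, ← toDualL_apply, smul_apply, map_neg, map_add, map_smul, map_smul,
      map_smul, smul_smul]
    abel

end ControlSystem

instance (T : ℝ) : IsFiniteMeasure (timeMeasure T) := by
  unfold timeMeasure; infer_instance

lemma ae_timeMeasure_mem (T : ℝ) : ∀ᵐ t ∂(timeMeasure T), t ∈ Ioo 0 T :=
  ae_restrict_mem measurableSet_Ioo

lemma integral_timeMeasure {E : Type*} [NormedAddCommGroup E] [NormedSpace ℝ E] {T : ℝ}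
    (hT : 0 ≤ T) (f : ℝ → E) : ∫ t, f t ∂(timeMeasure T) = ∫ t in (0)..T, f t := by
  rw [intervalIntegral.integral_of_le hT, integral_Ioc_eq_integral_Ioo, timeMeasure]

lemma integrable_timeMeasure_iff {E : Type*} [NormedAddCommGroup E] {T : ℝ}
    (hT : 0 ≤ T) (f : ℝ → E) :
    Integrable f (timeMeasure T) ↔ IntervalIntegrable f volume 0 T := by
  rw [intervalIntegrable_iff_integrableOn_Ioo_of_le hT, timeMeasure, IntegrableOn]

/-- A nonnegative function with bounded integrals over compact subintervals is integrable. -/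
lemma integrable_timeMeasure_of_bound {T I : ℝ} (hT : 0 < T) {k : ℝ → ℝ} (hk : ∀ t, 0 ≤ k t)
    (hint : ∀ s t, 0 < s → s ≤ t → t < T → IntegrableOn k (Ioc s t))
    (hI : ∀ s t, 0 < s → s ≤ t → t < T → ∫ r in s..t, k r ≤ I) :
    Integrable k (timeMeasure T) ∧ ∫ t, k t ∂(timeMeasure T) ≤ I := by
  set a : ℕ → ℝ := fun n => T * (1 / ((n : ℝ) + 1)) / 2 with ha
  have h0 : Tendsto (fun n : ℕ => T * (1 / ((n : ℝ) + 1)) / 2) atTop (𝓝 0) := by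
    simpa using (tendsto_one_div_add_atTop_nhds_zero_nat (𝕜 := ℝ)).const_mul T |>.div_const 2
  have h1 : Tendsto (fun n => T - a n) atTop (𝓝 T) := by
    have := h0.const_sub T
    rwa [sub_zero] at this
  have hcov : AECover (volume.restrict (Ioo 0 T)) atTop fun n => Ioc (a n) (T - a n) :=
    aecover_Ioo_of_Ioc h0 h1
  have hapos : ∀ n, 0 < a n := fun n => by positivity
  have hale : ∀ n, a n ≤ T - a n := fun n => by
    have : 1 / ((n : ℝ) + 1) ≤ 1 := by
      rw [div_le_one (by positivity)]; linarith [n.cast_nonneg (α := ℝ)]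
    have : T * (1 / ((n : ℝ) + 1)) ≤ T := by nlinarith
    simp only [ha]; linarith
  have hb : ∀ n, T - a n < T := fun n => by linarith [hapos n]
  have hres : ∀ n, (volume.restrict (Ioo 0 T)).restrict (Ioc (a n) (T - a n)) =
      volume.restrict (Ioc (a n) (T - a n)) := fun n => by
    rw [Measure.restrict_restrict measurableSet_Ioc, inter_eq_left.2]
    exact fun x hx => ⟨(hapos n).trans hx.1, hx.2.trans_lt (hb n)⟩
  have hle : ∀ n, ∫ x in Ioc (a n) (T - a n), k x ∂(volume.restrict (Ioo 0 T)) ≤ I := fun n => by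
    rw [hres, ← intervalIntegral.integral_of_le (hale n)]
    exact hI _ _ (hapos n) (hale n) (hb n)
  have hon : ∀ n, IntegrableOn k (Ioc (a n) (T - a n)) (volume.restrict (Ioo 0 T)) := fun n => by
    rw [IntegrableOn, hres]
    exact hint _ _ (hapos n) (hale n) (hb n)
  have hi : Integrable k (volume.restrict (Ioo 0 T)) := by
    refine hcov.integrable_of_integral_norm_bounded I hon (Eventually.of_forall fun n => ?_)
    simpa only [Real.norm_of_nonneg (hk _)] using hle n
  exact ⟨hi, le_of_tendsto' (hcov.integral_tendsto_of_countably_generated hi) hle⟩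

namespace ControlSystem

variable {V H ω : Type*}
  [NormedAddCommGroup V] [InnerProductSpace ℝ V] [CompleteSpace V]
  [NormedAddCommGroup H] [InnerProductSpace ℝ H] [CompleteSpace H]
  [MeasurableSpace ω] {ρ : Measure ω}

/-- The parabolic energy inequality for classical solutions. -/
theorem exists_energy_bound (S : ControlSystem V H ω ρ) {T : ℝ} (hT : 0 < T) :
    ∃ K : ℝ, 0 ≤ K ∧ ∀ (y y' : ℝ → V) (Y : ℝ → H) (f : ℝ → StrongDual ℝ V),
      ContinuousOn Y (Icc 0 T) → (∀ t ∈ Ioo 0 T, S.ι (y t) = Y t) →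
      (∀ t ∈ Ioo 0 T, HasDerivAt y (y' t) t) →
      (∀ t ∈ Ioo 0 T, S.toDual (S.ι (y' t)) = f t - S.a (y t)) → Continuous f →
      MemLp y 2 (timeMeasure T) ∧
      ∫ t, ‖y t‖ ^ 2 ∂(timeMeasure T) ≤ K * (‖Y 0‖ ^ 2 + ∫ t, ‖f t‖ ^ 2 ∂(timeMeasure T)) ∧
      ∀ t ∈ Icc 0 T, ‖Y t‖ ^ 2 ≤ K * (‖Y 0‖ ^ 2 + ∫ t, ‖f t‖ ^ 2 ∂(timeMeasure T)) := by
  obtain ⟨α, w, hα, hw, hG⟩ := S.garding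
  set c := Real.exp (2 * w * T) with hc
  have hc1 : 1 ≤ c := Real.one_le_exp (by positivity)
  have hα' : 0 < 1 / α := by positivity
  refine ⟨2 * c ^ 2 * (1 + 1 / α) ^ 2, by positivity, fun y y' Y f hY hyY hy heq hf => ?_⟩
  set J := ∫ t, ‖f t‖ ^ 2 ∂(timeMeasure T) with hJ
  have hJ0 : 0 ≤ J := integral_nonneg fun t => by positivity
  have hycont : ContinuousOn y (Ioo 0 T) :=
    fun t ht => (hy t ht).continuousAt.continuousWithinAt
  have hsub : ∀ s t, 0 < s → t < T → Icc s t ⊆ Ioo 0 T := fun s t hs ht x hx =>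
    ⟨hs.trans_le hx.1, hx.2.trans_lt ht⟩
  have hyint : ∀ s t, 0 < s → t < T → IntegrableOn (fun r => ‖y r‖ ^ 2) (Icc s t) :=
    fun s t hs ht => ((hycont.mono (hsub s t hs ht)).norm.pow 2).integrableOn_Icc
  have hfint : ∀ s t, IntervalIntegrable (fun r => ‖f r‖ ^ 2) volume s t := fun s t =>
    (hf.norm.pow 2).intervalIntegrable s t
  have hfJ : ∀ s t, 0 < s → s ≤ t → t < T → ∫ r in s..t, ‖f r‖ ^ 2 ≤ J := by
    intro s t hs hst ht
    rw [hJ, integral_timeMeasure hT.le]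
    exact intervalIntegral.integral_mono_interval hs.le hst ht.le
      (Eventually.of_forall fun r => by positivity) (hfint 0 T)
  have core : ∀ s t, 0 < s → s ≤ t → t < T →
      ‖Y t‖ ^ 2 + α * ∫ r in s..t, ‖y r‖ ^ 2 ≤ c * (‖Y s‖ ^ 2 + 1 / α * J) := by
    intro s t hs hst ht
    have hd : ∀ r ∈ Ioo 0 T, HasDerivAt (fun r => Real.exp (-(2 * w * r)) * ‖S.ι (y r)‖ ^ 2)
        (Real.exp (-(2 * w * r)) * (2 * (f r (y r) - S.a (y r) (y r) - w * ‖S.ι (y r)‖ ^ 2)))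
        r := by
      intro r hr
      have h1 : HasDerivAt (fun r => Real.exp (-(2 * w * r)))
          (Real.exp (-(2 * w * r)) * (-(2 * w))) r := by
        have := ((hasDerivAt_id r).const_mul (2 * w)).neg.exp
        simpa using this
      have h2 := h1.mul (S.ι.hasFDerivAt.comp_hasDerivAt r (hy r hr)).norm_sq
      refine h2.congr_deriv ?_
      have h3 := DFunLike.congr_fun (heq r hr) (y r)
      rw [toDual_apply, real_inner_comm, sub_apply] at h3
      simp only [Function.comp_apply]
      rw [h3]
      ring
    have hint : IntegrableOn (fun r => 1 / α * ‖f r‖ ^ 2 - α * c⁻¹ * ‖y r‖ ^ 2) (Icc s t) :=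
      (((hf.norm.pow 2).continuousOn.integrableOn_Icc).const_mul _).sub
        ((hyint s t hs ht).const_mul _)
    have h1 := intervalIntegral.sub_le_integral_of_hasDeriv_right_of_le hst
      (fun r hr => (hd r (hsub s t hs ht hr)).continuousAt.continuousWithinAt)
      (fun r hr => (hd r (hsub s t hs ht (Ioo_subset_Icc_self hr))).hasDerivWithinAt) hint
      (fun r hr => by
        have hr' := hsub s t hs ht (Ioo_subset_Icc_self hr)
        have e1 := hG (y r)
        have e2 : f r (y r) ≤ ‖f r‖ * ‖y r‖ := (le_abs_self _).trans ((f r).le_opNorm (y r))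
        have e3 : 2 * (‖f r‖ * ‖y r‖) ≤ 1 / α * ‖f r‖ ^ 2 + α * ‖y r‖ ^ 2 := by
          have e4 : 1 / α * ‖f r‖ ^ 2 + α * ‖y r‖ ^ 2 - 2 * (‖f r‖ * ‖y r‖) =
            1 / α * (‖f r‖ - α * ‖y r‖) ^ 2 := by field_simp; ring
          have e5 : 0 ≤ 1 / α * (‖f r‖ - α * ‖y r‖) ^ 2 := by positivity
          linarith
        have e4 : Real.exp (-(2 * w * r)) ≤ 1 := by
          rw [Real.exp_le_one_iff]
          have := hr'.1
          have : 0 ≤ 2 * w * r := by positivity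
          linarith
        have e5 : c⁻¹ ≤ Real.exp (-(2 * w * r)) := by
          rw [hc, ← Real.exp_neg]
          apply Real.exp_le_exp.2
          have := mul_le_mul_of_nonneg_left hr'.2.le (show 0 ≤ 2 * w by positivity)
          linarith
        have e6 : 0 < Real.exp (-(2 * w * r)) := Real.exp_pos _
        set x := Real.exp (-(2 * w * r))
        have e7 : x * (2 * (f r (y r) - S.a (y r) (y r) - w * ‖S.ι (y r)‖ ^ 2)) ≤
            x * (1 / α * ‖f r‖ ^ 2 - α * ‖y r‖ ^ 2) := by
          apply mul_le_mul_of_nonneg_left _ e6.le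
          linarith
        have e8 : x * (1 / α * ‖f r‖ ^ 2) ≤ 1 * (1 / α * ‖f r‖ ^ 2) := by gcongr
        have e9 : c⁻¹ * (α * ‖y r‖ ^ 2) ≤ x * (α * ‖y r‖ ^ 2) := by gcongr
        linarith)
    have h2 : ∫ r in s..t, (1 / α * ‖f r‖ ^ 2 - α * c⁻¹ * ‖y r‖ ^ 2) =
        1 / α * (∫ r in s..t, ‖f r‖ ^ 2) - α * c⁻¹ * ∫ r in s..t, ‖y r‖ ^ 2 := by
      rw [intervalIntegral.integral_sub ((hfint s t).const_mul _) (IntervalIntegrable.const_mul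
        ((intervalIntegrable_iff_integrableOn_Icc_of_le hst).2 (hyint s t hs ht)) _),
        intervalIntegral.integral_const_mul, intervalIntegral.integral_const_mul]
    rw [h2] at h1
    have h3 := hfJ s t hs hst ht
    have hsT : s ∈ Ioo 0 T := ⟨hs, hst.trans_lt ht⟩
    have htT : t ∈ Ioo 0 T := ⟨hs.trans_le hst, ht⟩
    rw [hyY t htT, hyY s hsT] at h1
    have h4 : Real.exp (-(2 * w * s)) * ‖Y s‖ ^ 2 ≤ 1 * ‖Y s‖ ^ 2 := by
      gcongr
      rw [Real.exp_le_one_iff]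
      have : 0 ≤ 2 * w * s := by positivity
      linarith
    have h5 : c⁻¹ * ‖Y t‖ ^ 2 ≤ Real.exp (-(2 * w * t)) * ‖Y t‖ ^ 2 := by
      gcongr
      rw [hc, ← Real.exp_neg]
      apply Real.exp_le_exp.2
      have := mul_le_mul_of_nonneg_left ht.le (show 0 ≤ 2 * w by positivity)
      linarith
    have h6 : 1 / α * (∫ r in s..t, ‖f r‖ ^ 2) ≤ 1 / α * J := by gcongr
    have h7 : c⁻¹ * (‖Y t‖ ^ 2 + α * ∫ r in s..t, ‖y r‖ ^ 2) ≤ ‖Y s‖ ^ 2 + 1 / α * J := by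
      linarith
    rwa [inv_mul_le_iff₀ (by positivity)] at h7
  have hI0 : ∀ s t, s ≤ t → 0 ≤ ∫ r in s..t, ‖y r‖ ^ 2 := fun s t hst =>
    intervalIntegral.integral_nonneg hst fun r _ => by positivity
  have hY0 : Tendsto (fun s => c * (‖Y s‖ ^ 2 + 1 / α * J)) (𝓝[>] 0)
      (𝓝 (c * (‖Y 0‖ ^ 2 + 1 / α * J))) := by
    have h1 : Tendsto Y (𝓝[>] 0) (𝓝 (Y 0)) := by
      have := hY 0 ⟨le_rfl, hT.le⟩
      exact this.tendsto.mono_left (nhdsWithin_le_of_mem (Icc_mem_nhdsGT hT))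
    exact ((h1.norm.pow 2).add_const _).const_mul c
  have hYt : ∀ t ∈ Ioo 0 T, ‖Y t‖ ^ 2 ≤ c * (‖Y 0‖ ^ 2 + 1 / α * J) := by
    intro t ht
    refine ge_of_tendsto hY0 ?_
    filter_upwards [Ioo_mem_nhdsGT ht.1] with s hs
    have h1 := core s t hs.1 hs.2.le ht.2
    have h2 := hI0 s t hs.2.le
    nlinarith
  have hYt' : ∀ t ∈ Icc 0 T, ‖Y t‖ ^ 2 ≤ c * (‖Y 0‖ ^ 2 + 1 / α * J) := by
    intro t ht
    have h1 : ContinuousOn (fun t => ‖Y t‖ ^ 2) (Icc 0 T) := hY.norm.pow 2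
    rw [← closure_Ioo hT.ne] at h1 ht
    exact le_on_closure hYt h1 continuousOn_const ht
  have hint := integrable_timeMeasure_of_bound (I := c / α * (2 * c * (‖Y 0‖ ^ 2 + 1 / α * J)))
    hT (k := fun t => ‖y t‖ ^ 2) (fun t => by positivity)
    (fun s t hs hst ht => (hyint s t hs ht).mono_set Ioc_subset_Icc_self)
    (fun s t hs hst ht => by
      have h1 := core s t hs hst ht
      have h2 := hYt s ⟨hs, hst.trans_lt ht⟩
      have h3 : α * ∫ r in s..t, ‖y r‖ ^ 2 ≤ c * (2 * c * (‖Y 0‖ ^ 2 + 1 / α * J)) := by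
        have h4 : 1 / α * J ≤ c * (‖Y 0‖ ^ 2 + 1 / α * J) := by
          have h5 : 1 / α * J ≤ ‖Y 0‖ ^ 2 + 1 / α * J := by linarith [sq_nonneg ‖Y 0‖]
          have h6 : 0 ≤ ‖Y 0‖ ^ 2 + 1 / α * J := by positivity
          nlinarith
        have h5 : c * (‖Y s‖ ^ 2 + 1 / α * J) ≤ c * (2 * c * (‖Y 0‖ ^ 2 + 1 / α * J)) := by
          gcongr; linarith
        linarith [sq_nonneg ‖Y t‖]
      rw [div_mul_eq_mul_div, le_div_iff₀ hα, mul_comm]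
      exact h3)
  have hk1 : ‖Y 0‖ ^ 2 + 1 / α * J ≤ (1 + 1 / α) * (‖Y 0‖ ^ 2 + J) := by
    have : 0 ≤ 1 / α * ‖Y 0‖ ^ 2 := by positivity
    nlinarith
  have hk0 : 0 ≤ ‖Y 0‖ ^ 2 + J := by positivity
  refine ⟨?_, ?_, ?_⟩
  · rw [memLp_two_iff_integrable_sq_norm]
    · exact hint.1
    · exact hycont.aestronglyMeasurable measurableSet_Ioo
  · refine hint.2.trans ?_
    calc c / α * (2 * c * (‖Y 0‖ ^ 2 + 1 / α * J))
        ≤ c / α * (2 * c * ((1 + 1 / α) * (‖Y 0‖ ^ 2 + J))) := by gcongr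
      _ = 2 * c ^ 2 * (1 / α) * (1 + 1 / α) * (‖Y 0‖ ^ 2 + J) := by ring
      _ ≤ 2 * c ^ 2 * (1 + 1 / α) * (1 + 1 / α) * (‖Y 0‖ ^ 2 + J) := by gcongr; linarith
      _ = _ := by ring
  · intro t ht
    refine (hYt' t ht).trans ?_
    calc c * (‖Y 0‖ ^ 2 + 1 / α * J) ≤ c * ((1 + 1 / α) * (‖Y 0‖ ^ 2 + J)) := by gcongr
      _ = 1 * c * 1 * ((1 + 1 / α) * (‖Y 0‖ ^ 2 + J)) := by ring
      _ ≤ 2 * c * c * ((1 + 1 / α) * (‖Y 0‖ ^ 2 + J)) := by gcongr; norm_num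
      _ = (2 * c ^ 2) * 1 * ((1 + 1 / α) * (‖Y 0‖ ^ 2 + J)) := by ring
      _ ≤ (2 * c ^ 2) * (1 + 1 / α) * ((1 + 1 / α) * (‖Y 0‖ ^ 2 + J)) := by gcongr; linarith
      _ = _ := by ring

end ControlSystem

namespace ControlSystem

variable {V H ω : Type*}
  [NormedAddCommGroup V] [InnerProductSpace ℝ V] [CompleteSpace V]
  [NormedAddCommGroup H] [InnerProductSpace ℝ H] [CompleteSpace H]
  [MeasurableSpace ω] {ρ : Measure ω} {S : ControlSystem V H ω ρ}

namespace Flow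

lemma hasDerivAt_E (P : S.Flow) {t : ℝ} (ht : 0 < t) (h : H) :
    HasDerivAt (fun t => P.E t h) (S.ι (P.F' t h)) t := by
  refine (S.ι.hasFDerivAt.comp_hasDerivAt t (P.hasDerivAt_F t ht h)).congr_of_eventuallyEq ?_
  filter_upwards [lt_mem_nhds ht] with r hr
  exact (P.ι_F r hr h).symm

lemma tendsto_E (P : S.Flow) {α : Type*} {l : Filter α} {τ : α → ℝ} {h : α → H} {t₀ : ℝ} {h₀ : H}
    (ht₀ : 0 ≤ t₀) (hτ : Tendsto τ l (𝓝 t₀)) (hτ0 : ∀ᶠ x in l, 0 ≤ τ x)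
    (hh : Tendsto h l (𝓝 h₀)) : Tendsto (fun x => P.E (τ x) (h x)) l (𝓝 (P.E t₀ h₀)) := by
  have h1 : Tendsto (fun x => P.E (τ x) h₀) l (𝓝 (P.E t₀ h₀)) :=
    (P.continuousOn_E h₀ t₀ ht₀).tendsto.comp (tendsto_nhdsWithin_iff.2 ⟨hτ, hτ0⟩)
  have h2 : Tendsto (fun x => P.E (τ x) (h x - h₀)) l (𝓝 0) := by
    have h3 : Tendsto (fun x => Real.exp (P.rate * τ x) * ‖h x - h₀‖) l (𝓝 0) := by
      have e1 : Tendsto (fun x => Real.exp (P.rate * τ x)) l (𝓝 (Real.exp (P.rate * t₀))) :=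
        (Real.continuous_exp.tendsto _).comp (hτ.const_mul _)
      have e2 := e1.mul (tendsto_iff_norm_sub_tendsto_zero.1 hh)
      rwa [mul_zero] at e2
    refine squeeze_zero_norm' ?_ h3
    filter_upwards [hτ0] with x hx
    exact P.norm_E_le _ hx _
  have h4 := h1.add h2
  rw [add_zero] at h4
  refine h4.congr fun x => ?_
  rw [map_sub]
  abel

lemma tendsto_F (P : S.Flow) {α : Type*} {l : Filter α} {τ : α → ℝ} {h : α → H} {t₀ : ℝ} {h₀ : H}
    (ht₀ : 0 < t₀) (hτ : Tendsto τ l (𝓝 t₀)) (hh : Tendsto h l (𝓝 h₀)) :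
    Tendsto (fun x => P.F (τ x) (h x)) l (𝓝 (P.F t₀ h₀)) := by
  have hev : ∀ᶠ x in l, t₀ / 2 ≤ τ x := hτ.eventually_const_le (by linarith)
  have h1 : Tendsto (fun x => P.E (τ x - t₀ / 2) (h x)) l (𝓝 (P.E (t₀ - t₀ / 2) h₀)) := by
    refine P.tendsto_E (by linarith) (hτ.sub_const _) ?_ hh
    filter_upwards [hev] with x hx
    linarith
  have h2 := ((P.F (t₀ / 2)).continuous.tendsto _).comp h1
  rw [← P.F_add _ _ (by positivity) (by linarith), add_sub_cancel] at h2
  refine h2.congr' ?_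
  filter_upwards [hev] with x hx
  simp only [Function.comp_apply]
  rw [← P.F_add _ _ (by positivity) (by linarith), add_sub_cancel]

lemma tendsto_F' (P : S.Flow) {α : Type*} {l : Filter α} {τ : α → ℝ} {h : α → H} {t₀ : ℝ} {h₀ : H}
    (ht₀ : 0 < t₀) (hτ : Tendsto τ l (𝓝 t₀)) (hh : Tendsto h l (𝓝 h₀)) :
    Tendsto (fun x => P.F' (τ x) (h x)) l (𝓝 (P.F' t₀ h₀)) := by
  have hev : ∀ᶠ x in l, t₀ / 2 ≤ τ x := hτ.eventually_const_le (by linarith)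
  have h1 : Tendsto (fun x => P.E (τ x - t₀ / 2) (h x)) l (𝓝 (P.E (t₀ - t₀ / 2) h₀)) := by
    refine P.tendsto_E (by linarith) (hτ.sub_const _) ?_ hh
    filter_upwards [hev] with x hx
    linarith
  have h2 := ((P.F' (t₀ / 2)).continuous.tendsto _).comp h1
  rw [← P.F'_add _ _ (by positivity) (by linarith), add_sub_cancel] at h2
  refine h2.congr' ?_
  filter_upwards [hev] with x hx
  simp only [Function.comp_apply]
  rw [← P.F'_add _ _ (by positivity) (by linarith), add_sub_cancel]

lemma continuousOn_F' (P : S.Flow) (h : H) : ContinuousOn (fun t => P.F' t h) (Ioi 0) :=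
  fun t ht => by
    have : ContinuousAt (fun t => P.F' t h) t := P.tendsto_F' ht tendsto_id tendsto_const_nhds
    exact this.continuousWithinAt

lemma exists_norm_F_le (P : S.Flow) {a : ℝ} (ha : 0 < a) (b : ℝ) :
    ∃ C, 0 ≤ C ∧ ∀ t ∈ Icc a b, ∀ h, ‖P.F t h‖ ≤ C * ‖h‖ := by
  refine ⟨‖P.F a‖ * Real.exp (P.rate * (b - a)), by positivity, fun t ht h => ?_⟩
  have h1 := P.F_add a (t - a) ha (by linarith [ht.1]) h
  rw [add_sub_cancel] at h1
  rw [h1, mul_assoc]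
  refine ((P.F a).le_opNorm _).trans ?_
  gcongr
  refine (P.norm_E_le _ (by linarith [ht.1]) h).trans ?_
  gcongr
  · exact P.rate_nonneg
  · exact ht.2

lemma memLp_F (P : S.Flow) {T : ℝ} (hT : 0 < T) (h : H) :
    MemLp (fun t => P.F t h) 2 (timeMeasure T) := by
  obtain ⟨K, -, hK⟩ := S.exists_energy_bound hT
  exact (hK (fun t => P.F t h) (fun t => P.F' t h) (fun t => P.E t h) 0
    ((P.continuousOn_E h).mono Icc_subset_Ici_self) (fun t ht => P.ι_F t ht.1 h)
    (fun t ht => P.hasDerivAt_F t ht.1 h) (fun t ht => by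
      rw [P.equation t ht.1, Pi.zero_apply, zero_sub]) continuous_zero).1

/-- The semigroup of the adjoint form is the adjoint semigroup. -/
lemma inner_E (P : S.Flow) (Q : S.dual.Flow) {t : ℝ} (ht : 0 ≤ t) (g h : H) :
    inner ℝ (P.E t g) h = inner ℝ g (Q.E t h) := by
  have hd : ∀ s ∈ Ioo 0 t, HasDerivAt (fun s => inner ℝ (P.E s g) (Q.E (t - s) h)) 0 s := by
    intro s hs
    have hs' : 0 < t - s := by linarith [hs.2]
    have h1 : HasDerivAt (fun s => Q.E (t - s) h) (-S.ι (Q.F' (t - s) h)) s :=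
      (Q.hasDerivAt_E hs' h).comp_const_sub t s
    refine ((P.hasDerivAt_E hs.1 g).inner ℝ h1).congr_deriv ?_
    have e1 : inner ℝ (S.ι (P.F' s g)) (Q.E (t - s) h) = -S.a (P.F s g) (Q.F (t - s) h) := by
      rw [← Q.ι_F _ hs']
      exact DFunLike.congr_fun (P.equation s hs.1 g) (Q.F (t - s) h)
    have e2 : inner ℝ (S.ι (Q.F' (t - s) h)) (P.E s g) = -S.a (P.F s g) (Q.F (t - s) h) := by
      rw [← P.ι_F _ hs.1]
      exact DFunLike.congr_fun (Q.equation _ hs' h) (P.F s g)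
    rw [inner_neg_right, real_inner_comm, e1, e2]
    ring
  have hc : ContinuousOn (fun s => inner ℝ (P.E s g) (Q.E (t - s) h)) (Icc 0 t) := by
    refine ((P.continuousOn_E g).mono Icc_subset_Ici_self).inner
      ((Q.continuousOn_E h).comp (by fun_prop) fun s hs => ?_)
    simp only [mem_Ici]
    linarith [hs.2]
  rcases ht.eq_or_lt with rfl | ht'
  · simp [P.E_zero, Q.E_zero]
  obtain ⟨c, hc1, hc2⟩ := exists_hasDerivAt_eq_slope _ (fun _ => (0 : ℝ)) ht' hc hd
  rw [eq_comm, div_eq_zero_iff] at hc2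
  rcases hc2 with hc2 | hc2
  · simpa [P.E_zero, Q.E_zero, sub_eq_zero] using hc2
  · linarith

end Flow

end ControlSystem

/-- The primitive of a test function with zero mean is a test function. -/
lemma exists_primitive {T : ℝ} (hT : 0 < T) {θ : ℝ → ℝ} (hθ : ContDiff ℝ (⊤ : ℕ∞) θ)
    (hc : HasCompactSupport θ) (hs : tsupport θ ⊆ Ioo 0 T) (h0 : ∫ t in (0)..T, θ t = 0) :
    ∃ φ : ℝ → ℝ, ContDiff ℝ (⊤ : ℕ∞) φ ∧ HasCompactSupport φ ∧ tsupport φ ⊆ Ioo 0 T ∧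
      deriv φ = θ := by
  have hd : ∀ x, HasDerivAt (fun x => ∫ t in (0)..x, θ t) (θ x) x := fun x =>
    intervalIntegral.integral_hasDerivAt_right (hθ.continuous.intervalIntegrable _ _)
      hθ.continuous.stronglyMeasurable.stronglyMeasurableAtFilter hθ.continuous.continuousAt
  have hderiv : deriv (fun x => ∫ t in (0)..x, θ t) = θ := funext fun x => (hd x).deriv
  obtain ⟨a, b, ha, hab, hb, hsub⟩ : ∃ a b, 0 < a ∧ a ≤ b ∧ b < T ∧ tsupport θ ⊆ Icc a b := by
    rcases (tsupport θ).eq_empty_or_nonempty with he | hne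
    · exact ⟨T / 2, T / 2, by positivity, le_rfl, by linarith, by simp [he]⟩
    · obtain ⟨a, ha⟩ := hc.isCompact.exists_isLeast hne
      obtain ⟨b, hb⟩ := hc.isCompact.exists_isGreatest hne
      exact ⟨a, b, (hs ha.1).1, ha.2 hb.1, (hs hb.1).2, fun x hx => ⟨ha.2 hx, hb.2 hx⟩⟩
  have hzero : ∀ x, x ∉ Icc a b → θ x = 0 := fun x hx => by
    by_contra h
    exact hx (hsub (subset_tsupport θ h))
  have hsupp : Function.support (fun x => ∫ t in (0)..x, θ t) ⊆ Icc a b := by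
    intro x hx
    by_contra hxab
    apply hx
    rw [mem_Icc, not_and_or, not_le, not_le] at hxab
    rcases hxab with hxa | hxb
    · refine intervalIntegral.integral_zero_ae (Eventually.of_forall fun t ht => hzero t ?_)
      rintro ⟨h1, -⟩
      rw [mem_uIoc] at ht
      rcases ht with ht | ht <;> linarith [ht.1, ht.2]
    · change ∫ t in (0)..x, θ t = 0
      rw [← intervalIntegral.integral_add_adjacent_intervals
        (hθ.continuous.intervalIntegrable 0 T) (hθ.continuous.intervalIntegrable T x), h0, zero_add]
      refine intervalIntegral.integral_zero_ae (Eventually.of_forall fun t ht => hzero t ?_)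
      rintro ⟨-, h1⟩
      rw [mem_uIoc] at ht
      rcases ht with ht | ht <;> linarith [ht.1, ht.2]
  have hts : tsupport (fun x => ∫ t in (0)..x, θ t) ⊆ Icc a b := closure_minimal hsupp isClosed_Icc
  refine ⟨fun x => ∫ t in (0)..x, θ t, ?_, ?_, ?_, hderiv⟩
  · exact contDiff_infty_iff_deriv.2 ⟨fun x => (hd x).differentiableAt, by rwa [hderiv]⟩
  · exact isCompact_Icc.of_isClosed_subset (isClosed_tsupport _) hts
  · exact hts.trans fun x hx => ⟨ha.trans_le hx.1, hx.2.trans_lt hb⟩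

lemma intervalIntegral_eq_zero_off {T : ℝ} {φ : ℝ → ℝ} (hs : tsupport φ ⊆ Ioo 0 T) :
    φ 0 = 0 ∧ φ T = 0 :=
  ⟨image_eq_zero_of_notMem_tsupport fun h => (hs h).1.false,
    image_eq_zero_of_notMem_tsupport fun h => (hs h).2.false⟩

/-- A continuous function with an integrable weak derivative is a primitive of it. -/
lemma sub_eq_integral_of_weakDeriv {T : ℝ} (hT : 0 < T) {z k : ℝ → ℝ}
    (hz : ContinuousOn z (Icc 0 T)) (hk : IntervalIntegrable k volume 0 T)
    (hw : ∀ φ : ℝ → ℝ, ContDiff ℝ (⊤ : ℕ∞) φ → HasCompactSupport φ → tsupport φ ⊆ Ioo 0 T →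
      ∫ t in (0)..T, deriv φ t * z t = -∫ t in (0)..T, φ t * k t) :
    ∀ s ∈ Icc 0 T, ∀ t ∈ Icc 0 T, z t - z s = ∫ r in s..t, k r := by
  set K : ℝ → ℝ := fun x => ∫ r in (0)..x, k r with hKdef
  have hKac : AbsolutelyContinuousOnInterval K 0 T :=
    hk.absolutelyContinuousOnInterval_intervalIntegral left_mem_uIcc
  have hKc : ContinuousOn K (Icc 0 T) := by
    have := hKac.continuousOn
    rwa [uIcc_of_le hT.le] at this
  have hKd : ∀ᵐ x, x ∈ uIoc 0 T → deriv K x = k x := by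
    filter_upwards [hk.ae_hasDerivAt_integral] with x hx hx'
    exact (hx (uIoc_subset_uIcc hx') 0 left_mem_uIcc).deriv
  set w : ℝ → ℝ := fun t => z t - K t with hwdef
  have hwc : ContinuousOn w (Icc 0 T) := hz.sub hKc
  have hzero : ∀ φ : ℝ → ℝ, ContDiff ℝ (⊤ : ℕ∞) φ → HasCompactSupport φ →
      tsupport φ ⊆ Ioo 0 T → ∫ t in (0)..T, deriv φ t * w t = 0 := by
    intro φ hφ hφc hφs
    have hac : AbsolutelyContinuousOnInterval φ 0 T :=
      ((hφ.of_le (by exact_mod_cast le_top)).contDiffOn).absolutelyContinuousOnInterval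
    have h1 := hac.integral_mul_deriv_eq_deriv_mul hKac
    obtain ⟨h2, h3⟩ := intervalIntegral_eq_zero_off hφs
    have h4 : ∫ x in (0)..T, φ x * deriv K x = ∫ x in (0)..T, φ x * k x := by
      apply intervalIntegral.integral_congr_ae
      filter_upwards [hKd] with x hx hx'
      rw [hx hx']
    rw [h4, h2, h3, zero_mul, zero_mul, sub_zero, zero_sub] at h1
    have hdc : Continuous (deriv φ) := hφ.continuous_deriv (by exact_mod_cast le_top)
    have h5 : ∀ q : ℝ → ℝ, ContinuousOn q (Icc 0 T) →
        IntervalIntegrable (fun t => deriv φ t * q t) volume 0 T := fun q hq =>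
      (hdc.continuousOn.mul (by rwa [uIcc_of_le hT.le])).intervalIntegrable
    simp only [hwdef, mul_sub]
    rw [intervalIntegral.integral_sub (h5 z hz) (h5 K hKc), hw φ hφ hφc hφs, h1]
    ring
  let β : ContDiffBump (T / 2) := ⟨T / 8, T / 4, by positivity, by linarith⟩
  set b : ℝ → ℝ := β.normed volume with hb
  have hbts : tsupport b ⊆ Ioo 0 T := by
    rw [hb, β.tsupport_normed_eq, Real.closedBall_eq_Icc]
    intro x hx
    have h1 : T / 2 - T / 4 ≤ x := hx.1
    have h2 : x ≤ T / 2 + T / 4 := hx.2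
    constructor <;> linarith
  have hint : ∀ θ : ℝ → ℝ, tsupport θ ⊆ Ioo 0 T → ∀ q : ℝ → ℝ,
      ∫ t, θ t * q t = ∫ t in (0)..T, θ t * q t := fun θ hθ q => by
    rw [intervalIntegral.integral_of_le hT.le, integral_Ioc_eq_integral_Ioo, eq_comm]
    refine setIntegral_eq_integral_of_forall_compl_eq_zero fun x hx => ?_
    rw [image_eq_zero_of_notMem_tsupport fun h => hx (hθ h), zero_mul]
  have hb1 : ∫ t in (0)..T, b t = 1 := by
    have := hint b hbts 1
    simp only [Pi.one_apply, mul_one] at this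
    rw [← this]
    exact β.integral_normed
  set c := ∫ t in (0)..T, b t * w t with hc
  have hae : ∀ᵐ x : ℝ, x ∈ Ioo 0 T → w x - c = 0 := by
    refine isOpen_Ioo.ae_eq_zero_of_integral_contDiff_smul_eq_zero
      (((hwc.mono Ioo_subset_Icc_self).sub continuousOn_const).locallyIntegrableOn
        measurableSet_Ioo) fun ψ hψ hψc hψs => ?_
    have hcont : ∀ q : ℝ → ℝ, Continuous q → ∀ r : ℝ → ℝ, ContinuousOn r (Icc 0 T) →
        IntervalIntegrable (fun t => q t * r t) volume 0 T := fun q hq r hr =>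
      (hq.continuousOn.mul (by rwa [uIcc_of_le hT.le])).intervalIntegrable
    set m := ∫ t in (0)..T, ψ t with hm
    have hbd : ContDiff ℝ (⊤ : ℕ∞) b := β.contDiff_normed
    obtain ⟨φ, hφ, hφc, hφs, hφd⟩ := exists_primitive hT (θ := fun t => ψ t - m * b t)
      (hψ.sub (contDiff_const.mul hbd)) (hψc.sub (β.hasCompactSupport_normed.mul_left))
      (by
        refine (closure_mono (t := tsupport ψ ∪ tsupport b) ?_).trans ?_
        · intro x hx
          by_contra hx'
          rw [mem_union, not_or] at hx'
          apply hx
          simp only [image_eq_zero_of_notMem_tsupport hx'.1,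
            image_eq_zero_of_notMem_tsupport hx'.2, mul_zero, sub_zero]
        · rw [((isClosed_tsupport ψ).union (isClosed_tsupport b)).closure_eq]
          exact union_subset hψs hbts)
      (by
        rw [intervalIntegral.integral_sub (hψ.continuous.intervalIntegrable _ _)
          ((hbd.continuous.intervalIntegrable _ _).const_mul m),
          intervalIntegral.integral_const_mul, hb1]
        simp [hm])
    have h1 := hzero φ hφ hφc hφs
    rw [hφd] at h1
    have h2 : ∀ t, (ψ t - m * b t) * w t = ψ t * w t - m * (b t * w t) := fun t => by ring
    simp only [h2] at h1
    rw [intervalIntegral.integral_sub (hcont ψ hψ.continuous w hwc)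
      ((hcont b hbd.continuous w hwc).const_mul m), intervalIntegral.integral_const_mul] at h1
    simp only [smul_eq_mul]
    rw [hint ψ hψs]
    simp only [mul_sub]
    rw [intervalIntegral.integral_sub (hcont ψ hψ.continuous w hwc)
      (hcont ψ hψ.continuous _ continuousOn_const), intervalIntegral.integral_mul_const]
    linarith
  have heq : EqOn w (fun _ => c) (Icc 0 T) := by
    refine Measure.eqOn_Icc_of_ae_eq volume hT.ne ?_ hwc continuousOn_const
    rw [Measure.restrict_congr_set Ioo_ae_eq_Icc.symm]
    rw [EventuallyEq, ae_restrict_iff' measurableSet_Ioo]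
    filter_upwards [hae] with x hx hx'
    linarith [hx hx']
  intro s hs t ht
  have h1 : z s - K s = c := heq hs
  have h2 : z t - K t = c := heq ht
  have h3 : IntervalIntegrable k volume 0 s :=
    hk.mono_set (by rw [uIcc_of_le hs.1, uIcc_of_le hT.le]; exact Icc_subset_Icc_right hs.2)
  have h4 : IntervalIntegrable k volume 0 t :=
    hk.mono_set (by rw [uIcc_of_le ht.1, uIcc_of_le hT.le]; exact Icc_subset_Icc_right ht.2)
  rw [← intervalIntegral.integral_interval_sub_left h4 h3]
  change _ = K t - K s
  linarith

/-- A function with increments dominated by those of an absolutely continuous function is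
absolutely continuous. -/
lemma _root_.AbsolutelyContinuousOnInterval.of_dist_le {X Y : Type*} [PseudoMetricSpace X]
    [PseudoMetricSpace Y] {f : ℝ → X} {Φ : ℝ → Y} {a b : ℝ}
    (hΦ : AbsolutelyContinuousOnInterval Φ a b)
    (h : ∀ s ∈ uIcc a b, ∀ t ∈ uIcc a b, dist (f s) (f t) ≤ dist (Φ s) (Φ t)) :
    AbsolutelyContinuousOnInterval f a b := by
  rw [absolutelyContinuousOnInterval_iff] at hΦ ⊢
  intro ε hε
  obtain ⟨δ, hδ, hE⟩ := hΦ ε hε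
  refine ⟨δ, hδ, fun E hEd hEs => (Finset.sum_le_sum fun i hi => ?_).trans_lt (hE E hEd hEs)⟩
  exact h _ (hEd.1 i hi).1 _ (hEd.1 i hi).2

namespace ControlSystem

variable {V H ω : Type*}
  [NormedAddCommGroup V] [InnerProductSpace ℝ V] [CompleteSpace V]
  [NormedAddCommGroup H] [InnerProductSpace ℝ H] [CompleteSpace H]
  [MeasurableSpace ω] {ρ : Measure ω} {S : ControlSystem V H ω ρ}

/-- The continuous representative of an element of `W(0, T)` is a primitive of its derivative. -/
lemma MemW.sub_eq_integral {T : ℝ} (hT : 0 < T) {y : ℝ → V} {g : ℝ → StrongDual ℝ V}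
    (hy : S.MemW T y g) {Y : ℝ → H} (hY : ContinuousOn Y (Icc 0 T))
    (hYy : ∀ᵐ s ∂(timeMeasure T), Y s = S.ι (y s)) :
    ∀ s ∈ Icc 0 T, ∀ t ∈ Icc 0 T, S.toDualL (Y t) - S.toDualL (Y s) = ∫ r in s..t, g r := by
  have hgint : Integrable g (timeMeasure T) := hy.memLp_deriv.integrable one_le_two
  have hgi : IntervalIntegrable g volume 0 T := (integrable_timeMeasure_iff hT.le g).1 hgint
  have hyint : Integrable (fun t => S.toDualL (S.ι (y t))) (timeMeasure T) :=
    (S.toDualL.comp S.ι).integrable_comp (hy.memLp.integrable one_le_two)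
  intro s hs t ht
  have hsub : uIcc s t ⊆ uIcc 0 T := by
    rw [uIcc_of_le hT.le]
    exact uIcc_subset_Icc hs ht
  ext v
  rw [ContinuousLinearMap.intervalIntegral_apply (hgi.mono_set hsub)]
  refine sub_eq_integral_of_weakDeriv hT (z := fun t => inner ℝ (Y t) (S.ι v))
    (k := fun t => g t v) (hY.inner continuousOn_const) ?_ (fun φ hφ hφc hφs => ?_) s hs t ht
  · exact (integrable_timeMeasure_iff hT.le _).1
      ((ContinuousLinearMap.apply ℝ ℝ v).integrable_comp hgint)
  · have h1 := DFunLike.congr_fun (hy.weakDeriv φ hφ hφc hφs) v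
    have hb : ∀ ψ : ℝ → ℝ, Continuous ψ → ∃ C, ∀ᵐ t ∂(timeMeasure T), ‖ψ t‖ ≤ C := by
      intro ψ hψ
      obtain ⟨C, hC⟩ := isCompact_Icc.exists_bound_of_continuousOn (hψ.continuousOn (s := Icc 0 T))
      refine ⟨C, ?_⟩
      filter_upwards [ae_timeMeasure_mem T] with t ht
      exact hC t (Ioo_subset_Icc_self ht)
    have hdc : Continuous (deriv φ) := hφ.continuous_deriv (by exact_mod_cast le_top)
    obtain ⟨C1, hC1⟩ := hb _ hdc
    obtain ⟨C2, hC2⟩ := hb _ hφ.continuous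
    have i1 : Integrable (fun t => deriv φ t • S.toDual (S.ι (y t))) (timeMeasure T) :=
      hyint.bdd_smul C1 hdc.aestronglyMeasurable hC1
    have i2 : Integrable (fun t => φ t • g t) (timeMeasure T) :=
      hgint.bdd_smul C2 hφ.continuous.aestronglyMeasurable hC2
    rw [neg_apply, ContinuousLinearMap.integral_apply i1, ContinuousLinearMap.integral_apply i2]
      at h1
    rw [← integral_timeMeasure hT.le, ← integral_timeMeasure hT.le]
    refine Eq.trans (integral_congr_ae ?_) h1
    filter_upwards [hYy] with t ht
    simp [ht]

/-- The product rule for the pairing of an element of `W(0, T)` with a `C¹` function. -/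
lemma inner_sub_eq_integral {a b : ℝ} (hab : a ≤ b) {g : ℝ → StrongDual ℝ V}
    {Y : ℝ → H} (hY : ContinuousOn Y (Icc a b)) (hg : IntervalIntegrable g volume a b)
    (hYg : ∀ s ∈ Icc a b, ∀ t ∈ Icc a b, S.toDualL (Y t) - S.toDualL (Y s) = ∫ r in s..t, g r)
    {p p' : ℝ → V} (hp : ∀ r ∈ Icc a b, HasDerivAt p (p' r) r)
    (hp' : ContinuousOn p' (Icc a b)) :
    inner ℝ (Y b) (S.ι (p b)) - inner ℝ (Y a) (S.ι (p a)) =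
      ∫ r in a..b, (g r (p r) + inner ℝ (Y r) (S.ι (p' r))) := by
  have hpc : ContinuousOn p (Icc a b) := fun r hr => (hp r hr).continuousAt.continuousWithinAt
  have hu : uIcc a b = Icc a b := uIcc_of_le hab
  obtain ⟨C₁, hC₁⟩ := isCompact_Icc.exists_bound_of_continuousOn hpc
  obtain ⟨C₂, hC₂⟩ := isCompact_Icc.exists_bound_of_continuousOn hp'
  obtain ⟨C₃, hC₃⟩ := isCompact_Icc.exists_bound_of_continuousOn
    (S.toDualL.continuous.comp_continuousOn hY)
  have ha : a ∈ Icc a b := left_mem_Icc.2 hab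
  have hC₁0 : 0 ≤ C₁ := (norm_nonneg _).trans (hC₁ a ha)
  have hC₂0 : 0 ≤ C₂ := (norm_nonneg _).trans (hC₂ a ha)
  have hC₃0 : 0 ≤ C₃ := (norm_nonneg _).trans (hC₃ a ha)
  set f : ℝ → ℝ := fun t => S.toDualL (Y t) (p t) with hf
  have hΨ : IntervalIntegrable (fun r => C₁ * ‖g r‖ + C₃ * C₂) volume a b :=
    (hg.norm.const_mul _).add intervalIntegrable_const
  have hsub : ∀ s ∈ Icc a b, ∀ t ∈ Icc a b, uIcc s t ⊆ uIcc a b := fun s hs t ht => by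
    rw [hu]; exact uIcc_subset_Icc hs ht
  have hfac : AbsolutelyContinuousOnInterval f a b := by
    refine (hΨ.absolutelyContinuousOnInterval_intervalIntegral left_mem_uIcc).of_dist_le ?_
    rw [hu]
    have key : ∀ s ∈ Icc a b, ∀ t ∈ Icc a b, s ≤ t → dist (f s) (f t) ≤
        dist (∫ r in a..s, (C₁ * ‖g r‖ + C₃ * C₂)) (∫ r in a..t, (C₁ * ‖g r‖ + C₃ * C₂)) := by
      intro s hs t ht hst
      have h1 : f t - f s = (S.toDualL (Y t) - S.toDualL (Y s)) (p t) +
          S.toDualL (Y s) (p t - p s) := by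
        simp only [hf, sub_apply, map_sub]; ring
      have h2 : ‖p t - p s‖ ≤ C₂ * (t - s) := by
        have := (convex_Icc a b).norm_image_sub_le_of_norm_hasDerivWithin_le
          (fun r hr => (hp r hr).hasDerivWithinAt) hC₂ hs ht
        rwa [Real.norm_of_nonneg (by linarith)] at this
      have h3 : ‖S.toDualL (Y t) - S.toDualL (Y s)‖ ≤ ∫ r in s..t, ‖g r‖ := by
        rw [hYg s hs t ht]
        exact intervalIntegral.norm_integral_le_integral_norm hst
      have h4 : (∫ r in a..t, (C₁ * ‖g r‖ + C₃ * C₂)) - (∫ r in a..s, (C₁ * ‖g r‖ + C₃ * C₂)) =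
          C₁ * (∫ r in s..t, ‖g r‖) + C₃ * C₂ * (t - s) := by
        rw [intervalIntegral.integral_interval_sub_left (hΨ.mono_set (hsub a ha t ht))
          (hΨ.mono_set (hsub a ha s hs)), intervalIntegral.integral_add
          ((hg.mono_set (hsub s hs t ht)).norm.const_mul _) intervalIntegrable_const,
          intervalIntegral.integral_const_mul, intervalIntegral.integral_const, smul_eq_mul]
        ring
      rw [dist_comm, Real.dist_eq, dist_comm, Real.dist_eq, h4, h1]
      refine le_trans ?_ (le_abs_self _)
      calc |(S.toDualL (Y t) - S.toDualL (Y s)) (p t) + S.toDualL (Y s) (p t - p s)|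
          ≤ ‖(S.toDualL (Y t) - S.toDualL (Y s)) (p t)‖ + ‖S.toDualL (Y s) (p t - p s)‖ :=
            abs_add_le _ _
        _ ≤ ‖S.toDualL (Y t) - S.toDualL (Y s)‖ * ‖p t‖ + ‖S.toDualL (Y s)‖ * ‖p t - p s‖ := by
            gcongr <;> exact ContinuousLinearMap.le_opNorm _ _
        _ ≤ (∫ r in s..t, ‖g r‖) * C₁ + C₃ * (C₂ * (t - s)) := by
            gcongr
            · exact (norm_nonneg _).trans h3
            · exact hC₁ t ht
            · exact hC₃ s hs
        _ = _ := by ring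
    intro s hs t ht
    rcases le_total s t with h | h
    · exact key s hs t ht h
    · rw [dist_comm, dist_comm (∫ r in a..s, _)]
      exact key t ht s hs h
  set k : ℝ → ℝ := fun r => g r (p r) + inner ℝ (Y r) (S.ι (p' r)) with hk
  have hkint : IntervalIntegrable k volume a b := by
    refine IntervalIntegrable.add ?_ ?_
    · rw [intervalIntegrable_iff_integrableOn_Icc_of_le hab] at hg ⊢
      have hpm : AEStronglyMeasurable p (volume.restrict (Icc a b)) :=
        hpc.aestronglyMeasurable measurableSet_Icc
      refine Integrable.mono' (hg.norm.mul_const C₁) ?_ ?_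
      · exact isBoundedBilinearMap_apply.continuous.comp_aestronglyMeasurable
          (hg.aestronglyMeasurable.prodMk hpm)
      · filter_upwards [ae_restrict_mem measurableSet_Icc] with r hr
        refine ((g r).le_opNorm _).trans ?_
        gcongr
        exact hC₁ r hr
    · refine ContinuousOn.intervalIntegrable ?_
      rw [hu]
      exact hY.inner (S.ι.continuous.comp_continuousOn hp')
  have hac := hfac.sub (hkint.absolutelyContinuousOnInterval_intervalIntegral left_mem_uIcc)
  obtain ⟨c, hc⟩ := hac.const_of_ae_hasDerivAt_zero (by
    have hna : ∀ᵐ x : ℝ, x ≠ a := by simp [ae_iff, measure_singleton]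
    have hnb : ∀ᵐ x : ℝ, x ≠ b := by simp [ae_iff, measure_singleton]
    filter_upwards [hg.ae_hasDerivAt_integral, hkint.ae_hasDerivAt_integral, hna, hnb]
      with x hx1 hx2 hxa hxb hx
    have hxI : x ∈ Icc a b := by rwa [hu] at hx
    have hxIoo : x ∈ Ioo a b := ⟨lt_of_le_of_ne hxI.1 hxa.symm, lt_of_le_of_ne hxI.2 hxb⟩
    have h1 : HasDerivAt (fun t => S.toDualL (Y t)) (g x) x := by
      refine ((hx1 hx a left_mem_uIcc).add_const (S.toDualL (Y a))).congr_of_eventuallyEq ?_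
      filter_upwards [isOpen_Ioo.mem_nhds hxIoo] with t ht
      rw [← hYg a ha t (Ioo_subset_Icc_self ht)]
      abel
    have h2 : HasDerivAt f (k x) x := h1.clm_apply (hp x hxI)
    have h3 := h2.sub (hx2 hx a left_mem_uIcc)
    rwa [sub_self] at h3)
  have e1 := hc a left_mem_uIcc
  have e2 := hc b right_mem_uIcc
  simp only [Pi.sub_apply, intervalIntegral.integral_same, sub_zero] at e1 e2
  change f b - f a = _
  rw [e1, ← e2]
  ring

/-- The product rule up to end points at which the `C¹` function is only continuous into `H`. -/
lemma inner_sub_eq_integral_of_Ioo {a b : ℝ} (hab : a < b) {g : ℝ → StrongDual ℝ V}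
    {Y : ℝ → H} (hY : ContinuousOn Y (Icc a b)) (hg : IntervalIntegrable g volume a b)
    (hYg : ∀ s ∈ Icc a b, ∀ t ∈ Icc a b, S.toDualL (Y t) - S.toDualL (Y s) = ∫ r in s..t, g r)
    {p p' : ℝ → V} {P : ℝ → H} (hP : ContinuousOn P (Icc a b))
    (hPp : ∀ r ∈ Ioo a b, P r = S.ι (p r))
    (hp : ∀ r ∈ Ioo a b, HasDerivAt p (p' r) r) (hp' : ContinuousOn p' (Ioo a b))
    {k : ℝ → ℝ} (hk : IntervalIntegrable k volume a b)
    (hkg : ∀ᵐ r ∂(volume.restrict (Ioo a b)), g r (p r) + inner ℝ (Y r) (S.ι (p' r)) = k r) :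
    inner ℝ (Y b) (P b) - inner ℝ (Y a) (P a) = ∫ r in a..b, k r := by
  have hu : uIcc a b = Icc a b := uIcc_of_le hab.le
  set f : ℝ → ℝ := fun r => inner ℝ (Y r) (P r) - ∫ x in a..r, k x with hf
  have hfc : ContinuousOn f (Icc a b) := by
    refine (hY.inner hP).sub ?_
    have := intervalIntegral.continuousOn_primitive_interval' hk left_mem_uIcc
    rwa [hu] at this
  have key : ∀ s ∈ Ioo a b, ∀ t ∈ Ioo a b, s ≤ t → f s = f t := by
    intro s hs t ht hst
    have hI : Icc s t ⊆ Ioo a b := fun x hx => ⟨hs.1.trans_le hx.1, hx.2.trans_lt ht.2⟩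
    have hI' : Icc s t ⊆ Icc a b := hI.trans Ioo_subset_Icc_self
    have hu' : uIcc s t ⊆ uIcc a b := by rwa [uIcc_of_le hst, hu]
    have h1 := inner_sub_eq_integral (S := S) hst (hY.mono hI') (hg.mono_set hu')
      (fun x hx z hz => hYg x (hI' hx) z (hI' hz)) (fun r hr => hp r (hI hr)) (hp'.mono hI)
    have h2 : ∫ r in s..t, (g r (p r) + inner ℝ (Y r) (S.ι (p' r))) = ∫ r in s..t, k r := by
      apply intervalIntegral.integral_congr_ae
      rw [ae_restrict_iff' measurableSet_Ioo] at hkg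
      filter_upwards [hkg] with r hr hr'
      rw [uIoc_of_le hst] at hr'
      exact hr (hI (Ioc_subset_Icc_self hr'))
    rw [h2, ← hPp s hs, ← hPp t ht] at h1
    have has : uIcc a s ⊆ uIcc a b := by
      rw [uIcc_of_le hs.1.le, hu]; exact Icc_subset_Icc_right hs.2.le
    have hat : uIcc a t ⊆ uIcc a b := by
      rw [uIcc_of_le ht.1.le, hu]; exact Icc_subset_Icc_right ht.2.le
    rw [← intervalIntegral.integral_interval_sub_left (hk.mono_set hat) (hk.mono_set has)] at h1
    simp only [hf]
    linarith
  have hm : (a + b) / 2 ∈ Ioo a b := by constructor <;> linarith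
  have heq : EqOn f (fun _ => f ((a + b) / 2)) (Ioo a b) := by
    intro s hs
    rcases le_total s ((a + b) / 2) with h | h
    · exact key s hs _ hm h
    · exact (key _ hm s hs h).symm
  have heq' := heq.of_subset_closure hfc continuousOn_const Ioo_subset_Icc_self
    (closure_Ioo hab.ne).symm.subset
  have e1 := heq' (left_mem_Icc.2 hab.le)
  have e2 := heq' (right_mem_Icc.2 hab.le)
  simp only [hf, intervalIntegral.integral_same, sub_zero] at e1 e2
  linarith

end ControlSystem

/-- The affine time reversal `s ↦ ν (T - s)` maps `(0, T)` to `(0, ν T)`. -/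
lemma measurePreserving_reversal {ν T : ℝ} (hν : 0 < ν) :
    MeasurePreserving (fun s => ν * (T - s)) (timeMeasure T)
      (ENNReal.ofReal ν⁻¹ • timeMeasure (ν * T)) := by
  have hm : Measurable fun s : ℝ => ν * (T - s) := by fun_prop
  refine ⟨hm, ?_⟩
  have h1 : Measure.map (fun s => ν * (T - s)) volume = ENNReal.ofReal ν⁻¹ • volume := by
    have h2 : (fun s => ν * (T - s)) = (fun s => ν * s) ∘ fun s => T - s := rfl
    rw [h2, ← Measure.map_map (by fun_prop) (by fun_prop),
      (Measure.measurePreserving_sub_left volume T).map_eq, Real.map_volume_mul_left hν.ne',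
      abs_of_pos (inv_pos.2 hν)]
  have h2 : Ioo 0 T = (fun s => ν * (T - s)) ⁻¹' Ioo 0 (ν * T) := by
    ext s
    simp only [mem_Ioo, mem_preimage]
    constructor
    · rintro ⟨h1, h2⟩
      exact ⟨mul_pos hν (by linarith), mul_lt_mul_of_pos_left (by linarith) hν⟩
    · rintro ⟨h1, h2⟩
      have := pos_of_mul_pos_right h1 hν.le
      have := lt_of_mul_lt_mul_left h2 hν.le
      constructor <;> linarith
  rw [timeMeasure, h2, ← Measure.restrict_map hm measurableSet_Ioo, h1, Measure.restrict_smul,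
    timeMeasure]

lemma memLp_comp_reversal {E : Type*} [NormedAddCommGroup E] {ν T : ℝ} (hν : 0 < ν) {f : ℝ → E}
    (hf : MemLp f 2 (timeMeasure (ν * T))) :
    MemLp (fun s => f (ν * (T - s))) 2 (timeMeasure T) :=
  (hf.smul_measure ENNReal.ofReal_ne_top).comp_measurePreserving (measurePreserving_reversal hν)

lemma ae_comp_reversal {ν T : ℝ} (hν : 0 < ν) {p : ℝ → Prop}
    (hp : ∀ᵐ t ∂(timeMeasure (ν * T)), p t) : ∀ᵐ s ∂(timeMeasure T), p (ν * (T - s)) :=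
  (measurePreserving_reversal hν).quasiMeasurePreserving.ae (Measure.ae_smul_measure hp _)

lemma timeMeasure_mono {s t : ℝ} (h : s ≤ t) : timeMeasure s ≤ timeMeasure t :=
  Measure.restrict_mono (Ioo_subset_Ioo_right h) le_rfl

namespace ControlSystem

variable {V H ω : Type*}
  [NormedAddCommGroup V] [InnerProductSpace ℝ V] [CompleteSpace V]
  [NormedAddCommGroup H] [InnerProductSpace ℝ H] [CompleteSpace H]
  [MeasurableSpace ω] {ρ : Measure ω} {S : ControlSystem V H ω ρ}

lemma integrable_B {μ : Measure ℝ} {u : ℝ → Lp ℝ 2 ρ} {p : ℝ → V} (hu : MemLp u 2 μ)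
    (hp : MemLp p 2 μ) : Integrable (fun t => S.B (u t) (p t)) μ := by
  refine Integrable.mono' ((hu.norm.integrable_mul hp.norm).const_mul ‖S.B‖) ?_ ?_
  · exact isBoundedBilinearMap_apply.continuous.comp_aestronglyMeasurable
      ((S.B.continuous.comp_aestronglyMeasurable hu.1).prodMk hp.1)
  · refine Eventually.of_forall fun t => ?_
    simp only [Pi.mul_apply]
    rw [← mul_assoc]
    refine ((S.B (u t)).le_opNorm _).trans ?_
    gcongr
    exact S.B.le_opNorm _

lemma eq_of_hasTrace {T : ℝ} (hT : 0 < T) {y : ℝ → V} {Y : ℝ → H}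
    (hY : ContinuousOn Y (Icc 0 T)) (hYy : ∀ᵐ s ∂(timeMeasure T), Y s = S.ι (y s)) {t : ℝ}
    (ht : t ∈ Icc 0 T) {h : H} (hh : S.HasTrace T y t h) : Y t = h := by
  obtain ⟨Y', hY', hY'y, rfl⟩ := hh
  refine Measure.eqOn_Icc_of_ae_eq volume hT.ne ?_ hY hY' ht
  rw [Measure.restrict_congr_set Ioo_ae_eq_Icc.symm]
  filter_upwards [hYy, hY'y] with s h1 h2
  rw [h1, h2]

/-- The variation of constants formula for weak solutions, tested with `q ∈ H`. -/
theorem inner_state (Q : S.dual.Flow) {T ν : ℝ} (hν : 0 < ν) {u : ℝ → Lp ℝ 2 ρ}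
    (hu : MemLp u 2 (timeMeasure T)) {y : ℝ → V} {g : ℝ → StrongDual ℝ V} (hy : S.MemW T y g)
    (hg : ∀ᵐ t ∂(timeMeasure T), g t + ν • S.a (y t) = ν • S.B (u t)) {Y : ℝ → H}
    (hY : ContinuousOn Y (Icc 0 T)) (hYy : ∀ᵐ s ∂(timeMeasure T), Y s = S.ι (y s))
    {t : ℝ} (ht0 : 0 < t) (htT : t ≤ T) (q : H) :
    inner ℝ (Y t) q = inner ℝ (Y 0) (Q.E (ν * t) q) +
      ν * ∫ s in (0)..t, S.B (u s) (Q.F (ν * (t - s)) q) := by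
  have hT : 0 < T := ht0.trans_le htT
  have hsub : Icc 0 t ⊆ Icc 0 T := Icc_subset_Icc_right htT
  have hgi : IntervalIntegrable g volume 0 T :=
    (integrable_timeMeasure_iff hT.le g).1 (hy.memLp_deriv.integrable one_le_two)
  have hinc := hy.sub_eq_integral hT hY hYy
  have hpos : ∀ r ∈ Ioo 0 t, 0 < ν * (t - r) := fun r hr => mul_pos hν (by linarith [hr.2])
  have hpm : MemLp (fun s => Q.F (ν * (t - s)) q) 2 (timeMeasure t) :=
    memLp_comp_reversal hν (f := fun s => Q.F s q) (Q.memLp_F (mul_pos hν ht0) q)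
  have hk : IntervalIntegrable (fun s => S.B (u s) (Q.F (ν * (t - s)) q)) volume 0 t :=
    (integrable_timeMeasure_iff ht0.le _).1
      (integrable_B (hu.mono_measure (timeMeasure_mono htT)) hpm)
  have h1 := inner_sub_eq_integral_of_Ioo (S := S) ht0 (hY.mono hsub)
    (hgi.mono_set (by rw [uIcc_of_le ht0.le, uIcc_of_le hT.le]; exact hsub))
    (fun a ha b hb => hinc a (hsub ha) b (hsub hb))
    (p := fun r => Q.F (ν * (t - r)) q) (p' := fun r => -(ν • Q.F' (ν * (t - r)) q))
    (P := fun r => Q.E (ν * (t - r)) q) (k := fun r => ν * S.B (u r) (Q.F (ν * (t - r)) q))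
    ((Q.continuousOn_E q).comp (by fun_prop) fun r hr => by
      simp only [mem_Ici]
      exact mul_nonneg hν.le (by linarith [hr.2]))
    (fun r hr => (Q.ι_F _ (hpos r hr) q).symm)
    (fun r hr => by
      have e1 := Q.hasDerivAt_F _ (hpos r hr) q
      have e2 : HasDerivAt (fun r => ν * (t - r)) (-ν) r := by
        simpa using ((hasDerivAt_id r).const_sub t).const_mul ν
      have := e1.scomp r e2
      simpa [Function.comp_def] using this)
    (((Q.continuousOn_F' q).comp (by fun_prop) fun r hr => hpos r hr).const_smul ν).neg
    (hk.const_mul ν)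
    (by
      have hle : volume.restrict (Ioo 0 t) ≤ timeMeasure T := timeMeasure_mono htT
      filter_upwards [ae_mono hle hg, ae_mono hle hYy, ae_restrict_mem measurableSet_Ioo]
        with r h1 h2 h3
      have e1 := DFunLike.congr_fun h1 (Q.F (ν * (t - r)) q)
      have e2 : inner ℝ (S.ι (Q.F' (ν * (t - r)) q)) (S.ι (y r)) =
          -S.a (y r) (Q.F (ν * (t - r)) q) :=
        DFunLike.congr_fun (Q.equation _ (hpos r h3) q) (y r)
      simp only [add_apply, smul_apply, smul_eq_mul] at e1
      rw [h2, map_neg, map_smul, inner_neg_right, inner_smul_right, real_inner_comm, e2]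
      linarith)
  rw [intervalIntegral.integral_const_mul] at h1
  simp only [sub_self, mul_zero, Q.E_zero, one_apply_eq_self, sub_zero] at h1
  linarith

/-- Adjoint states are given by the adjoint semigroup. -/
theorem adjointState_eq (P : S.Flow) (Q : S.dual.Flow) {ν : ℝ} (hν : 0 < ν) {p1 : H} {p : ℝ → V}
    (hp : S.IsAdjointState ν p1 p) :
    ∀ᵐ t ∂(timeMeasure 1), p t = Q.F (ν * (1 - t)) p1 := by
  obtain ⟨⟨g, hW, hg⟩, Z, hZ, hZp, hZ1⟩ := hp
  have hgi : IntervalIntegrable g volume 0 1 :=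
    (integrable_timeMeasure_iff zero_le_one g).1 (hW.memLp_deriv.integrable one_le_two)
  have hinc := hW.sub_eq_integral one_pos hZ hZp
  have key : ∀ t ∈ Ioo (0 : ℝ) 1, Z t = Q.E (ν * (1 - t)) p1 := by
    intro t ht
    refine ext_inner_right ℝ fun h => ?_
    have hsub : Icc t 1 ⊆ Icc 0 1 := Icc_subset_Icc_left ht.1.le
    have hpos : ∀ r ∈ Ioo t 1, 0 < ν * (r - t) := fun r hr => mul_pos hν (by linarith [hr.1])
    have h1 := inner_sub_eq_integral_of_Ioo (S := S) ht.2 (hZ.mono hsub)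
      (hgi.mono_set (by rw [uIcc_of_le ht.2.le, uIcc_of_le zero_le_one]; exact hsub))
      (fun a ha b hb => hinc a (hsub ha) b (hsub hb))
      (p := fun r => P.F (ν * (r - t)) h) (p' := fun r => ν • P.F' (ν * (r - t)) h)
      (P := fun r => P.E (ν * (r - t)) h) (k := fun r => 0)
      ((P.continuousOn_E h).comp (by fun_prop) fun r hr => by
        simp only [mem_Ici]
        exact mul_nonneg hν.le (by linarith [hr.1]))
      (fun r hr => (P.ι_F _ (hpos r hr) h).symm)
      (fun r hr => by
        have e1 := P.hasDerivAt_F _ (hpos r hr) h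
        have e2 : HasDerivAt (fun r => ν * (r - t)) ν r := by
          simpa using ((hasDerivAt_id r).sub_const t).const_mul ν
        exact e1.scomp r e2)
      (((P.continuousOn_F' h).comp (by fun_prop) fun r hr => hpos r hr).const_smul ν)
      intervalIntegrable_const
      (by
        have hle : volume.restrict (Ioo t 1) ≤ timeMeasure 1 :=
          Measure.restrict_mono (Ioo_subset_Ioo_left ht.1.le) le_rfl
        filter_upwards [ae_mono hle hg, ae_mono hle hZp, ae_restrict_mem measurableSet_Ioo]
          with r h1 h2 h3
        have e1 := DFunLike.congr_fun h1 (P.F (ν * (r - t)) h)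
        have e2 : inner ℝ (S.ι (P.F' (ν * (r - t)) h)) (S.ι (p r)) =
            -S.a (P.F (ν * (r - t)) h) (p r) :=
          DFunLike.congr_fun (P.equation _ (hpos r h3) h) (p r)
        simp only [add_apply, smul_apply, neg_apply, smul_eq_mul, zero_apply,
          ContinuousLinearMap.flip_apply] at e1
        rw [h2, map_smul, inner_smul_right, real_inner_comm, e2]
        linarith)
    have hnn : 0 ≤ ν * (1 - t) := mul_nonneg hν.le (by linarith [ht.2])
    simp only [sub_self, mul_zero, P.E_zero, one_apply_eq_self,
      intervalIntegral.integral_zero, hZ1] at h1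
    rw [real_inner_comm, P.inner_E Q hnn] at h1
    rw [real_inner_comm h]
    rw [real_inner_comm] at h1
    linarith [real_inner_comm (Z t) h]
  filter_upwards [hZp, ae_timeMeasure_mem 1] with t h1 h2
  apply S.ι_injective
  rw [← h1, key t h2]
  exact (Q.ι_F _ (mul_pos hν (by linarith [h2.2])) p1).symm

/-- The value at time `τ` of the state with control `w`, with the time of `w` reversed, tested
with `q`. -/
noncomputable def pairing (Q : S.dual.Flow) (τ : ℝ) (w : ℝ → Lp ℝ 2 ρ) (q : H) : ℝ :=
  inner ℝ S.y0 (Q.E τ q) + ∫ s, S.B (w s) (Q.F s q) ∂(timeMeasure τ)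

lemma Reaches.inner_eq (Q : S.dual.Flow) {T ν : ℝ} (hT : 0 < T) (hν : 0 < ν) {u : ℝ → Lp ℝ 2 ρ}
    (hu : MemLp u 2 (timeMeasure T)) {h : H} (hh : S.Reaches T ν u h) (q : H) :
    inner ℝ h q = pairing Q (ν * T) (fun s => u (ν⁻¹ * (ν * T - s))) q := by
  obtain ⟨y, ⟨⟨g, hW, hg⟩, Y, hY, hYy, hY0⟩, hh⟩ := hh
  have h1 := eq_of_hasTrace hT hY hYy ⟨hT.le, le_rfl⟩ hh
  have h2 := inner_state Q hν hu hW hg hY hYy hT le_rfl q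
  rw [h1, hY0] at h2
  rw [h2, pairing, integral_timeMeasure (by positivity)]
  have h3 := intervalIntegral.integral_comp_sub_mul (a := 0) (b := T)
    (fun s => S.B (u (ν⁻¹ * (ν * T - s))) (Q.F s q)) hν.ne' (ν * T)
  simp only [sub_self, mul_zero, sub_zero, sub_sub_cancel, inv_mul_cancel_left₀ hν.ne',
    smul_eq_mul] at h3
  congr 1
  rw [← mul_right_inj' (inv_ne_zero hν.ne'), ← h3, inv_mul_cancel_left₀ hν.ne']
  simp only [mul_sub]

end ControlSystem

lemma exists_ae_bound_of_continuous {ψ : ℝ → ℝ} (hψ : Continuous ψ) (T : ℝ) :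
    ∃ C, 0 ≤ C ∧ ∀ᵐ t ∂(timeMeasure T), ‖ψ t‖ ≤ C := by
  obtain ⟨C, hC⟩ := isCompact_Icc.exists_bound_of_continuousOn (hψ.continuousOn (s := Icc 0 T))
  refine ⟨max C 0, le_max_right _ _, ?_⟩
  filter_upwards [ae_timeMeasure_mem T] with t ht
  exact (hC t (Ioo_subset_Icc_self ht)).trans (le_max_left _ _)

lemma memLp_of_continuous {E : Type*} [NormedAddCommGroup E] [SecondCountableTopologyEither ℝ E]
    {f : ℝ → E} (hf : Continuous f) (T : ℝ) : MemLp f 2 (timeMeasure T) := by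
  obtain ⟨C, -, hC⟩ := exists_ae_bound_of_continuous hf.norm T
  refine MemLp.of_bound hf.aestronglyMeasurable C ?_
  simpa using hC

lemma norm_toLp_sq {E : Type*} [NormedAddCommGroup E] [InnerProductSpace ℝ E] {μ : Measure ℝ}
    {f : ℝ → E} (hf : MemLp f 2 μ) : ‖hf.toLp f‖ ^ 2 = ∫ t, ‖f t‖ ^ 2 ∂μ := by
  rw [← real_inner_self_eq_norm_sq, L2.inner_def]
  refine integral_congr_ae ?_
  filter_upwards [hf.coeFn_toLp] with t ht
  rw [ht, real_inner_self_eq_norm_sq]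

/-- Integration against a bounded function is continuous with respect to `L²` convergence. -/
lemma tendsto_integral_smul_of_eLpNorm {X Z : Type*} [NormedAddCommGroup X] [NormedSpace ℝ X]
    [NormedAddCommGroup Z] [NormedSpace ℝ Z] {T : ℝ} {ψ : ℝ → ℝ} (hψ : Continuous ψ)
    (A : X →L[ℝ] Z) {f : ℕ → ℝ → X} {f₀ : ℝ → X} (hf : ∀ n, MemLp (f n) 2 (timeMeasure T))
    (hf₀ : MemLp f₀ 2 (timeMeasure T))
    (h : Tendsto (fun n => eLpNorm (f n - f₀) 2 (timeMeasure T)) atTop (𝓝 0)) :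
    Tendsto (fun n => ∫ t, ψ t • A (f n t) ∂(timeMeasure T)) atTop
      (𝓝 (∫ t, ψ t • A (f₀ t) ∂(timeMeasure T))) := by
  obtain ⟨C, hC0, hC⟩ := exists_ae_bound_of_continuous hψ T
  have hint : ∀ g : ℝ → X, MemLp g 2 (timeMeasure T) →
      Integrable (fun t => ψ t • A (g t)) (timeMeasure T) := fun g hg =>
    (A.integrable_comp (hg.integrable one_le_two)).bdd_smul C hψ.aestronglyMeasurable hC
  refine tendsto_integral_of_L1' _ (hint f₀ hf₀).1 (Eventually.of_forall fun n => hint _ (hf n)) ?_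
  set M : ENNReal := ENNReal.ofReal (C * ‖A‖) *
    (timeMeasure T univ) ^ (1 / (1 : ENNReal).toReal - 1 / (2 : ENNReal).toReal) with hM
  have hMtop : M ≠ ⊤ := by
    refine ENNReal.mul_ne_top ENNReal.ofReal_ne_top ?_
    exact ENNReal.rpow_ne_top_of_nonneg (by norm_num) (measure_ne_top _ _)
  have hlim : Tendsto (fun n => M * eLpNorm (f n - f₀) 2 (timeMeasure T)) atTop (𝓝 0) := by
    have := ENNReal.Tendsto.const_mul h (Or.inr hMtop)
    rwa [mul_zero] at this
  refine tendsto_of_tendsto_of_tendsto_of_le_of_le tendsto_const_nhds hlim (fun _ => bot_le)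
    fun n => ?_
  have h1 : eLpNorm ((fun t => ψ t • A (f n t)) - fun t => ψ t • A (f₀ t)) 1 (timeMeasure T) ≤
      ENNReal.ofReal (C * ‖A‖) * eLpNorm (f n - f₀) 1 (timeMeasure T) := by
    refine eLpNorm_le_mul_eLpNorm_of_ae_le_mul ?_ 1
    filter_upwards [hC] with t ht
    rw [Pi.sub_apply, ← smul_sub, ← map_sub, norm_smul, mul_assoc]
    exact mul_le_mul ht (A.le_opNorm _) (norm_nonneg _) hC0
  refine h1.trans ?_
  rw [hM, mul_assoc]
  gcongr
  rw [mul_comm]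
  exact eLpNorm_le_eLpNorm_mul_rpow_measure_univ (by norm_num) ((hf n).1.sub hf₀.1)

namespace ControlSystem

variable {V H ω : Type*}
  [NormedAddCommGroup V] [InnerProductSpace ℝ V] [CompleteSpace V]
  [NormedAddCommGroup H] [InnerProductSpace ℝ H] [CompleteSpace H]
  [MeasurableSpace ω] {ρ : Measure ω} {S : ControlSystem V H ω ρ}

/-- Classical derivatives are weak derivatives. -/
lemma hasWeakDeriv_of_hasDerivAt {T : ℝ} (hT : 0 < T) {y y' : ℝ → V} {g : ℝ → StrongDual ℝ V}
    (hy : MemLp y 2 (timeMeasure T)) (hg : MemLp g 2 (timeMeasure T))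
    (hd : ∀ t ∈ Ioo 0 T, HasDerivAt y (y' t) t)
    (hyg : ∀ t ∈ Ioo 0 T, g t = S.toDualL (S.ι (y' t))) : S.HasWeakDeriv T y g := by
  intro φ hφ hφc hφs
  set L : V →L[ℝ] StrongDual ℝ V := S.toDualL.comp S.ι with hL
  have hdc : Continuous (deriv φ) := hφ.continuous_deriv (by exact_mod_cast le_top)
  obtain ⟨C1, -, hC1⟩ := exists_ae_bound_of_continuous hdc T
  obtain ⟨C2, -, hC2⟩ := exists_ae_bound_of_continuous hφ.continuous T
  have i1 : Integrable (fun t => deriv φ t • L (y t)) (timeMeasure T) :=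
    (L.integrable_comp (hy.integrable one_le_two)).bdd_smul C1 hdc.aestronglyMeasurable hC1
  have i2 : Integrable (fun t => φ t • g t) (timeMeasure T) :=
    (hg.integrable one_le_two).bdd_smul C2 hφ.continuous.aestronglyMeasurable hC2
  have hoff : ∀ t, t ∉ Ioo 0 T → φ =ᶠ[𝓝 t] 0 := fun t ht =>
    notMem_tsupport_iff_eventuallyEq.1 fun h => ht (hφs h)
  have hG : ∀ t, HasDerivAt (fun t => φ t • L (y t)) (deriv φ t • L (y t) + φ t • g t) t := by
    intro t
    by_cases ht : t ∈ Ioo 0 T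
    · have h1 : HasDerivAt φ (deriv φ t) t :=
        (hφ.differentiable (by simp)).differentiableAt.hasDerivAt
      have h2 : HasDerivAt (fun t => L (y t)) (g t) t := by
        rw [hyg t ht]
        exact L.hasFDerivAt.comp_hasDerivAt t (hd t ht)
      rw [add_comm]
      exact h1.smul h2
    · have h1 := hoff t ht
      rw [h1.deriv_eq, h1.eq_of_nhds]
      simp only [Pi.zero_apply, zero_smul, add_zero, Pi.zero_def, deriv_const]
      refine (hasDerivAt_const t 0).congr_of_eventuallyEq ?_
      filter_upwards [h1] with s hs
      rw [hs, Pi.zero_apply, zero_smul]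
  have h1 := intervalIntegral.integral_eq_sub_of_hasDerivAt (a := 0) (b := T) (fun t _ => hG t)
    ((integrable_timeMeasure_iff hT.le _).1 (i1.add i2))
  obtain ⟨h2, h3⟩ := intervalIntegral_eq_zero_off hφs
  rw [h2, h3, zero_smul, zero_smul, sub_zero, ← integral_timeMeasure hT.le,
    integral_add i1 i2] at h1
  exact eq_neg_of_add_eq_zero_left h1

/-- The adjoint equation is solved by the adjoint semigroup. -/
theorem isAdjointState_flow (Q : S.dual.Flow) {ν : ℝ} (hν : 0 < ν) (p1 : H) :
    S.IsAdjointState ν p1 fun t => Q.F (ν * (1 - t)) p1 := by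
  have hpos : ∀ t ∈ Ioo (0 : ℝ) 1, 0 < ν * (1 - t) := fun r hr => mul_pos hν (by linarith [hr.2])
  have hp : MemLp (fun t => Q.F (ν * (1 - t)) p1) 2 (timeMeasure 1) :=
    memLp_comp_reversal hν (f := fun s => Q.F s p1) (Q.memLp_F (by positivity) p1)
  have hg : MemLp (fun t => (ν • S.a.flip) (Q.F (ν * (1 - t)) p1)) 2 (timeMeasure 1) :=
    (ν • S.a.flip).comp_memLp' hp
  refine ⟨⟨_, ⟨hp, hg, ?_⟩, Eventually.of_forall fun t => ?_⟩,
    fun t => Q.E (ν * (1 - t)) p1, ?_, ?_, ?_⟩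
  · refine hasWeakDeriv_of_hasDerivAt one_pos hp hg
      (y' := fun t => -(ν • Q.F' (ν * (1 - t)) p1)) (fun t ht => ?_) fun t ht => ?_
    · have e1 := Q.hasDerivAt_F _ (hpos t ht) p1
      have e2 : HasDerivAt (fun r => ν * (1 - r)) (-ν) t := by
        simpa using ((hasDerivAt_id t).const_sub 1).const_mul ν
      have := e1.scomp t e2
      simpa [Function.comp_def] using this
    · have h1 : S.toDualL (S.ι (Q.F' (ν * (1 - t)) p1)) = -S.a.flip (Q.F (ν * (1 - t)) p1) :=
        Q.equation _ (hpos t ht) p1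
      rw [map_neg, map_smul, map_neg, map_smul, h1, smul_neg, neg_neg, smul_apply]
  · rw [smul_apply, neg_add_cancel]
  · refine (Q.continuousOn_E p1).comp (by fun_prop) fun t ht => ?_
    simp only [mem_Ici]
    exact mul_nonneg hν.le (by linarith [ht.2])
  · filter_upwards [ae_timeMeasure_mem 1] with t ht
    exact (Q.ι_F _ (hpos t ht) p1).symm
  · simp [Q.E_zero]

/-- Classical solutions of the state equation with continuous control. -/
structure IsClassical (S : ControlSystem V H ω ρ) (T : ℝ) (u : ℝ → Lp ℝ 2 ρ) (y : ℝ → V)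
    (Y : ℝ → H) : Prop where
  continuous_control : Continuous u
  continuousOn : ContinuousOn Y (Icc 0 T)
  eq_ι : ∀ t ∈ Ioo 0 T, S.ι (y t) = Y t
  exists_deriv : ∃ y' : ℝ → V, ∀ t ∈ Ioo 0 T, HasDerivAt y (y' t) t ∧
    S.toDualL (S.ι (y' t)) = S.B (u t) - S.a (y t)

namespace IsClassical

variable {T : ℝ} {u u₁ u₂ : ℝ → Lp ℝ 2 ρ} {y y₁ y₂ : ℝ → V} {Y Y₁ Y₂ : ℝ → H}

lemma add (h₁ : S.IsClassical T u₁ y₁ Y₁) (h₂ : S.IsClassical T u₂ y₂ Y₂) :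
    S.IsClassical T (u₁ + u₂) (y₁ + y₂) (Y₁ + Y₂) := by
  obtain ⟨y₁', hy₁⟩ := h₁.exists_deriv
  obtain ⟨y₂', hy₂⟩ := h₂.exists_deriv
  refine ⟨h₁.1.add h₂.1, h₁.2.add h₂.2, fun t ht => ?_, y₁' + y₂', fun t ht =>
    ⟨(hy₁ t ht).1.add (hy₂ t ht).1, ?_⟩⟩
  · simp [h₁.eq_ι t ht, h₂.eq_ι t ht]
  · simp only [Pi.add_apply, map_add, (hy₁ t ht).2, (hy₂ t ht).2]
    abel

lemma sub (h₁ : S.IsClassical T u₁ y₁ Y₁) (h₂ : S.IsClassical T u₂ y₂ Y₂) :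
    S.IsClassical T (u₁ - u₂) (y₁ - y₂) (Y₁ - Y₂) := by
  obtain ⟨y₁', hy₁⟩ := h₁.exists_deriv
  obtain ⟨y₂', hy₂⟩ := h₂.exists_deriv
  refine ⟨h₁.1.sub h₂.1, h₁.2.sub h₂.2, fun t ht => ?_, y₁' - y₂', fun t ht =>
    ⟨(hy₁ t ht).1.sub (hy₂ t ht).1, ?_⟩⟩
  · simp [h₁.eq_ι t ht, h₂.eq_ι t ht]
  · simp only [Pi.sub_apply, map_sub, (hy₁ t ht).2, (hy₂ t ht).2]
    abel

/-- The energy inequality in terms of `L²` norms. -/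
lemma exists_bound (S : ControlSystem V H ω ρ) {T : ℝ} (hT : 0 < T) :
    ∃ K : ℝ, 0 ≤ K ∧ ∀ (u : ℝ → Lp ℝ 2 ρ) (y : ℝ → V) (Y : ℝ → H), S.IsClassical T u y Y →
      Y 0 = 0 → ∀ hu : MemLp u 2 (timeMeasure T), ∃ hy : MemLp y 2 (timeMeasure T),
      ‖hy.toLp y‖ ≤ K * ‖hu.toLp u‖ ∧ ∀ t ∈ Icc 0 T, ‖Y t‖ ≤ K * ‖hu.toLp u‖ := by
  obtain ⟨K, hK0, hK⟩ := S.exists_energy_bound hT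
  refine ⟨Real.sqrt K * ‖S.B‖, by positivity, fun u y Y h hY0 hu => ?_⟩
  obtain ⟨y', hy'⟩ := h.exists_deriv
  obtain ⟨h1, h2, h3⟩ := hK y y' Y (fun t => S.B (u t)) h.continuousOn h.eq_ι
    (fun t ht => (hy' t ht).1) (fun t ht => (hy' t ht).2) (S.B.continuous.comp h.continuous_control)
  have h4 : ∫ t, ‖S.B (u t)‖ ^ 2 ∂(timeMeasure T) ≤ ‖S.B‖ ^ 2 * ‖hu.toLp u‖ ^ 2 := by
    rw [norm_toLp_sq, ← integral_const_mul]
    refine integral_mono_of_nonneg (Eventually.of_forall fun t => by positivity)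
      (((memLp_two_iff_integrable_sq_norm hu.1).1 hu).const_mul _)
      (Eventually.of_forall fun t => ?_)
    simp only
    rw [← mul_pow]
    gcongr
    exact S.B.le_opNorm _
  have h5 : K * (‖Y 0‖ ^ 2 + ∫ t, ‖S.B (u t)‖ ^ 2 ∂(timeMeasure T)) ≤
      (Real.sqrt K * ‖S.B‖ * ‖hu.toLp u‖) ^ 2 := by
    rw [hY0, norm_zero, mul_pow, mul_pow, Real.sq_sqrt hK0, mul_assoc]
    gcongr
    simpa using h4
  refine ⟨h1, ?_, fun t ht => ?_⟩
  · refine le_of_abs_le (abs_le_of_sq_le_sq ?_ (by positivity))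
    rw [norm_toLp_sq]
    exact h2.trans h5
  · exact le_of_abs_le (abs_le_of_sq_le_sq ((h3 t ht).trans h5) (by positivity))

end IsClassical

/-- The continuous controls with a classical state with initial value zero. -/
def classicalControls (S : ControlSystem V H ω ρ) (T : ℝ) : Set (ℝ → Lp ℝ 2 ρ) :=
  {u | ∃ y Y, S.IsClassical T u y Y ∧ Y 0 = 0}

lemma classicalControls_add {T : ℝ} {u₁ u₂ : ℝ → Lp ℝ 2 ρ} (h₁ : u₁ ∈ S.classicalControls T)
    (h₂ : u₂ ∈ S.classicalControls T) : u₁ + u₂ ∈ S.classicalControls T := by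
  obtain ⟨y₁, Y₁, h₁, hY₁⟩ := h₁
  obtain ⟨y₂, Y₂, h₂, hY₂⟩ := h₂
  exact ⟨_, _, h₁.add h₂, by simp [hY₁, hY₂]⟩

lemma classicalControls_zero (T : ℝ) : (0 : ℝ → Lp ℝ 2 ρ) ∈ S.classicalControls T :=
  ⟨0, 0, ⟨continuous_zero, continuousOn_const, fun t _ => by simp, 0, fun t _ =>
    ⟨hasDerivAt_const t 0, by simp only [Pi.zero_apply, map_zero, sub_zero]⟩⟩, rfl⟩

lemma classicalControls_sum {T : ℝ} {I : Type*} (s : Finset I) {u : I → ℝ → Lp ℝ 2 ρ}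
    (h : ∀ i, u i ∈ S.classicalControls T) : ∑ i ∈ s, u i ∈ S.classicalControls T := by
  classical
  induction s using Finset.induction_on with
  | empty => simpa using classicalControls_zero T
  | insert i s hi ih => rw [Finset.sum_insert hi]; exact classicalControls_add (h i) ih

/-- Exponential controls have classical states. -/
lemma classicalControls_exp (P : S.Flow) (T : ℝ) {α₀ ω₀ κ : ℝ} (hα : 0 < α₀) (hκ : ω₀ ≤ κ)
    (hG : ∀ v : V, α₀ * ‖v‖ ^ 2 ≤ S.a v v + ω₀ * ‖S.ι v‖ ^ 2) (c : Lp ℝ 2 ρ) :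
    (fun t => Real.exp (κ * t) • c) ∈ S.classicalControls T := by
  obtain ⟨L, hL⟩ := S.exists_resolvent hα hκ hG
  set v := L (S.B c) with hv
  have hv' : S.a v + κ • S.toDualL (S.ι v) = S.B c := hL (S.B c)
  have he : ∀ t, HasDerivAt (fun t => Real.exp (κ * t)) (Real.exp (κ * t) * κ) t := fun t => by
    have := ((hasDerivAt_id t).const_mul κ).exp
    simpa using this
  have hec : Continuous fun t => Real.exp (κ * t) := by fun_prop
  refine ⟨fun t => Real.exp (κ * t) • v + P.F t (-S.ι v),
    fun t => Real.exp (κ * t) • S.ι v + P.E t (-S.ι v), ⟨?_, ?_, ?_, ?_⟩, ?_⟩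
  · exact hec.smul continuous_const
  · refine ContinuousOn.add ?_ ((P.continuousOn_E _).mono Icc_subset_Ici_self)
    exact (hec.smul continuous_const).continuousOn
  · intro t ht
    rw [map_add, map_smul, P.ι_F t ht.1]
  · refine ⟨fun t => (Real.exp (κ * t) * κ) • v + P.F' t (-S.ι v), fun t ht =>
      ⟨((he t).smul_const v).add (P.hasDerivAt_F t ht.1 _), ?_⟩⟩
    have h1 : S.toDualL (S.ι (P.F' t (-S.ι v))) = -S.a (P.F t (-S.ι v)) := P.equation t ht.1 _
    rw [map_add, map_add, h1, map_smul, map_smul, map_smul, ← hv', map_add, map_smul, smul_add,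
      smul_smul]
    abel
  · simp [P.E_zero]

lemma classicalControls_polynomial (P : S.Flow) (T : ℝ) {α₀ ω₀ : ℝ} (hα : 0 < α₀)
    (hG : ∀ v : V, α₀ * ‖v‖ ^ 2 ≤ S.a v v + ω₀ * ‖S.ι v‖ ^ 2) (p : Polynomial ℝ) (c : Lp ℝ 2 ρ) :
    (fun t => (Real.exp (ω₀ * t) * p.eval (Real.exp t)) • c) ∈ S.classicalControls T := by
  induction p using Polynomial.induction_on' with
  | add p q hp hq =>
    have := classicalControls_add hp hq
    convert this using 1
    ext1 t
    simp only [Polynomial.eval_add, Pi.add_apply, mul_add, add_smul]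
  | monomial n x =>
    have := classicalControls_exp P T (κ := ω₀ + n) hα (by linarith [n.cast_nonneg (α := ℝ)]) hG
      (x • c)
    convert this using 1
    ext1 t
    rw [Polynomial.eval_monomial, smul_smul, add_mul, Real.exp_add, Real.exp_nat_mul]
    congr 1
    ring

lemma exists_classicalControl_uniform [FiniteDimensional ℝ (Lp ℝ 2 ρ)] (P : S.Flow) (T : ℝ)
    {g : ℝ → Lp ℝ 2 ρ} (hg : Continuous g) {η : ℝ} (hη : 0 < η) :
    ∃ w ∈ S.classicalControls T, ∀ t ∈ Icc 0 T, ‖g t - w t‖ ≤ η := by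
  obtain ⟨α₀, ω₀, hα, hω, hG⟩ := S.garding
  let b := Module.finBasis ℝ (Lp ℝ 2 ρ)
  set C := ∑ i, ‖b i‖ with hC
  have hC0 : 0 ≤ C := Finset.sum_nonneg fun i _ => norm_nonneg _
  set η' := η / (Real.exp (ω₀ * T) * (C + 1)) with hη'
  have hη'0 : 0 < η' := by positivity
  have hcoord : ∀ i, Continuous (b.coord i) := fun i =>
    LinearMap.continuous_of_finiteDimensional _
  have hp : ∀ i, ∃ p : Polynomial ℝ, ∀ x ∈ Icc 1 (Real.exp T),
      |p.eval x - Real.exp (-(ω₀ * Real.log x)) * b.coord i (g (Real.log x))| < η' := by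
    intro i
    refine exists_polynomial_near_of_continuousOn 1 (Real.exp T)
      (fun x => Real.exp (-(ω₀ * Real.log x)) * b.coord i (g (Real.log x))) ?_ η' hη'0
    have hlog : ContinuousOn Real.log (Icc 1 (Real.exp T)) :=
      Real.continuousOn_log.mono fun x hx => by
        have := hx.1
        simp only [mem_compl_iff, mem_singleton_iff]
        linarith
    exact (Real.continuous_exp.comp_continuousOn (hlog.const_mul ω₀).neg).mul
      (((hcoord i).comp hg).comp_continuousOn hlog)
  choose p hp using hp
  refine ⟨∑ i, fun t => (Real.exp (ω₀ * t) * (p i).eval (Real.exp t)) • b i,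
    classicalControls_sum _ fun i => classicalControls_polynomial P T hα hG (p i) (b i),
    fun t ht => ?_⟩
  have h1 : g t - (∑ i, fun t => (Real.exp (ω₀ * t) * (p i).eval (Real.exp t)) • b i) t =
      ∑ i, (b.coord i (g t) - Real.exp (ω₀ * t) * (p i).eval (Real.exp t)) • b i := by
    simp only [sub_smul, Finset.sum_sub_distrib, Finset.sum_apply]
    congr 1
    exact (b.sum_repr (g t)).symm
  rw [h1]
  have h2 : ∀ i, ‖(b.coord i (g t) - Real.exp (ω₀ * t) * (p i).eval (Real.exp t)) • b i‖ ≤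
      Real.exp (ω₀ * T) * η' * ‖b i‖ := by
    intro i
    rw [norm_smul]
    gcongr
    have h3 := hp i (Real.exp t) ⟨Real.one_le_exp ht.1, Real.exp_le_exp.2 ht.2⟩
    rw [Real.log_exp] at h3
    have h4 : b.coord i (g t) - Real.exp (ω₀ * t) * (p i).eval (Real.exp t) =
        -(Real.exp (ω₀ * t) * ((p i).eval (Real.exp t) -
          Real.exp (-(ω₀ * t)) * b.coord i (g t))) := by
      rw [mul_sub, ← mul_assoc, ← Real.exp_add, add_neg_cancel, Real.exp_zero]
      ring
    rw [h4, norm_neg, norm_mul, Real.norm_of_nonneg (Real.exp_pos _).le, Real.norm_eq_abs]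
    gcongr
    exact ht.2
  refine (norm_sum_le _ _).trans ((Finset.sum_le_sum fun i _ => h2 i).trans ?_)
  rw [← Finset.mul_sum, ← hC, hη']
  have he := Real.exp_pos (ω₀ * T)
  have : Real.exp (ω₀ * T) * (η / (Real.exp (ω₀ * T) * (C + 1))) * C = η * (C / (C + 1)) := by
    field_simp
  rw [this]
  have : C / (C + 1) ≤ 1 := by rw [div_le_one (by positivity)]; linarith
  nlinarith

lemma exists_classicalControl_eLpNorm [FiniteDimensional ℝ (Lp ℝ 2 ρ)] (P : S.Flow) {T : ℝ}
    {u : ℝ → Lp ℝ 2 ρ} (hu : MemLp u 2 (timeMeasure T)) {ε : ENNReal} (hε : ε ≠ 0) :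
    ∃ w ∈ S.classicalControls T, eLpNorm (w - u) 2 (timeMeasure T) ≤ ε := by
  obtain ⟨g, hg, hgL⟩ := hu.exists_boundedContinuous_eLpNorm_sub_le (by norm_num)
    (ENNReal.half_pos hε).ne'
  set M : ENNReal := (timeMeasure T univ) ^ (2 : ENNReal).toReal⁻¹ with hM
  have hMtop : M ≠ ⊤ := ENNReal.rpow_ne_top_of_nonneg (by norm_num) (measure_ne_top _ _)
  obtain ⟨η, hη, hηε⟩ : ∃ η : ℝ, 0 < η ∧ M * ENNReal.ofReal η ≤ ε / 2 := by
    have h1 : Tendsto (fun η : ℝ => M * ENNReal.ofReal η) (𝓝[>] 0) (𝓝 (M * ENNReal.ofReal 0)) :=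
      ENNReal.Tendsto.const_mul
        ((ENNReal.continuous_ofReal.tendsto 0).mono_left nhdsWithin_le_nhds) (Or.inr hMtop)
    rw [ENNReal.ofReal_zero, mul_zero] at h1
    obtain ⟨η, h2, h3⟩ := ((h1.eventually_le_const (ENNReal.half_pos hε)).and
      self_mem_nhdsWithin).exists
    exact ⟨η, h3, h2⟩
  obtain ⟨w, hw, hwg⟩ := exists_classicalControl_uniform P T g.continuous hη
  refine ⟨w, hw, ?_⟩
  have hwc : AEStronglyMeasurable w (timeMeasure T) := by
    obtain ⟨_, _, h, -⟩ := hw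
    exact h.continuous_control.aestronglyMeasurable
  have h1 : eLpNorm (u - w) 2 (timeMeasure T) ≤ ε / 2 + ε / 2 := by
    have h2 : u - w = (u - g) + (⇑g - w) := by abel
    rw [h2]
    refine (eLpNorm_add_le (hu.1.sub hgL.1) (hgL.1.sub hwc) one_le_two).trans ?_
    gcongr
    refine (eLpNorm_le_of_ae_bound (C := η) ?_).trans hηε
    filter_upwards [ae_timeMeasure_mem T] with t ht
    exact hwg t (Ioo_subset_Icc_self ht)
  rwa [eLpNorm_sub_comm, ENNReal.add_halves] at h1

lemma IsClassical.memLp {T : ℝ} (hT : 0 < T) {u : ℝ → Lp ℝ 2 ρ} {y : ℝ → V} {Y : ℝ → H}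
    (h : S.IsClassical T u y Y) : MemLp y 2 (timeMeasure T) := by
  obtain ⟨K, -, hK⟩ := S.exists_energy_bound hT
  obtain ⟨y', hy'⟩ := h.exists_deriv
  exact (hK y y' Y (fun t => S.B (u t)) h.continuousOn h.eq_ι
    (fun t ht => (hy' t ht).1) (fun t ht => (hy' t ht).2)
    (S.B.continuous.comp h.continuous_control)).1

/-- Existence of weak solutions of the state equation. -/
theorem exists_state_one [FiniteDimensional ℝ (Lp ℝ 2 ρ)] (S : ControlSystem V H ω ρ) {T : ℝ}
    (hT : 0 < T) {u : ℝ → Lp ℝ 2 ρ} (hu : MemLp u 2 (timeMeasure T)) :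
    ∃ y : ℝ → V, S.IsState T 1 u y ∧ ∃ h, S.HasTrace T y T h := by
  obtain ⟨P⟩ := S.exists_flow
  have hε : ∀ n : ℕ, ENNReal.ofReal (1 / ((n : ℝ) + 1)) ≠ 0 := fun n => by
    simp only [ne_eq, ENNReal.ofReal_eq_zero, not_le]; positivity
  choose w hw hwu using fun n => exists_classicalControl_eLpNorm P hu (hε n)
  choose y₀ Y₀ hcl₀ hY₀ using hw
  have hhom : S.IsClassical T 0 (fun t => P.F t S.y0) (fun t => P.E t S.y0) := by
    refine ⟨continuous_zero, (P.continuousOn_E _).mono Icc_subset_Ici_self,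
      fun t ht => P.ι_F t ht.1 _, fun t => P.F' t S.y0, fun t ht =>
      ⟨P.hasDerivAt_F t ht.1 _, ?_⟩⟩
    rw [Pi.zero_apply, map_zero, zero_sub]
    exact P.equation t ht.1 _
  set y : ℕ → ℝ → V := fun n => y₀ n + fun t => P.F t S.y0 with hy
  set Y : ℕ → ℝ → H := fun n => Y₀ n + fun t => P.E t S.y0 with hY
  have hcl : ∀ n, S.IsClassical T (w n) (y n) (Y n) := fun n => by
    have := (hcl₀ n).add hhom
    rwa [add_zero] at this
  have hYn0 : ∀ n, Y n 0 = S.y0 := fun n => by simp [hY, hY₀ n, P.E_zero]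
  have hyL : ∀ n, MemLp (y n) 2 (timeMeasure T) := fun n => (hcl n).memLp hT
  have hwL : ∀ n, MemLp (w n) 2 (timeMeasure T) := fun n =>
    memLp_of_continuous (hcl n).continuous_control T
  have hwlim : Tendsto (fun n => eLpNorm (w n - u) 2 (timeMeasure T)) atTop (𝓝 0) := by
    have h1 : Tendsto (fun n : ℕ => ENNReal.ofReal (1 / ((n : ℝ) + 1))) atTop (𝓝 0) := by
      rw [← ENNReal.ofReal_zero]
      exact (ENNReal.continuous_ofReal.tendsto 0).comp tendsto_one_div_add_atTop_nhds_zero_nat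
    exact tendsto_of_tendsto_of_tendsto_of_le_of_le tendsto_const_nhds h1 (fun _ => bot_le) hwu
  have hwcau : CauchySeq fun n => (hwL n).toLp (w n) :=
    ((Lp.tendsto_Lp_iff_tendsto_eLpNorm'' w hwL u hu).2 hwlim).cauchySeq
  obtain ⟨K, hK0, hK⟩ := IsClassical.exists_bound S hT
  have hdiff : ∀ n m, dist ((hyL n).toLp (y n)) ((hyL m).toLp (y m)) ≤
        K * dist ((hwL n).toLp (w n)) ((hwL m).toLp (w m)) ∧
      ∀ t ∈ Icc 0 T, dist (Y n t) (Y m t) ≤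
        K * dist ((hwL n).toLp (w n)) ((hwL m).toLp (w m)) := by
    intro n m
    obtain ⟨h1, h2, h3⟩ := hK _ _ _ ((hcl n).sub (hcl m))
      (by rw [Pi.sub_apply, hYn0, hYn0, sub_self]) ((hwL n).sub (hwL m))
    rw [dist_eq_norm, dist_eq_norm, ← MemLp.toLp_sub, ← MemLp.toLp_sub]
    exact ⟨h2, fun t ht => by rw [dist_eq_norm]; exact h3 t ht⟩
  have hsmall : ∀ ε > 0, ∃ N, ∀ m ≥ N, ∀ n ≥ N,
      K * dist ((hwL m).toLp (w m)) ((hwL n).toLp (w n)) < ε := by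
    intro ε hε
    obtain ⟨N, hN⟩ := Metric.cauchySeq_iff.1 hwcau (ε / (K + 1)) (by positivity)
    refine ⟨N, fun m hm n hn => ?_⟩
    have h1 := hN m hm n hn
    rw [lt_div_iff₀ (by positivity)] at h1
    have h2 := dist_nonneg (x := (hwL m).toLp (w m)) (y := (hwL n).toLp (w n))
    linarith
  have hycau : CauchySeq fun n => (hyL n).toLp (y n) := by
    rw [Metric.cauchySeq_iff]
    intro ε hε
    obtain ⟨N, hN⟩ := hsmall ε hε
    exact ⟨N, fun m hm n hn => ((hdiff m n).1).trans_lt (hN m hm n hn)⟩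
  have hYcau : UniformCauchySeqOn Y atTop (Icc 0 T) := by
    rw [Metric.uniformCauchySeqOn_iff]
    intro ε hε
    obtain ⟨N, hN⟩ := hsmall ε hε
    exact ⟨N, fun m hm n hn t ht => ((hdiff m n).2 t ht).trans_lt (hN m hm n hn)⟩
  obtain ⟨yL, hyL'⟩ := cauchySeq_tendsto_of_complete hycau
  set y' : ℝ → V := ⇑yL with hy'
  have hy'L : MemLp y' 2 (timeMeasure T) := Lp.memLp yL
  have hylim : Tendsto (fun n => eLpNorm (y n - y') 2 (timeMeasure T)) atTop (𝓝 0) := by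
    refine (Lp.tendsto_Lp_iff_tendsto_eLpNorm'' y hyL y' hy'L).1 ?_
    have h1 : hy'L.toLp y' = yL := Lp.toLp_coeFn yL hy'L
    rwa [h1]
  have hYt : ∀ t ∈ Icc 0 T, ∃ h, Tendsto (fun n => Y n t) atTop (𝓝 h) := fun t ht =>
    cauchySeq_tendsto_of_complete (hYcau.cauchySeq ht)
  choose! Y' hY' using hYt
  have hYu : TendstoUniformlyOn Y Y' atTop (Icc 0 T) := hYcau.tendstoUniformlyOn_of_tendsto hY'
  have hY'c : ContinuousOn Y' (Icc 0 T) :=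
    hYu.continuousOn (Frequently.of_forall fun n => (hcl n).continuousOn)
  have hY'y : ∀ᵐ s ∂(timeMeasure T), Y' s = S.ι (y' s) := by
    obtain ⟨ns, hns, hae⟩ := (tendstoInMeasure_of_tendsto_eLpNorm (by norm_num)
      (fun n => (hyL n).1) hy'L.1 hylim).exists_seq_tendsto_ae
    filter_upwards [hae, ae_timeMeasure_mem T] with t h1 h2
    have h3 := (S.ι.continuous.tendsto _).comp h1
    refine tendsto_nhds_unique ((hY' t (Ioo_subset_Icc_self h2)).comp hns.tendsto_atTop)
      (h3.congr fun k => ?_)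
    exact (hcl (ns k)).eq_ι t h2
  have hgL : MemLp (fun t => S.B (u t) - S.a (y' t)) 2 (timeMeasure T) :=
    (S.B.comp_memLp' hu).sub (S.a.comp_memLp' hy'L)
  refine ⟨y', ⟨⟨fun t => S.B (u t) - S.a (y' t), ⟨hy'L, hgL, ?_⟩, Eventually.of_forall fun t => by
    simp⟩, Y', hY'c, hY'y, ?_⟩, Y' T, Y', hY'c, hY'y, rfl⟩
  · intro φ hφ hφc hφs
    have hdc : Continuous (deriv φ) := hφ.continuous_deriv (by exact_mod_cast le_top)
    have t1 := tendsto_integral_smul_of_eLpNorm hdc (S.toDualL.comp S.ι) hyL hy'L hylim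
    have t2 := tendsto_integral_smul_of_eLpNorm hφ.continuous S.B hwL hu hwlim
    have t3 := tendsto_integral_smul_of_eLpNorm hφ.continuous S.a hyL hy'L hylim
    obtain ⟨C, -, hC⟩ := exists_ae_bound_of_continuous hφ.continuous T
    have hsplit : ∀ (u : ℝ → Lp ℝ 2 ρ) (y : ℝ → V), MemLp u 2 (timeMeasure T) →
        MemLp y 2 (timeMeasure T) →
        ∫ t, φ t • (S.B (u t) - S.a (y t)) ∂(timeMeasure T) =
          ∫ t, φ t • S.B (u t) ∂(timeMeasure T) - ∫ t, φ t • S.a (y t) ∂(timeMeasure T) := by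
      intro u y hu hy
      simp only [smul_sub]
      exact integral_sub ((S.B.integrable_comp (hu.integrable one_le_two)).bdd_smul C
          hφ.continuous.aestronglyMeasurable hC)
        ((S.a.integrable_comp (hy.integrable one_le_two)).bdd_smul C
          hφ.continuous.aestronglyMeasurable hC)
    rw [hsplit u y' hu hy'L]
    refine tendsto_nhds_unique t1 ((t2.sub t3).neg.congr fun n => ?_)
    rw [← hsplit (w n) (y n) (hwL n) (hyL n)]
    obtain ⟨yd, hyd⟩ := (hcl n).exists_deriv
    exact (hasWeakDeriv_of_hasDerivAt hT (hyL n)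
      ((S.B.comp_memLp' (hwL n)).sub (S.a.comp_memLp' (hyL n))) (fun t ht => (hyd t ht).1)
      (fun t ht => ((hyd t ht).2).symm) φ hφ hφc hφs).symm
  · have h0 : (0 : ℝ) ∈ Icc 0 T := ⟨le_rfl, hT.le⟩
    exact tendsto_nhds_unique (hY' 0 h0) (by simp only [hYn0]; exact tendsto_const_nhds)

/-- The control system with time scaled by `ν`. -/
noncomputable def scale (S : ControlSystem V H ω ρ) {ν : ℝ} (hν : 0 < ν) :
    ControlSystem V H ω ρ :=
  { S with
    a := ν • S.a
    B := ν • S.B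
    garding := by
      obtain ⟨α₀, ω₀, hα, hω, hG⟩ := S.garding
      refine ⟨ν * α₀, ν * ω₀, by positivity, by positivity, fun v => ?_⟩
      have := mul_le_mul_of_nonneg_left (hG v) hν.le
      simp only [smul_apply, smul_eq_mul]
      linarith }

theorem exists_reaches [FiniteDimensional ℝ (Lp ℝ 2 ρ)] (S : ControlSystem V H ω ρ) {T ν : ℝ}
    (hT : 0 < T) (hν : 0 < ν) {u : ℝ → Lp ℝ 2 ρ} (hu : MemLp u 2 (timeMeasure T)) :
    ∃ h, S.Reaches T ν u h := by
  obtain ⟨y, ⟨⟨g, hW, hg⟩, h0⟩, h, hh⟩ := (S.scale hν).exists_state_one hT hu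
  refine ⟨h, y, ⟨⟨g, ⟨hW.1, hW.2, hW.3⟩, ?_⟩, h0⟩, hh⟩
  filter_upwards [hg] with t ht
  rwa [one_smul, one_smul] at ht

end ControlSystem

/-- A decreasing sequence of closed convex bounded nonempty sets in a Hilbert space has a common
point. -/
lemma exists_mem_iInter_of_convex {X : Type*} [NormedAddCommGroup X] [InnerProductSpace ℝ X]
    [CompleteSpace X] {A : ℕ → Set X} (hA : Antitone A) (hne : ∀ n, (A n).Nonempty)
    (hcl : ∀ n, IsClosed (A n)) (hcv : ∀ n, Convex ℝ (A n)) {C : ℝ}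
    (hC : ∀ x ∈ A 0, ‖x‖ ≤ C) : ∃ x, ∀ n, x ∈ A n := by
  have h1 : ∀ n, ∃ v ∈ A n, ∀ w ∈ A n, ‖v‖ ^ 2 ≤ inner ℝ v w := by
    intro n
    obtain ⟨v, hv, hv'⟩ := exists_norm_eq_iInf_of_complete_convex (hne n) (hcl n).isComplete
      (hcv n) 0
    rw [norm_eq_iInf_iff_real_inner_le_zero (hcv n) hv] at hv'
    refine ⟨v, hv, fun w hw => ?_⟩
    have := hv' w hw
    rw [zero_sub, inner_neg_left, inner_sub_right, real_inner_self_eq_norm_sq] at this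
    linarith
  choose v hv hvw using h1
  have hsq : ∀ n m, n ≤ m → ‖v m - v n‖ ^ 2 ≤ ‖v m‖ ^ 2 - ‖v n‖ ^ 2 := by
    intro n m hnm
    have := hvw n (v m) (hA hnm (hv m))
    rw [norm_sub_sq_real, real_inner_comm]
    linarith
  have hmono : Monotone fun n => ‖v n‖ ^ 2 := fun n m hnm => by
    have := hsq n m hnm
    have := sq_nonneg ‖v m - v n‖
    simp only
    linarith
  have hbdd : BddAbove (range fun n => ‖v n‖ ^ 2) := by
    refine ⟨C ^ 2, ?_⟩
    rintro _ ⟨n, rfl⟩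
    simp only
    gcongr
    exact hC _ (hA (Nat.zero_le n) (hv n))
  have hcs := (tendsto_atTop_ciSup hmono hbdd).cauchySeq
  have hcau : CauchySeq v := by
    rw [Metric.cauchySeq_iff'] at hcs ⊢
    intro ε hε
    obtain ⟨N, hN⟩ := hcs (ε ^ 2) (by positivity)
    refine ⟨N, fun n hn => ?_⟩
    have h1 := hN n hn
    rw [Real.dist_eq] at h1
    have h2 := hsq N n hn
    rw [dist_eq_norm]
    exact lt_of_pow_lt_pow_left₀ 2 hε.le (h2.trans_lt ((le_abs_self _).trans_lt h1))
  obtain ⟨x, hx⟩ := cauchySeq_tendsto_of_complete hcau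
  refine ⟨x, fun n => (hcl n).mem_of_tendsto hx ?_⟩
  filter_upwards [eventually_ge_atTop n] with m hm
  exact hA hm (hv m)

namespace ControlSystem

variable {V H ω : Type*}
  [NormedAddCommGroup V] [InnerProductSpace ℝ V] [CompleteSpace V]
  [NormedAddCommGroup H] [InnerProductSpace ℝ H] [CompleteSpace H]
  [MeasurableSpace ω] {ρ : Measure ω}

/-- The set of admissible control values is closed, convex and bounded, and there is a measurable
selection of minimizers of `c ↦ ⟨B c, v⟩` over it. -/
structure Selector (S : ControlSystem V H ω ρ) where
  /-- the minimizer as a function of `v` -/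
  sel : V → Lp ℝ 2 ρ
  /-- a norm bound for admissible values -/
  radius : ℝ
  sel_mem : ∀ v, sel v ∈ S.Uad
  le : ∀ v, ∀ c ∈ S.Uad, S.B (sel v) v ≤ S.B c v
  norm_le : ∀ c ∈ S.Uad, ‖c‖ ≤ radius
  aestronglyMeasurable : ∀ (μ : Measure ℝ) (p : ℝ → V), AEStronglyMeasurable p μ →
    AEStronglyMeasurable (fun t => sel (p t)) μ
  convex : Convex ℝ S.Uad
  isClosed : IsClosed S.Uad

/-- `L²` of a finite set with the counting measure. -/
noncomputable def funEquivLp (N : ℕ) :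
    (Fin N → ℝ) ≃ₗ[ℝ] Lp ℝ 2 (Measure.count : Measure (Fin N)) where
  toFun c := (MemLp.of_discrete (f := c)).toLp c
  map_add' _ _ := rfl
  map_smul' _ _ := rfl
  invFun f := f
  left_inv c := by
    have h := MemLp.coeFn_toLp (MemLp.of_discrete (f := c) (p := 2)
      (μ := (Measure.count : Measure (Fin N))))
    funext i
    exact (Measure.ae_count_iff.1 h) i
  right_inv f := Lp.toLp_coeFn f _

instance (N : ℕ) : FiniteDimensional ℝ (Lp ℝ 2 (Measure.count : Measure (Fin N))) :=
  (funEquivLp N).finiteDimensional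

lemma Uad_eq_image {N : ℕ} (S : ControlSystem V H (Fin N) Measure.count) :
    S.Uad = funEquivLp N '' Icc S.ua S.ub := by
  ext c
  rw [LinearEquiv.image_eq_preimage_symm]
  simp only [Uad, Measure.ae_count_iff, mem_preimage, mem_Icc, Pi.le_def, ← forall_and]
  rfl

theorem exists_selector {N : ℕ} (S : ControlSystem V H (Fin N) Measure.count) :
    Nonempty S.Selector := by
  have hlt : ∀ i, S.ua i < S.ub i := Measure.ae_count_iff.1 S.ua_lt_ub
  have hcont : Continuous (funEquivLp N) :=
    LinearMap.continuous_of_finiteDimensional (funEquivLp N).toLinearMap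
  have hcomp : IsCompact S.Uad := by
    rw [Uad_eq_image]
    exact isCompact_Icc.image hcont
  obtain ⟨r, hr⟩ := hcomp.isBounded.exists_norm_le
  set e : Fin N → Lp ℝ 2 (Measure.count : Measure (Fin N)) :=
    fun i => funEquivLp N fun j => if i = j then 1 else 0 with he
  have hB : ∀ (c : Fin N → ℝ) (v : V), S.B (funEquivLp N c) v = ∑ i, c i * S.B (e i) v := by
    intro c v
    have := LinearMap.pi_apply_eq_sum_univ (funEquivLp N).toLinearMap c
    rw [LinearEquiv.coe_coe] at this
    rw [this, map_sum, sum_apply]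
    refine Finset.sum_congr rfl fun i _ => ?_
    rw [map_smul, smul_apply, smul_eq_mul]
  set s : V → Fin N → ℝ := fun v i => if 0 ≤ S.B (e i) v then S.ua i else S.ub i with hs
  refine ⟨⟨fun v => funEquivLp N (s v), r, fun v => ?_, fun v c hc => ?_, hr, ?_, ?_,
    hcomp.isClosed⟩⟩
  · rw [Uad_eq_image]
    refine mem_image_of_mem _ ⟨fun i => ?_, fun i => ?_⟩ <;> simp only [hs] <;> split_ifs
    · exact le_rfl
    · exact (hlt i).le
    · exact (hlt i).le
    · exact le_rfl
  · rw [Uad_eq_image] at hc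
    obtain ⟨c, hc, rfl⟩ := hc
    rw [hB, hB]
    refine Finset.sum_le_sum fun i _ => ?_
    simp only [hs]
    split_ifs with h
    · exact mul_le_mul_of_nonneg_right (hc.1 i) h
    · exact mul_le_mul_of_nonpos_right (hc.2 i) (not_le.1 h).le
  · intro μ p hp
    refine hcont.comp_aestronglyMeasurable (AEMeasurable.aestronglyMeasurable ?_)
    refine aemeasurable_pi_lambda _ fun i => ?_
    have h1 : AEMeasurable (fun t => S.B (e i) (p t)) μ :=
      ((S.B (e i)).continuous.comp_aestronglyMeasurable hp).aemeasurable
    exact (Measurable.ite measurableSet_Ici measurable_const measurable_const :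
      Measurable fun x : ℝ => if 0 ≤ x then S.ua i else S.ub i).comp_aemeasurable h1
  · rw [Uad_eq_image]
    exact (convex_Icc _ _).linear_image (funEquivLp N).toLinearMap

end ControlSystem

/-- The set of `L²` functions with values in a closed set is closed. -/
lemma isClosed_ae_mem {E : Type*} [NormedAddCommGroup E] {μ : Measure ℝ} {K : Set E}
    (hK : IsClosed K) : IsClosed {U : Lp E 2 μ | ∀ᵐ t ∂μ, U t ∈ K} := by
  refine IsSeqClosed.isClosed fun U W hU hW => ?_
  have h1 := tendstoInMeasure_of_tendsto_Lp hW
  obtain ⟨ns, -, hns⟩ := h1.exists_seq_tendsto_ae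
  have h2 : ∀ᵐ t ∂μ, ∀ n, U n t ∈ K := ae_all_iff.2 hU
  filter_upwards [hns, h2] with t ht1 ht2
  exact hK.mem_of_tendsto ht1 (Eventually.of_forall fun n => ht2 _)

namespace ControlSystem

variable {V H ω : Type*}
  [NormedAddCommGroup V] [InnerProductSpace ℝ V] [CompleteSpace V]
  [NormedAddCommGroup H] [InnerProductSpace ℝ H] [CompleteSpace H]
  [MeasurableSpace ω] {ρ : Measure ω} {S : ControlSystem V H ω ρ}

lemma mem_UadTime_comp_reversal {ν T : ℝ} (hν : 0 < ν) {u : ℝ → Lp ℝ 2 ρ}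
    (hu : u ∈ S.UadTime (ν * T)) : (fun t => u (ν * (T - t))) ∈ S.UadTime T :=
  ⟨memLp_comp_reversal hν hu.1, ae_comp_reversal (p := fun t => u t ∈ S.Uad) hν hu.2⟩

lemma Selector.mem_UadTime (K : S.Selector) {T : ℝ} {u : ℝ → Lp ℝ 2 ρ}
    (hm : AEStronglyMeasurable u (timeMeasure T)) (hu : ∀ᵐ t ∂timeMeasure T, u t ∈ S.Uad) :
    u ∈ S.UadTime T := by
  refine ⟨MemLp.of_bound hm K.radius ?_, hu⟩
  filter_upwards [hu] with t ht using K.norm_le _ ht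

/-- The values at time `τ` of the states with admissible controls. -/
def reachable (Q : S.dual.Flow) (τ : ℝ) : Set H :=
  {h | ∃ w ∈ S.UadTime τ, ∀ q, inner ℝ h q = pairing Q τ w q}

section Reachable

variable [FiniteDimensional ℝ (Lp ℝ 2 ρ)] (Q : S.dual.Flow)

lemma exists_inner_eq_pairing {τ : ℝ} (hτ : 0 < τ) {w : ℝ → Lp ℝ 2 ρ}
    (hw : MemLp w 2 (timeMeasure τ)) : ∃ h, ∀ q, inner ℝ h q = pairing Q τ w q := by
  have h1 : MemLp (fun t => w (1 * (τ - t))) 2 (timeMeasure τ) :=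
    memLp_comp_reversal one_pos (by rwa [one_mul])
  obtain ⟨h, hh⟩ := S.exists_reaches hτ one_pos h1
  refine ⟨h, fun q => ?_⟩
  rw [hh.inner_eq Q hτ one_pos h1 q]
  simp

theorem mem_reachable_iff {ν T : ℝ} (hν : 0 < ν) (hT : 0 < T) {h : H} :
    h ∈ reachable Q (ν * T) ↔ ∃ u ∈ S.UadTime T, S.Reaches T ν u h := by
  constructor
  · rintro ⟨w, hw, hh⟩
    have hu := mem_UadTime_comp_reversal hν hw
    obtain ⟨h', hh'⟩ := S.exists_reaches hT hν hu.1
    refine ⟨_, hu, ?_⟩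
    have : h = h' := by
      refine ext_inner_right ℝ fun q => ?_
      rw [hh, hh'.inner_eq Q hT hν hu.1 q]
      congr 1
      funext s
      congr 1
      field_simp
      ring
    rwa [this]
  · rintro ⟨u, hu, hh⟩
    refine ⟨_, ?_, hh.inner_eq Q hT hν hu.1⟩
    refine mem_UadTime_comp_reversal (inv_pos.2 hν) ?_
    rwa [inv_mul_cancel_left₀ hν.ne']

lemma pairing_add_smul {τ : ℝ} (hτ : 0 < τ) {w₁ w₂ : ℝ → Lp ℝ 2 ρ}
    (h₁ : MemLp w₁ 2 (timeMeasure τ)) (h₂ : MemLp w₂ 2 (timeMeasure τ)) {a b : ℝ}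
    (hab : a + b = 1) (q : H) :
    pairing Q τ (fun s => a • w₁ s + b • w₂ s) q =
      a * pairing Q τ w₁ q + b * pairing Q τ w₂ q := by
  have hF := Q.memLp_F hτ q
  simp only [pairing, map_add, map_smul, add_apply, smul_apply, smul_eq_mul]
  rw [integral_add ((integrable_B h₁ hF).const_mul a) ((integrable_B h₂ hF).const_mul b),
    integral_const_mul, integral_const_mul]
  linear_combination (- inner ℝ S.y0 (Q.E τ q)) * hab

lemma convex_reachable (K : S.Selector) {τ : ℝ} (hτ : 0 < τ) : Convex ℝ (reachable Q τ) := by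
  rintro h₁ ⟨w₁, hw₁, hh₁⟩ h₂ ⟨w₂, hw₂, hh₂⟩ a b ha hb hab
  refine ⟨fun s => a • w₁ s + b • w₂ s,
    ⟨(hw₁.1.const_smul a).add (hw₂.1.const_smul b), ?_⟩, fun q => ?_⟩
  · filter_upwards [hw₁.2, hw₂.2] with s h1 h2 using K.convex h1 h2 ha hb hab
  · rw [pairing_add_smul Q hτ hw₁.1 hw₂.1 hab, inner_add_left, real_inner_smul_left,
      real_inner_smul_left, hh₁, hh₂]

lemma nonempty_reachable (K : S.Selector) {τ : ℝ} (hτ : 0 < τ) : (reachable Q τ).Nonempty := by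
  have hw : (fun _ : ℝ => K.sel 0) ∈ S.UadTime τ :=
    K.mem_UadTime aestronglyMeasurable_const (Eventually.of_forall fun _ => K.sel_mem 0)
  obtain ⟨h, hh⟩ := exists_inner_eq_pairing Q hτ hw.1
  exact ⟨h, _, hw, hh⟩

lemma pairing_congr {τ : ℝ} {w₁ w₂ : ℝ → Lp ℝ 2 ρ} (h : w₁ =ᵐ[timeMeasure τ] w₂) (q : H) :
    pairing Q τ w₁ q = pairing Q τ w₂ q := by
  unfold pairing
  congr 1
  refine integral_congr_ae ?_
  filter_upwards [h] with s hs
  rw [hs]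

lemma continuous_pairing {τ : ℝ} (hτ : 0 < τ) (q : H) :
    Continuous fun U : Lp (Lp ℝ 2 ρ) 2 (timeMeasure τ) => pairing Q τ U q := by
  set J := InnerProductSpace.toDual ℝ (Lp ℝ 2 ρ)
  have hφ : MemLp (fun s => J.symm (S.B.flip (Q.F s q))) 2 (timeMeasure τ) :=
    ((Q.memLp_F hτ q).continuousLinearMap_comp S.B.flip).of_le
      (J.symm.continuous.comp_aestronglyMeasurable
        (S.B.flip.continuous.comp_aestronglyMeasurable (Q.memLp_F hτ q).1))
      (Eventually.of_forall fun s => (J.symm.norm_map _).le)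
  have h : (fun U : Lp (Lp ℝ 2 ρ) 2 (timeMeasure τ) => pairing Q τ U q) =
      fun U => inner ℝ S.y0 (Q.E τ q) + inner ℝ (hφ.toLp _) U := by
    funext U
    rw [pairing, L2.inner_def]
    congr 1
    refine integral_congr_ae ?_
    filter_upwards [hφ.coeFn_toLp] with s hs
    rw [hs, InnerProductSpace.toDual_symm_apply]
    rfl
  rw [h]
  fun_prop

/-- The distance of `yd` to the reachable set is attained. -/
theorem exists_forall_norm_sub_le (K : S.Selector) {τ : ℝ} (hτ : 0 < τ) :
    ∃ x ∈ reachable Q τ, ∀ h ∈ reachable Q τ, ‖x - S.yd‖ ≤ ‖h - S.yd‖ := by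
  set I : ℝ := sInf ((fun h => ‖h - S.yd‖) '' reachable Q τ) with hI
  have hne : ((fun h => ‖h - S.yd‖) '' reachable Q τ).Nonempty :=
    (nonempty_reachable Q K hτ).image _
  have hbdd : BddBelow ((fun h => ‖h - S.yd‖) '' reachable Q τ) :=
    ⟨0, by rintro _ ⟨h, -, rfl⟩; exact norm_nonneg _⟩
  set A : ℕ → Set (Lp (Lp ℝ 2 ρ) 2 (timeMeasure τ)) := fun n =>
    {U | ∀ᵐ t ∂timeMeasure τ, U t ∈ S.Uad} ∩
      ⋂ q : H, {U | pairing Q τ U q ≤ inner ℝ S.yd q + (I + 1 / ((n : ℝ) + 1)) * ‖q‖} with hA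
  have hmem : ∀ U : Lp (Lp ℝ 2 ρ) 2 (timeMeasure τ), (∀ᵐ t ∂timeMeasure τ, U t ∈ S.Uad) →
      (U : ℝ → Lp ℝ 2 ρ) ∈ S.UadTime τ := fun U hU => ⟨Lp.memLp U, hU⟩
  obtain ⟨U, hU⟩ : ∃ U, ∀ n, U ∈ A n := by
    refine exists_mem_iInter_of_convex (C := (timeMeasure τ).real univ ^ (2 : ENNReal).toReal⁻¹
      * K.radius) ?_ ?_ ?_ ?_ ?_
    · intro n m hnm U hU
      refine ⟨hU.1, mem_iInter.2 fun q => ?_⟩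
      have h1 := mem_iInter.1 hU.2 q
      rw [mem_ofPred_eq] at h1 ⊢
      refine h1.trans ?_
      gcongr
    · intro n
      obtain ⟨_, ⟨h, ⟨w, hw, hh⟩, rfl⟩, hlt⟩ := exists_lt_of_csInf_lt hne
        (lt_add_of_pos_right I (Nat.one_div_pos_of_nat (n := n)))
      refine ⟨hw.1.toLp w, ?_, mem_iInter.2 fun q => ?_⟩
      · filter_upwards [hw.1.coeFn_toLp, hw.2] with t h1 h2
        rwa [h1]
      · rw [mem_ofPred_eq, pairing_congr Q hw.1.coeFn_toLp, ← hh, ← sub_le_iff_le_add',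
          ← inner_sub_left]
        refine (real_inner_le_norm _ _).trans ?_
        gcongr
    · intro n
      refine (isClosed_ae_mem K.isClosed).inter (isClosed_iInter fun q => ?_)
      exact isClosed_le (continuous_pairing Q hτ q) continuous_const
    · rintro n U hU W hW a b ha hb hab
      have hadd : ∀ᵐ t ∂timeMeasure τ, (a • U + b • W) t = a • U t + b • W t := by
        filter_upwards [Lp.coeFn_add (a • U) (b • W), Lp.coeFn_smul a U, Lp.coeFn_smul b W]
          with t h1 h2 h3
        rw [h1, Pi.add_apply, h2, h3, Pi.smul_apply, Pi.smul_apply]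
      refine ⟨?_, mem_iInter.2 fun q => ?_⟩
      · rw [mem_ofPred_eq]
        filter_upwards [hadd, hU.1, hW.1] with t h1 h2 h3
        rw [h1]
        exact K.convex h2 h3 ha hb hab
      · rw [mem_ofPred_eq, pairing_congr Q hadd,
          pairing_add_smul Q hτ (Lp.memLp U) (Lp.memLp W) hab]
        have h1 := mul_le_mul_of_nonneg_left (mem_iInter.1 hU.2 q) ha
        have h2 := mul_le_mul_of_nonneg_left (mem_iInter.1 hW.2 q) hb
        refine (add_le_add h1 h2).trans (le_of_eq ?_)
        linear_combination (inner ℝ S.yd q + (I + 1 / ((n : ℝ) + 1)) * ‖q‖) * hab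
    · intro U hU
      have hr : 0 ≤ K.radius := (norm_nonneg _).trans (K.norm_le _ (K.sel_mem 0))
      refine Lp.norm_le_of_ae_bound hr ?_
      filter_upwards [hU.1] with t ht using K.norm_le _ ht
  have hUU := hmem U (hU 0).1
  obtain ⟨x, hx⟩ := exists_inner_eq_pairing Q hτ hUU.1
  refine ⟨x, ⟨_, hUU, hx⟩, fun h hh => ?_⟩
  have hle : I ≤ ‖h - S.yd‖ := csInf_le hbdd ⟨h, hh, rfl⟩
  refine le_trans ?_ hle
  refine le_of_forall_pos_le_add fun ε hε => ?_
  obtain ⟨n, hn⟩ := exists_nat_one_div_lt hε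
  have h1 := mem_iInter.1 (hU n).2 (x - S.yd)
  rw [mem_ofPred_eq, ← hx, ← sub_le_iff_le_add', ← inner_sub_left,
    real_inner_self_eq_norm_mul_norm] at h1
  rcases (norm_nonneg (x - S.yd)).eq_or_lt with h0 | h0
  · rw [← h0]
    have : 0 ≤ I := le_csInf hne (by rintro _ ⟨h, -, rfl⟩; exact norm_nonneg _)
    linarith
  · have := le_of_mul_le_mul_right h1 h0
    linarith

end Reachable

end ControlSystem

/-- The variational inequality for nearest points in convex sets, in quadratic form. -/
lemma norm_sub_sq_le_of_nearest {X : Type*} [NormedAddCommGroup X] [InnerProductSpace ℝ X]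
    {C : Set X} (hC : Convex ℝ C) {x z : X} (hx : x ∈ C) (hmin : ∀ h ∈ C, ‖x - z‖ ≤ ‖h - z‖)
    {h : X} (hh : h ∈ C) :
    0 ≤ inner ℝ (x - z) (h - x) ∧ ‖h - x‖ ^ 2 ≤ ‖h - z‖ ^ 2 - ‖x - z‖ ^ 2 := by
  have h1 : ‖z - x‖ = ⨅ w : C, ‖z - w‖ := by
    have : Nonempty C := ⟨⟨x, hx⟩⟩
    refine le_antisymm (le_ciInf fun w => ?_)
      (ciInf_le ⟨0, by rintro _ ⟨w, rfl⟩; exact norm_nonneg _⟩ (⟨x, hx⟩ : C))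
    rw [norm_sub_rev z x, norm_sub_rev z w]
    exact hmin w w.2
  have h2 := (norm_eq_iInf_iff_real_inner_le_zero hC hx).1 h1 h hh
  rw [← neg_sub, inner_neg_left] at h2
  have h3 : h - z = (h - x) + (x - z) := by abel
  refine ⟨by linarith, ?_⟩
  rw [h3, norm_add_sq_real, real_inner_comm]
  linarith

namespace ControlSystem

variable {V H ω : Type*}
  [NormedAddCommGroup V] [InnerProductSpace ℝ V] [CompleteSpace V]
  [NormedAddCommGroup H] [InnerProductSpace ℝ H] [CompleteSpace H]
  [MeasurableSpace ω] {ρ : Measure ω} {S : ControlSystem V H ω ρ}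

/-- `x` is a reachable value at time `τ` of minimal distance to `yd`. -/
def IsNearest (Q : S.dual.Flow) (τ : ℝ) (x : H) : Prop :=
  x ∈ reachable Q τ ∧ ∀ h ∈ reachable Q τ, ‖x - S.yd‖ ≤ ‖h - S.yd‖

lemma Selector.exists_extension (K : S.Selector) {τ : ℝ} {w : ℝ → Lp ℝ 2 ρ}
    (hw : w ∈ S.UadTime τ) : ∃ w' : ℝ → Lp ℝ 2 ρ, (∀ T, w' ∈ S.UadTime T) ∧
      w' =ᵐ[timeMeasure τ] w := by
  classical
  set w' : ℝ → Lp ℝ 2 ρ := (Ioo 0 τ).piecewise w fun _ => K.sel 0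
  have hm : AEStronglyMeasurable w' volume :=
    AEStronglyMeasurable.piecewise measurableSet_Ioo hw.1.1 aestronglyMeasurable_const
  have hmem : ∀ᵐ t, w' t ∈ S.Uad := by
    filter_upwards [(ae_restrict_iff' measurableSet_Ioo).1 hw.2] with t ht
    by_cases h : t ∈ Ioo 0 τ
    · rw [show w' t = w t from piecewise_eq_of_mem _ _ _ h]
      exact ht h
    · rw [show w' t = K.sel 0 from piecewise_eq_of_notMem _ _ _ h]
      exact K.sel_mem 0
  refine ⟨w', fun T => K.mem_UadTime hm.restrict (ae_restrict_of_ae hmem), ?_⟩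
  filter_upwards [ae_timeMeasure_mem τ] with t ht using piecewise_eq_of_mem _ _ _ ht

lemma Selector.radius_nonneg (K : S.Selector) : 0 ≤ K.radius :=
  (norm_nonneg _).trans (K.norm_le _ (K.sel_mem 0))

section Nearest

variable [FiniteDimensional ℝ (Lp ℝ 2 ρ)] (Q : S.dual.Flow)

/-- Reachable values depend on time with a Lipschitz bound up to the flow of the initial value. -/
lemma exists_reachable_near (P : S.Flow) (K : S.Selector) {a b : ℝ} (ha : 0 < a) : ∃ C, ∀ τ ∈ Icc a b, ∀ τ' ∈ Icc a b,
    ∀ h ∈ reachable Q τ, ∃ h' ∈ reachable Q τ',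
      ‖h - h'‖ ≤ ‖P.E τ S.y0 - P.E τ' S.y0‖ + C * |τ - τ'| := by
  obtain ⟨C, hC0, hC⟩ := Q.exists_norm_F_le ha b
  refine ⟨‖S.B‖ * K.radius * C, fun τ hτ τ' hτ' h ⟨w, hw, hh⟩ => ?_⟩
  have h0 : 0 < τ := ha.trans_le hτ.1
  have h0' : 0 < τ' := ha.trans_le hτ'.1
  obtain ⟨w', hw', hww⟩ := K.exists_extension hw
  obtain ⟨h', hh'⟩ := exists_inner_eq_pairing Q h0' (hw' τ').1
  refine ⟨h', ⟨w', hw' τ', hh'⟩, ?_⟩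
  have key : ∀ q, inner ℝ (h - h') q ≤
      (‖P.E τ S.y0 - P.E τ' S.y0‖ + ‖S.B‖ * K.radius * C * |τ - τ'|) * ‖q‖ := by
    intro q
    have hi : ∀ T, 0 < T → IntervalIntegrable (fun s => S.B (w' s) (Q.F s q)) volume 0 T :=
      fun T hT => (integrable_timeMeasure_iff hT.le _).1
        (integrable_B (hw' T).1 (Q.memLp_F hT q))
    have hb : |∫ s in τ'..τ, S.B (w' s) (Q.F s q)| ≤ ‖S.B‖ * K.radius * C * ‖q‖ * |τ - τ'| := by
      rw [← Real.norm_eq_abs]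
      refine intervalIntegral.norm_integral_le_of_norm_le_const_ae ?_
      have hae := (ae_restrict_iff' measurableSet_Ioo).1 (hw' (b + 1)).2
      filter_upwards [hae] with s hs hsm
      have hs1 : s ∈ Icc a b := by
        rcases le_total τ' τ with h | h
        · rw [uIoc_of_le h] at hsm
          exact ⟨hτ'.1.trans hsm.1.le, hsm.2.trans hτ.2⟩
        · rw [uIoc_of_ge h] at hsm
          exact ⟨hτ.1.trans hsm.1.le, hsm.2.trans hτ'.2⟩
      have hs2 := hs ⟨ha.trans_le hs1.1, by linarith [hs1.2]⟩
      calc ‖S.B (w' s) (Q.F s q)‖ ≤ ‖S.B‖ * ‖w' s‖ * ‖Q.F s q‖ := S.B.le_opNorm₂ _ _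
        _ ≤ ‖S.B‖ * K.radius * (C * ‖q‖) := by
          gcongr
          · have := K.radius_nonneg
            positivity
          · exact K.norm_le _ hs2
          · exact hC s hs1 q
        _ = _ := by ring
    have h2 : inner ℝ (h - h') q =
        inner ℝ (P.E τ S.y0 - P.E τ' S.y0) q + ∫ s in τ'..τ, S.B (w' s) (Q.F s q) := by
      rw [inner_sub_left, hh, hh', ← pairing_congr Q hww, pairing, pairing, inner_sub_left,
        P.inner_E Q h0.le, P.inner_E Q h0'.le, integral_timeMeasure h0.le,
        integral_timeMeasure h0'.le, ← intervalIntegral.integral_interval_sub_left (hi τ h0)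
          (hi τ' h0')]
      ring
    rw [h2, add_mul]
    refine add_le_add (real_inner_le_norm _ _) ((le_abs_self _).trans (hb.trans_eq ?_))
    ring
  have := key (h - h')
  rw [real_inner_self_eq_norm_mul_norm] at this
  rcases (norm_nonneg (h - h')).eq_or_lt with hz | hz
  · rw [← hz]
    have := K.radius_nonneg
    positivity
  · exact le_of_mul_le_mul_right this hz

/-- The nearest reachable point depends continuously on time. -/
theorem tendsto_nearest (P : S.Flow) (K : S.Selector) {x : ℝ → H} (hx : ∀ τ, 0 < τ → IsNearest Q τ (x τ)) {τ₀ : ℝ}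
    (hτ₀ : 0 < τ₀) : Tendsto x (𝓝 τ₀) (𝓝 (x τ₀)) := by
  obtain ⟨C, hC⟩ := exists_reachable_near Q P K (a := τ₀ / 2) (b := τ₀ + 1) (by positivity)
  set r : ℝ → ℝ := fun τ => ‖P.E τ S.y0 - P.E τ₀ S.y0‖ + C * |τ - τ₀| with hr
  have hr0 : Tendsto r (𝓝 τ₀) (𝓝 0) := by
    have h1 : ContinuousAt (fun τ => P.E τ S.y0) τ₀ :=
      (P.continuousOn_E S.y0).continuousAt (Ici_mem_nhds hτ₀)
    have h2 : ContinuousAt r τ₀ := by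
      refine ContinuousAt.add (h1.sub continuousAt_const).norm ?_
      exact Continuous.continuousAt (by fun_prop)
    have h3 : r τ₀ = 0 := by simp [hr]
    rw [← h3]
    exact h2
  have hlim : Tendsto (fun τ => r τ + √((‖x τ₀ - S.yd‖ + 2 * r τ) ^ 2 - ‖x τ₀ - S.yd‖ ^ 2))
      (𝓝 τ₀) (𝓝 0) := by
    have hc : Continuous fun r : ℝ => r + √((‖x τ₀ - S.yd‖ + 2 * r) ^ 2 - ‖x τ₀ - S.yd‖ ^ 2) := by
      fun_prop
    have := (hc.tendsto 0).comp hr0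
    simpa [Function.comp_def] using this
  rw [tendsto_iff_norm_sub_tendsto_zero]
  refine squeeze_zero' (Eventually.of_forall fun _ => norm_nonneg _) ?_ hlim
  have hm : τ₀ ∈ Icc (τ₀ / 2) (τ₀ + 1) := ⟨by linarith, by linarith⟩
  filter_upwards [Icc_mem_nhds (show τ₀ / 2 < τ₀ by linarith) (show τ₀ < τ₀ + 1 by linarith)]
    with τ hτ
  have h0 : 0 < τ := (by positivity : 0 < τ₀ / 2).trans_le hτ.1
  obtain ⟨h', hh', hle'⟩ := hC τ hτ τ₀ hm _ (hx τ h0).1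
  obtain ⟨g, hg, hleg⟩ := hC τ₀ hm τ hτ _ (hx τ₀ hτ₀).1
  rw [norm_sub_rev (P.E τ₀ S.y0), abs_sub_comm] at hleg
  have e1 : ‖x τ - S.yd‖ ≤ ‖x τ₀ - S.yd‖ + r τ := by
    refine ((hx τ h0).2 g hg).trans ?_
    have : g - S.yd = (x τ₀ - S.yd) - (x τ₀ - g) := by abel
    rw [this]
    exact (norm_sub_le _ _).trans (by gcongr)
  have e2 : ‖h' - S.yd‖ ≤ ‖x τ₀ - S.yd‖ + 2 * r τ := by
    have : h' - S.yd = (x τ - S.yd) - (x τ - h') := by abel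
    rw [this]
    have := (norm_sub_le (x τ - S.yd) (x τ - h')).trans (add_le_add e1 hle')
    linarith
  have e3 := (norm_sub_sq_le_of_nearest (convex_reachable Q K hτ₀) (hx τ₀ hτ₀).1
    (hx τ₀ hτ₀).2 hh').2
  have e4 : ‖h' - x τ₀‖ ≤ √((‖x τ₀ - S.yd‖ + 2 * r τ) ^ 2 - ‖x τ₀ - S.yd‖ ^ 2) := by
    refine Real.le_sqrt_of_sq_le (e3.trans ?_)
    gcongr
  have : x τ - x τ₀ = (x τ - h') + (h' - x τ₀) := by abel
  rw [this]
  exact (norm_add_le _ _).trans (add_le_add hle' e4)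

end Nearest

end ControlSystem

/-- An envelope theorem for `D t = max_x G t x` with `G t x - G t₀ x = ∫ g`. -/
lemma hasDerivAt_of_envelope {X : Type*} [TopologicalSpace X] {D : ℝ → ℝ} {G g : ℝ → X → ℝ}
    {q : ℝ → X} {t₀ : ℝ}
    (hG : ∀ᶠ t in 𝓝 t₀, ∀ x, IntervalIntegrable (fun s => g s x) volume t₀ t ∧
      G t x - G t₀ x = ∫ s in t₀..t, g s x)
    (hD : ∀ᶠ t in 𝓝 t₀, G t (q t₀) ≤ D t ∧ G t₀ (q t) ≤ D t₀ ∧ D t ≤ G t (q t))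
    (hq : Tendsto q (𝓝 t₀) (𝓝 (q t₀)))
    (hg : Tendsto (fun z : ℝ × X => g z.1 z.2) (𝓝 (t₀, q t₀)) (𝓝 (g t₀ (q t₀)))) :
    HasDerivAt D (g t₀ (q t₀)) t₀ := by
  rw [hasDerivAt_iff_isLittleO, Asymptotics.isLittleO_iff]
  intro ε hε
  have h1 := hg.eventually (Metric.ball_mem_nhds _ hε)
  rw [nhds_prod_eq] at h1
  obtain ⟨p₁, hp₁, p₂, hp₂, hp⟩ := eventually_prod_iff.1 h1
  obtain ⟨η, hη, hball⟩ := Metric.eventually_nhds_iff.1 hp₁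
  have hq2 := hq.eventually hp₂
  have key : ∀ t, dist t t₀ < η → ∀ x, p₂ x → IntervalIntegrable (fun s => g s x) volume t₀ t →
      |(∫ s in t₀..t, g s x) - (t - t₀) * g t₀ (q t₀)| ≤ ε * |t - t₀| := by
    intro t ht x hx hint
    have e1 : (∫ s in t₀..t, g s x) - (t - t₀) * g t₀ (q t₀) =
        ∫ s in t₀..t, (g s x - g t₀ (q t₀)) := by
      rw [intervalIntegral.integral_sub hint intervalIntegrable_const,
        intervalIntegral.integral_const, smul_eq_mul]
    rw [e1, ← Real.norm_eq_abs]
    refine intervalIntegral.norm_integral_le_of_norm_le_const fun s hs => ?_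
    have hs1 : dist s t₀ < η := by
      refine lt_of_le_of_lt ?_ ht
      rw [Real.dist_eq, Real.dist_eq]
      exact abs_sub_left_of_mem_uIcc (uIoc_subset_uIcc hs)
    exact (hp (hball hs1) hx).le
  filter_upwards [hG, hD, hq2, Metric.ball_mem_nhds t₀ hη] with t h2 h3 h4 h5
  obtain ⟨-, -, h6⟩ := hD.self_of_nhds
  have a1 := key t h5 _ hq2.self_of_nhds (h2 (q t₀)).1
  have a2 := key t h5 _ h4 (h2 (q t)).1
  rw [← (h2 _).2] at a1 a2
  rw [Real.norm_eq_abs, Real.norm_eq_abs, smul_eq_mul]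
  rw [abs_le] at a1 a2 ⊢
  constructor <;> linarith [a1.1, a2.2, h3.1, h3.2.1, h3.2.2]

namespace ControlSystem

variable {V H ω : Type*}
  [NormedAddCommGroup V] [InnerProductSpace ℝ V] [CompleteSpace V]
  [NormedAddCommGroup H] [InnerProductSpace ℝ H] [CompleteSpace H]
  [MeasurableSpace ω] {ρ : Measure ω} {S : ControlSystem V H ω ρ}

namespace Selector

variable (K : S.Selector) (Q : S.dual.Flow)

/-- The minimum of `c ↦ ⟨B c, v⟩` over the admissible values. -/
noncomputable def minB (v : V) : ℝ := S.B (K.sel v) v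

lemma abs_B_le {c : Lp ℝ 2 ρ} (hc : c ∈ S.Uad) (v : V) : |S.B c v| ≤ ‖S.B‖ * K.radius * ‖v‖ := by
  rw [← Real.norm_eq_abs]
  refine (S.B.le_opNorm₂ c v).trans ?_
  gcongr
  exact K.norm_le c hc

lemma minB_sub_le (v w : V) : K.minB v - K.minB w ≤ ‖S.B‖ * K.radius * ‖v - w‖ := by
  have h1 := K.le v _ (K.sel_mem w)
  have h2 := (le_abs_self _).trans (K.abs_B_le (K.sel_mem w) (v - w))
  rw [map_sub] at h2
  unfold minB
  linarith

lemma abs_minB_sub_le (v w : V) : |K.minB v - K.minB w| ≤ ‖S.B‖ * K.radius * ‖v - w‖ := by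
  rw [abs_le]
  have h1 := K.minB_sub_le v w
  have h2 := K.minB_sub_le w v
  rw [norm_sub_rev] at h2
  constructor <;> linarith

lemma continuous_minB : Continuous K.minB :=
  (LipschitzWith.of_dist_le_mul (K := (‖S.B‖ * K.radius).toNNReal) fun v w => by
    rw [Real.coe_toNNReal _ (mul_nonneg (norm_nonneg S.B) K.radius_nonneg), dist_eq_norm,
      dist_eq_norm]
    exact K.abs_minB_sub_le v w).continuous

lemma sel_F_mem_UadTime {τ : ℝ} (hτ : 0 < τ) (q : H) :
    (fun s => K.sel (Q.F s q)) ∈ S.UadTime τ :=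
  K.mem_UadTime (K.aestronglyMeasurable _ _ (Q.memLp_F hτ q).1)
    (Eventually.of_forall fun _ => K.sel_mem _)

lemma integrable_minB {τ : ℝ} (hτ : 0 < τ) (q : H) :
    Integrable (fun s => K.minB (Q.F s q)) (timeMeasure τ) :=
  integrable_B (K.sel_F_mem_UadTime Q hτ q).1 (Q.memLp_F hτ q)

/-- The dual function: the minimum of `⟪h - yd, q⟫` over the reachable values `h` at time `τ`. -/
noncomputable def dualFun (τ : ℝ) (q : H) : ℝ :=
  inner ℝ S.y0 (Q.E τ q) - inner ℝ S.yd q + ∫ s, K.minB (Q.F s q) ∂timeMeasure τ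

/-- The time derivative of the dual function. -/
noncomputable def dualDeriv (s : ℝ) (q : H) : ℝ :=
  inner ℝ S.y0 (S.ι (Q.F' s q)) + K.minB (Q.F s q)

lemma dualFun_eq (τ : ℝ) (q : H) :
    K.dualFun Q τ q = pairing Q τ (fun s => K.sel (Q.F s q)) q - inner ℝ S.yd q := by
  unfold dualFun pairing minB
  ring

lemma dualFun_le {τ : ℝ} (hτ : 0 < τ) {h : H} (hh : h ∈ reachable Q τ) (q : H) :
    K.dualFun Q τ q ≤ inner ℝ (h - S.yd) q := by
  obtain ⟨w, hw, hhw⟩ := hh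
  rw [inner_sub_left, hhw, dualFun, pairing]
  have : ∫ s, K.minB (Q.F s q) ∂timeMeasure τ ≤ ∫ s, S.B (w s) (Q.F s q) ∂timeMeasure τ := by
    refine integral_mono_ae (K.integrable_minB Q hτ q) (integrable_B hw.1 (Q.memLp_F hτ q)) ?_
    filter_upwards [hw.2] with s hs using K.le _ _ hs
  linarith

lemma dualFun_nearest [FiniteDimensional ℝ (Lp ℝ 2 ρ)] {τ : ℝ} (hτ : 0 < τ) {x : H}
    (hx : IsNearest Q τ x) :
    ‖x - S.yd‖ ≤ K.dualFun Q τ (‖x - S.yd‖⁻¹ • (x - S.yd)) := by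
  set q := ‖x - S.yd‖⁻¹ • (x - S.yd) with hq
  obtain ⟨h, hh⟩ := exists_inner_eq_pairing Q hτ (K.sel_F_mem_UadTime Q hτ q).1
  have hmem : h ∈ reachable Q τ := ⟨_, K.sel_F_mem_UadTime Q hτ q, hh⟩
  rw [dualFun_eq, ← hh, ← inner_sub_left]
  have h1 := (norm_sub_sq_le_of_nearest (convex_reachable Q K hτ) hx.1 hx.2 hmem).1
  have h2 : h - S.yd = (h - x) + (x - S.yd) := by abel
  rw [h2, hq, inner_smul_right, inner_add_left, real_inner_self_eq_norm_mul_norm, real_inner_comm,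
    mul_add]
  have h3 : ‖x - S.yd‖⁻¹ * (‖x - S.yd‖ * ‖x - S.yd‖) = ‖x - S.yd‖ := by
    rw [← mul_assoc]
    exact inv_mul_mul_self _
  rw [h3]
  have := mul_nonneg (inv_nonneg.2 (norm_nonneg (x - S.yd))) h1
  linarith

lemma tendsto_dualDeriv {α : Type*} {l : Filter α} {τ : α → ℝ} {h : α → H} {t₀ : ℝ} {h₀ : H}
    (ht₀ : 0 < t₀) (hτ : Tendsto τ l (𝓝 t₀)) (hh : Tendsto h l (𝓝 h₀)) :
    Tendsto (fun x => K.dualDeriv Q (τ x) (h x)) l (𝓝 (K.dualDeriv Q t₀ h₀)) := by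
  refine Tendsto.add (Tendsto.inner tendsto_const_nhds ?_) ?_
  · exact (S.ι.continuous.tendsto _).comp (Q.tendsto_F' ht₀ hτ hh)
  · exact (K.continuous_minB.tendsto _).comp (Q.tendsto_F ht₀ hτ hh)

lemma dualFun_sub {a b : ℝ} (ha : 0 < a) (hb : 0 < b) (q : H) :
    IntervalIntegrable (fun s => K.dualDeriv Q s q) volume a b ∧
      K.dualFun Q b q - K.dualFun Q a q = ∫ s in a..b, K.dualDeriv Q s q := by
  have hpos : ∀ s ∈ uIcc a b, 0 < s := fun s hs => lt_of_lt_of_le (lt_min ha hb) hs.1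
  have h1 : IntervalIntegrable (fun s => inner ℝ S.y0 (S.ι (Q.F' s q))) volume a b := by
    refine ContinuousOn.intervalIntegrable ?_
    exact continuousOn_const.inner (S.ι.continuous.comp_continuousOn
      ((Q.continuousOn_F' q).mono hpos))
  have hi : ∀ T, 0 < T → IntervalIntegrable (fun s => K.minB (Q.F s q)) volume 0 T :=
    fun T hT => (integrable_timeMeasure_iff hT.le _).1 (K.integrable_minB Q hT q)
  have h2 : IntervalIntegrable (fun s => K.minB (Q.F s q)) volume a b := (hi a ha).symm.trans (hi b hb)
  refine ⟨h1.add h2, ?_⟩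
  unfold dualDeriv dualFun
  rw [intervalIntegral.integral_add h1 h2,
    intervalIntegral.integral_eq_sub_of_hasDerivAt (f := fun s => inner ℝ S.y0 (Q.E s q))
      (fun s hs => by
        refine ((hasDerivAt_const s S.y0).inner ℝ (Q.hasDerivAt_E (hpos s hs) q)).congr_deriv ?_
        rw [inner_zero_left, add_zero]
        rfl) h1,
    integral_timeMeasure ha.le, integral_timeMeasure hb.le,
    ← intervalIntegral.integral_interval_sub_left (hi b hb) (hi a ha)]
  ring

end Selector

/-- The distance from `yd` to the reachable set is differentiable in time where it is positive. -/
theorem hasDerivAt_nearest [FiniteDimensional ℝ (Lp ℝ 2 ρ)] (P : S.Flow) (Q : S.dual.Flow)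
    (K : S.Selector) {x : ℝ → H} (hx : ∀ τ, 0 < τ → IsNearest Q τ (x τ)) {τ₀ : ℝ} (hτ₀ : 0 < τ₀)
    (hpos : 0 < ‖x τ₀ - S.yd‖) :
    HasDerivAt (fun τ => ‖x τ - S.yd‖)
        (K.dualDeriv Q τ₀ (‖x τ₀ - S.yd‖⁻¹ • (x τ₀ - S.yd))) τ₀ ∧
      ContinuousAt (fun τ => K.dualDeriv Q τ (‖x τ - S.yd‖⁻¹ • (x τ - S.yd))) τ₀ := by
  have hxt := tendsto_nearest Q P K hx hτ₀
  have hq : Tendsto (fun τ => ‖x τ - S.yd‖⁻¹ • (x τ - S.yd)) (𝓝 τ₀)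
      (𝓝 (‖x τ₀ - S.yd‖⁻¹ • (x τ₀ - S.yd))) :=
    ((hxt.sub_const _).norm.inv₀ hpos.ne').smul (hxt.sub_const _)
  have hle : ∀ τ, 0 < τ → ∀ z : H, K.dualFun Q τ (‖z‖⁻¹ • z) ≤ ‖x τ - S.yd‖ := by
    intro τ hτ z
    refine (K.dualFun_le Q hτ (hx τ hτ).1 _).trans ((real_inner_le_norm _ _).trans ?_)
    refine mul_le_of_le_one_right (norm_nonneg _) ?_
    rw [norm_smul, norm_inv, norm_norm]
    exact inv_mul_le_one
  refine ⟨?_, K.tendsto_dualDeriv Q hτ₀ tendsto_id hq⟩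
  refine hasDerivAt_of_envelope (G := K.dualFun Q) (g := K.dualDeriv Q)
    (q := fun τ => ‖x τ - S.yd‖⁻¹ • (x τ - S.yd)) ?_ ?_ hq
    (K.tendsto_dualDeriv Q hτ₀ continuous_fst.continuousAt continuous_snd.continuousAt)
  · filter_upwards [lt_mem_nhds hτ₀] with τ hτ q using K.dualFun_sub Q hτ₀ hτ q
  · filter_upwards [lt_mem_nhds hτ₀] with τ hτ
    exact ⟨hle τ hτ _, hle τ₀ hτ₀ _, K.dualFun_nearest Q hτ (hx τ hτ)⟩

lemma minDist_eq [FiniteDimensional ℝ (Lp ℝ 2 ρ)] (Q : S.dual.Flow) {τ : ℝ} (hτ : 0 < τ) {x : H}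
    (hx : IsNearest Q τ x) : S.minDist τ = ‖x - S.yd‖ - S.δ0 := by
  have hiff := fun h => mem_reachable_iff Q one_pos hτ (h := h)
  rw [one_mul] at hiff
  refine IsLeast.csInf_eq ⟨?_, ?_⟩
  · obtain ⟨u, hu, hh⟩ := (hiff x).1 hx.1
    exact ⟨u, hu, x, hh, rfl⟩
  · rintro _ ⟨u, hu, h, hh, rfl⟩
    exact sub_le_sub_right (hx.2 h ((hiff h).2 ⟨u, hu, hh⟩)) _

namespace Flow

lemma E_ι_F' (P : S.Flow) {s r : ℝ} (hs : 0 ≤ s) (hr : 0 < r) (h : H) :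
    P.E s (S.ι (P.F' r h)) = S.ι (P.F' (s + r) h) := by
  have h1 : HasDerivAt (fun r => P.E (s + r) h) (S.ι (P.F' (s + r) h)) r :=
    (P.hasDerivAt_E (by linarith : 0 < s + r) h).comp_const_add s r
  have h2 : HasDerivAt (fun r => P.E s (P.E r h)) (P.E s (S.ι (P.F' r h))) r :=
    (P.E s).hasFDerivAt.comp_hasDerivAt r (P.hasDerivAt_E hr h)
  refine h2.unique (h1.congr_of_eventuallyEq ?_)
  filter_upwards [lt_mem_nhds hr] with r hr
  exact (P.E_add s r hs hr.le h).symm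

lemma F_ι_F' (P : S.Flow) {s r : ℝ} (hs : 0 < s) (hr : 0 < r) (h : H) :
    P.F s (S.ι (P.F' r h)) = P.F' (s + r) h := by
  apply S.ι_injective
  rw [P.ι_F s hs, P.E_ι_F' hs.le hr]

end Flow

/-- The chain rule for the minimum function along a curve with minimizing controls. -/
lemma Selector.minB_sub_eq_integral (K : S.Selector) {t : ℝ} (ht : 0 < t) {b b' : ℝ → V}
    (hb : ∀ s ∈ Icc 0 t, HasDerivAt b (b' s) s) (hb' : ContinuousOn b' (Icc 0 t))
    {u : ℝ → Lp ℝ 2 ρ}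
    (hu : ∀ᵐ s ∂timeMeasure t, u s ∈ S.Uad ∧ S.B (u s) (b s) = K.minB (b s)) :
    K.minB (b t) - K.minB (b 0) = ∫ s in (0)..t, S.B (u s) (b' s) := by
  obtain ⟨C, hC⟩ := isCompact_Icc.exists_bound_of_continuousOn hb'
  have hC0 : 0 ≤ C := (norm_nonneg _).trans (hC 0 ⟨le_rfl, ht.le⟩)
  have hr := K.radius_nonneg
  have hlip : LipschitzOnWith (‖S.B‖ * K.radius * C).toNNReal (fun s => K.minB (b s))
      (uIcc 0 t) := by
    refine LipschitzOnWith.of_dist_le_mul fun x hx y hy => ?_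
    rw [uIcc_of_le ht.le] at hx hy
    rw [Real.coe_toNNReal _ (by positivity), dist_eq_norm, dist_eq_norm, mul_assoc]
    refine (K.abs_minB_sub_le _ _).trans ?_
    gcongr
    exact (convex_Icc 0 t).norm_image_sub_le_of_norm_hasDerivWithin_le
      (fun s hs => (hb s hs).hasDerivWithinAt) hC hy hx
  have hac := hlip.absolutelyContinuousOnInterval
  rw [← hac.integral_deriv_eq_sub, ← integral_timeMeasure ht.le, ← integral_timeMeasure ht.le]
  refine integral_congr_ae ?_
  filter_upwards [hu, ae_timeMeasure_mem t, ae_restrict_of_ae hac.ae_differentiableAt]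
    with s hs hst hd
  have hst' : s ∈ Icc 0 t := Ioo_subset_Icc_self hst
  have h1 := (hd (by rwa [uIcc_of_le ht.le])).hasDerivAt
  have h2 : HasDerivAt (fun r => S.B (u s) (b r)) (S.B (u s) (b' s)) s :=
    (S.B (u s)).hasFDerivAt.comp_hasDerivAt s (hb s hst')
  have hmin : IsLocalMin (fun r => S.B (u s) (b r) - K.minB (b r)) s := by
    refine Eventually.of_forall fun r => ?_
    simp only [hs.2, sub_self]
    exact sub_nonneg.2 (K.le _ _ hs.1)
  have := hmin.hasDerivAt_eq_zero (h2.sub h1)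
  exact (sub_eq_zero.1 this).symm

/-- The Hamiltonian is constant along optimal trajectories. -/
theorem integral_derivExpr (P : S.Flow) (Q : S.dual.Flow) (K : S.Selector) {ν : ℝ} (hν : 0 < ν)
    {u : ℝ → Lp ℝ 2 ρ} (hu : u ∈ S.UadTime 1) {y p : ℝ → V} {h q : H} (hy : S.IsState 1 ν u y)
    (hh : S.HasTrace 1 y 1 h) (hq : inner ℝ (h - S.yd) q ≤ K.dualFun Q ν q)
    (hp : S.IsAdjointState ν q p) :
    ∫ t, (S.B (u t) - S.a (y t)) (p t) ∂(timeMeasure 1) = K.dualDeriv Q ν q := by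
  have hreach : S.Reaches 1 ν u h := ⟨y, hy, hh⟩
  have hpair := hreach.inner_eq Q one_pos hν hu.1 q
  have hw := mem_UadTime_comp_reversal (S := S) (T := ν * 1) (inv_pos.2 hν) (u := u)
    (by rwa [inv_mul_cancel_left₀ hν.ne'])
  simp only [mul_one] at hpair hw
  have hopt : ∀ᵐ s ∂timeMeasure ν, S.B (u (ν⁻¹ * (ν - s))) (Q.F s q) = K.minB (Q.F s q) := by
    have hi1 := integrable_B (S := S) hw.1 (Q.memLp_F hν q)
    have hi2 := K.integrable_minB Q hν q
    have hnn : 0 ≤ᵐ[timeMeasure ν]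
        fun s => S.B (u (ν⁻¹ * (ν - s))) (Q.F s q) - K.minB (Q.F s q) := by
      filter_upwards [hw.2] with s hs using sub_nonneg.2 (K.le _ _ hs)
    have h0 : ∫ s, (S.B (u (ν⁻¹ * (ν - s))) (Q.F s q) - K.minB (Q.F s q)) ∂timeMeasure ν = 0 := by
      refine le_antisymm ?_ (integral_nonneg_of_ae hnn)
      rw [integral_sub hi1 hi2]
      rw [inner_sub_left, hpair, pairing, Selector.dualFun] at hq
      linarith
    filter_upwards [(integral_eq_zero_iff_of_nonneg_ae hnn (hi1.sub hi2)).1 h0] with s hs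
    exact sub_eq_zero.1 hs
  have hopt' : ∀ᵐ t ∂timeMeasure 1,
      S.B (u t) (Q.F (ν * (1 - t)) q) = K.minB (Q.F (ν * (1 - t)) q) := by
    have := ae_comp_reversal (T := 1) hν (by rwa [mul_one])
    filter_upwards [this] with t ht
    rwa [show ν⁻¹ * (ν - ν * (1 - t)) = t by field_simp; ring] at ht
  obtain ⟨⟨g, hW, hg⟩, Y, hY, hYy, hY0⟩ := hy
  have hconst : ∀ t ∈ Ioo (0 : ℝ) 1, K.minB (Q.F (ν * (1 - t)) q) +
      inner ℝ (Y t) (S.ι (Q.F' (ν * (1 - t)) q)) = K.dualDeriv Q ν q := by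
    intro t ht
    have hpos : ∀ s ∈ Icc 0 t, 0 < ν * (1 - s) :=
      fun s hs => mul_pos hν (by linarith [hs.2, ht.2])
    have h1 := K.minB_sub_eq_integral ht.1 (b := fun s => Q.F (ν * (1 - s)) q)
      (b' := fun s => -(ν • Q.F' (ν * (1 - s)) q)) (u := u)
      (fun s hs => by
        have e1 := Q.hasDerivAt_F _ (hpos s hs) q
        have e2 : HasDerivAt (fun r => ν * (1 - r)) (-ν) s := by
          simpa using ((hasDerivAt_id s).const_sub 1).const_mul ν
        have := e1.scomp s e2
        simpa [Function.comp_def] using this)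
      (((Q.continuousOn_F' q).comp (by fun_prop) fun s hs => hpos s hs).const_smul ν).neg
      (by
        have hle := timeMeasure_mono ht.2.le
        filter_upwards [ae_mono hle hu.2, ae_mono hle hopt'] with s h1 h2 using ⟨h1, h2⟩)
    have h2 := inner_state Q hν hu.1 hW hg hY hYy ht.1 ht.2.le (S.ι (Q.F' (ν * (1 - t)) q))
    have hpt := hpos t ⟨ht.1.le, le_rfl⟩
    have e1 : Q.E (ν * t) (S.ι (Q.F' (ν * (1 - t)) q)) = S.ι (Q.F' ν q) := by
      have := Q.E_ι_F' (mul_nonneg hν.le ht.1.le) hpt q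
      rwa [show ν * t + ν * (1 - t) = ν by ring] at this
    have e2 : ∫ s in (0)..t, S.B (u s) (Q.F (ν * (t - s)) (S.ι (Q.F' (ν * (1 - t)) q))) =
        ∫ s in (0)..t, S.B (u s) (Q.F' (ν * (1 - s)) q) := by
      rw [← integral_timeMeasure ht.1.le, ← integral_timeMeasure ht.1.le]
      refine integral_congr_ae ?_
      filter_upwards [ae_timeMeasure_mem t] with s hs
      have := Q.F_ι_F' (mul_pos hν (by linarith [hs.2] : 0 < t - s)) hpt q
      rw [show ν * (t - s) + ν * (1 - t) = ν * (1 - s) by ring] at this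
      exact congrArg _ this
    simp only [map_neg, map_smul, smul_eq_mul, intervalIntegral.integral_neg,
      intervalIntegral.integral_const_mul, sub_zero, mul_one] at h1
    rw [e1, e2, hY0] at h2
    rw [h2, Selector.dualDeriv]
    linarith
  have hfin : ∀ᵐ t ∂timeMeasure 1, (S.B (u t) - S.a (y t)) (p t) = K.dualDeriv Q ν q := by
    filter_upwards [hopt', hYy, adjointState_eq P Q hν hp, ae_timeMeasure_mem 1] with t h1 h2 h3 ht
    have e1 : inner ℝ (S.ι (Q.F' (ν * (1 - t)) q)) (S.ι (y t)) =
        -S.a (y t) (Q.F (ν * (1 - t)) q) :=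
      DFunLike.congr_fun (Q.equation _ (mul_pos hν (by linarith [ht.2])) q) (y t)
    rw [← hconst t ht, h3, sub_apply, h1, h2, real_inner_comm, e1]
    ring
  rw [integral_congr_ae hfin, integral_timeMeasure zero_le_one]
  simp

end ControlSystem

end ParabolicControl

open ParabolicControl ControlSystem

theorem mainTheorem8 {V H : Type*}
    [NormedAddCommGroup V] [InnerProductSpace ℝ V] [CompleteSpace V]
    [NormedAddCommGroup H] [InnerProductSpace ℝ H] [CompleteSpace H]
    (N : ℕ)
    (S : ParabolicControl.ControlSystem V H (Fin N) (MeasureTheory.Measure.count))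
    (ν : ℝ) (hν : 0 < ν) (hδ : -S.δ0 < S.minDist ν) :
    (S.argminSet ν).Nonempty ∧
    ∃ d : ℝ,
      (∀ u ∈ S.argminSet ν, ∀ e : ℝ, S.IsDerivExpr ν u e ↔ e = d) ∧
      HasDerivAt S.minDist d ν ∧
      ContDiffAt ℝ 1 S.minDist ν := by
  obtain ⟨P⟩ := S.exists_flow
  obtain ⟨Q⟩ := S.dual.exists_flow
  obtain ⟨K⟩ := S.exists_selector
  have hex : ∀ τ, 0 < τ → ∃ x, IsNearest Q τ x := fun τ hτ => exists_forall_norm_sub_le Q K hτ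
  choose! x hx using hex
  have hiff : ∀ h, h ∈ reachable Q ν ↔ ∃ u ∈ S.UadTime 1, S.Reaches 1 ν u h := fun h => by
    rw [← mem_reachable_iff Q hν one_pos, mul_one]
  have hD : ∀ τ, 0 < τ → S.minDist τ = ‖x τ - S.yd‖ - S.δ0 := fun τ hτ => minDist_eq Q hτ (hx τ hτ)
  have hpos : 0 < ‖x ν - S.yd‖ := by
    rw [hD ν hν] at hδ
    linarith
  set d : ℝ → ℝ := fun τ => K.dualDeriv Q τ (‖x τ - S.yd‖⁻¹ • (x τ - S.yd)) with hd
  have hderiv : ∀ τ, 0 < τ → 0 < ‖x τ - S.yd‖ → HasDerivAt S.minDist (d τ) τ := by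
    intro τ hτ h0
    refine ((hasDerivAt_nearest P Q K hx hτ h0).1.sub_const S.δ0).congr_of_eventuallyEq ?_
    filter_upwards [lt_mem_nhds hτ] with σ hσ using hD σ hσ
  refine ⟨?_, d ν, ?_, hderiv ν hν hpos, ?_⟩
  · obtain ⟨u, hu, hh⟩ := (hiff _).1 (hx ν hν).1
    exact ⟨u, hu, x ν, hh, fun u' hu' h' hh' => (hx ν hν).2 h' ((hiff h').2 ⟨u', hu', hh'⟩)⟩
  · rintro u ⟨hu, h, hh, hmin⟩
    have hmin' : ∀ h' ∈ reachable Q ν, ‖h - S.yd‖ ≤ ‖h' - S.yd‖ := fun h' hh' => by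
      obtain ⟨u', hu', hr⟩ := (hiff h').1 hh'
      exact hmin u' hu' h' hr
    have hxh : x ν = h := by
      have h1 := (norm_sub_sq_le_of_nearest (convex_reachable Q K hν) ((hiff h).2 ⟨u, hu, hh⟩)
        hmin' (hx ν hν).1).2
      have h2 := (hx ν hν).2 h ((hiff h).2 ⟨u, hu, hh⟩)
      have h3 := pow_le_pow_left₀ (norm_nonneg _) h2 2
      have h4 : ‖x ν - h‖ ^ 2 = 0 := le_antisymm (by linarith) (sq_nonneg _)
      exact sub_eq_zero.1 (norm_eq_zero.1 (pow_eq_zero_iff two_ne_zero |>.1 h4))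
    have hval : ∀ (y p : ℝ → V) (k : H), S.IsState 1 ν u y → S.HasTrace 1 y 1 k →
        S.IsAdjointState ν (‖k - S.yd‖⁻¹ • (k - S.yd)) p →
        ∫ t, (S.B (u t) - S.a (y t)) (p t) ∂(timeMeasure 1) = d ν := by
      intro y p k hy hk hp
      have hkx : k = x ν := by
        have hk' : S.Reaches 1 ν u k := ⟨y, hy, hk⟩
        rw [hxh]
        refine ext_inner_right ℝ fun q => ?_
        rw [hk'.inner_eq Q one_pos hν hu.1, hh.inner_eq Q one_pos hν hu.1]
      subst hkx
      refine integral_derivExpr P Q K hν hu hy hk ?_ hp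
      refine le_trans (le_of_eq ?_) (K.dualFun_nearest Q hν (hx ν hν))
      rw [inner_smul_right, real_inner_self_eq_norm_mul_norm, inv_mul_cancel_left₀ hpos.ne']
    intro e
    constructor
    · rintro ⟨y, p, k, hy, hk, hp, rfl⟩
      exact hval y p k hy hk hp
    · rintro rfl
      obtain ⟨y, hy, hk⟩ := hh
      have hp := isAdjointState_flow Q hν (‖h - S.yd‖⁻¹ • (h - S.yd))
      exact ⟨y, _, h, hy, hk, hp, (hval y _ h hy hk hp).symm⟩
  · have hxc : ContinuousAt x ν := tendsto_nearest Q P K hx hν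
    have hev : ∀ᶠ τ in 𝓝 ν, 0 < τ ∧ 0 < ‖x τ - S.yd‖ :=
      (lt_mem_nhds hν).and ((hxc.sub continuousAt_const).norm.eventually (lt_mem_nhds hpos))
    refine contDiffAt_one_iff.2 ⟨fun τ => ContinuousLinearMap.toSpanSingleton ℝ (d τ), _, hev,
      fun τ hτ => ?_, fun τ hτ => hderiv τ hτ.1 hτ.2⟩
    refine ContinuousAt.continuousWithinAt ?_
    exact (ContinuousLinearMap.toSpanSingletonLIE ℝ ℝ).continuous.continuousAt.comp
      (hasDerivAt_nearest P Q K hx hτ.1 hτ.2).2
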